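/- **Setting.** Let $n,p\ge 1$. Vertices are $0$ (leader) and $1,\dots,n$ (followers). A weighted digraph on these vertices is given by weights $a_{ij}\ge 0$, $a_{ii}=0$, with $a_{ij}>0$ iff $(j\to i)$ is an edge; its Laplacian has $l_{ij}=-a_{ij}$ for $i\ne j$, $l_{ii}=\sum_{k\neq i}a_{ik}$ ($k$ from $0$ to $n$), and $\mathcal L_{22}$ is its block for the followers. Let $\mathcal G_A=(a_{ij})$ be a fixed digraph containing a directed spanning tree rooted at $0$. *Agents.* Fix constants $0<k_m\le k_M$, $k_C,k_g,k_p,k_q,k_a,k_b>0$, $k_\zeta\ge 0$. Follower $i$ obeys $M_i(q_i)\ddot q_i+C_i(q_i,\dot q_i)\dot q_i+g_i(q_i)+\zeta_i(t)=\tau_i$, $q_i\in\mathbb R^p$, with $M_i$ of class $C^1$, $C_i$ and $g_i$ continuous, and (P1) $M_i$ symmetric positive definite; (P2) $k_mI\le M_i\le k_MI$; (P3) $\dot M_i=C_i+C_i^\top$, where $\dot M_i$ is the derivative of $M_i$ at $q_i$ in direction $\dot q_i$; (P4) $\|C_i(q,v)\|_2\le k_C\|v\|_2$, $\|g_i\|_2<k_g$;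 (P5) $\|\zeta_i(t)\|_2\le k_\zeta$. *Leader and initial data.* $q_0$ is $C^2$ on $[0,\infty)$ with $\|\mathbf 1_n\otimes\dot q_0\|_2\le k_p$, $\|\mathbf 1_n\otimes\ddot q_0\|_2\le k_q$; and $\|q_i(0)\|_2\le k_a/\sqrt n$, $\|\dot q_i(0)\|_2\le k_b/\sqrt n$ for $i=0,\dots,n$. *Observer.* On a time-varying digraph $\mathcal G_B(t)=(b_{ij}(t))$ that for every $t\ge0$ contains a directed spanning tree rooted at $0$, with $\omega_1>0$, $\omega_2>k_q/\sqrt n$ and $\hat r_0=q_0$, $\hat v_0=\dot q_0$, $$\dot{\hat r}_i=\hat v_i-\omega_1\,\mathrm{sgn}\Big(\sum_{j=0}^n b_{ij}(\hat r_i-\hat r_j)\Big),\qquad \dot{\hat v}_i=-\omega_2\,\mathrm{sgn}\Big(\sum_{j=0}^n b_{ij}(\hat v_i-\hat v_j)\Big).$$ The estimates have arbitrary initial values. *Control law.* $\tau_i=-\eta\sum_{j=0}^n a_{ij}\big((q_i-q_j)+\mu(\dot q_i-\dot q_j)\big)-\beta\,\mathrm{sgn}\big((q_i-\hat r_i)+\mu(\dot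 q_i-\hat v_i)\big)$. Solutions are Filippov solutions (locally absolutely continuous, inclusion almost everywhere) of the closed loop with state $(q,\dot q,\hat r,\hat v)$ on an interval $[0,\tau)$, $0<\tau\le\infty$. Let $\tilde q$ be the stacked vector of the $q_i-q_0$ and $z=(\tilde q,\dot{\tilde q})$. **Gain inequalities.** Let $\Gamma=\mathrm{diag}(\gamma_1,\dots,\gamma_n)>0$ with $\max_i\gamma_i=1$, $\underline\gamma=\min_i\gamma_i$ and $\Gamma\mathcal L_{22}+\mathcal L_{22}^\top\Gamma>0$; $X=(\Gamma\mathcal L_{22}+\mathcal L_{22}^\top\Gamma)\otimes I_p$, with extreme eigenvalues $\lambda_{\min},\lambda_{\max}$; $0<\delta<k_m$; $\mu_3>\max\big\{\sqrt{(k_M+\delta)/(2\lambda_{\max})},\sqrt{2\underline\gamma(k_m-\delta)/\lambda_{\min}}\big\}$. Put $\kappa=\underline\gamma(k_m-\delta)$ and $$W(x,y)=\eta\lambda_{\max}x^2+\tfrac12(k_M+\delta)y^2+\mu_3^{-1}(k_M+\delta)xy,$$ $$\rho_2=\tfrac14\eta\lambda_{\min}-\tfrac12\mu_3^{-2}\kappa,\qquad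 \sigma_2=\tfrac12\kappa-\frac{(\tfrac12\mu_3^{-1}\kappa)^2}{\tfrac14\eta\lambda_{\min}},$$ $\bar V^*=W(2k_a,2k_b)$, $\mathcal X_1=\sqrt{\bar V^*/\rho_2}$, $\mathcal Y_1=\sqrt{\bar V^*/\sigma_2}$, $\hat V^*=W(\mathcal X_1,\mathcal Y_1)$, $\mathcal X=\sqrt{\hat V^*/\rho_2}$, $\mathcal Y=\sqrt{\hat V^*/\sigma_2}$, $\varphi=\tfrac12\mu^2\eta\lambda_{\min}-\mu k_Ck_p-k_M$, $\xi=k_g+k_\zeta+k_Mk_q$, $$g(x,y)=\varphi y^2+\tfrac12\eta\lambda_{\min}x^2-2k_Ck_pxy-k_Cxy^2,$$ $$h(x,y)=g(x,y)-\big(\sqrt{np}\,\beta+k_Ck_p^2+\sqrt n(k_g+k_\zeta)+k_Mk_q\big)(x+\mu y).$$ The gain inequalities for $(\mu,\eta,\beta)$, with auxiliary widths $\vartheta,\varepsilon$, are: $\beta>(k_Ck_p^2+\xi)/\underline\gamma$; $\mu\ge\mu_3$, $\mu>\sqrt{2k_M/\lambda_{\min}}$; $\eta>1$; $\varphi>\frac{(2k_Ck_p)^2}{2\eta\lambda_{\min}}+k_C\mathcal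 X$; $\mathcal X-\mathcal X_1<\vartheta<\mathcal X$; $\mathcal Y-\mathcal Y_1<\varepsilon<\mathcal Y$; and $h(x,y)>0$ for all $(x,y)\in[0,\mathcal X]\times[0,\mathcal Y]$ with $x\ge\mathcal X-\vartheta$ or $y\ge\mathcal Y-\varepsilon$. Let further $$L_\mu=\begin{bmatrix}\eta\lambda_{\max}I_{np}&\frac{k_M+\delta}{2\mu}I_{np}\\ \frac{k_M+\delta}{2\mu}I_{np}&\frac{k_M+\delta}2I_{np}\end{bmatrix},\qquad N_\mu=\frac12\begin{bmatrix}\frac12\eta\lambda_{\min}I_{np}&\mu^{-1}\kappa I_{np}\\ \mu^{-1}\kappa I_{np}&\kappa I_{np}\end{bmatrix}.$$ **Theorem.** (1) Admissible $\Gamma,\delta,\mu_3$ exist. (2) For all admissible $\Gamma,\delta,\mu_3$, every $\beta>(k_Ck_p^2+\xi)/\underline\gamma$ and every $\mu\ge\mu_3$ with $\mu>\sqrt{2k_M/\lambda_{\min}}$, there is $\eta_0$ such that for every $\eta\ge\eta_0$ the gain inequalities hold for some $\vartheta,\varepsilon$. In particular gains satisfying the inequalities always exist; they depend only on $n,p,\mathcal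 G_A$ and the constants $k_m,\dots,k_b$. (3) Suppose the gain inequalities hold. Then there is $a_3>0$ with $\mu^{-1}g(x,y)\ge a_3(x^2+y^2)$ on $[0,\mathcal X]\times[0,\mathcal Y]$. For all agents, disturbances, leader trajectory, graph $\mathcal G_B(\cdot)$, observer gains and initial data as above, every Filippov solution on $[0,\tau)$ satisfies: - $\|\tilde q(t)\|_2<\mathcal X$ and $\|\dot{\tilde q}(t)\|_2<\mathcal Y$ for all $t\in[0,\tau)$; - there is $T_1\in[0,\infty)$ such that $\hat r_i(t)=q_0(t)$ and $\hat v_i(t)=\dot q_0(t)$ for all $i$ and all $t\in[T_1,\tau)$; - for every such $T_1$, every such $a_3$ and all $t\in[T_1,\tau)$, $$\|z(t)\|_2\le\sqrt{\frac{\lambda_{\max}(L_\mu)}{\lambda_{\min}(N_\mu)}}\;\|z(T_1)\|_2\;\exp\Big(-\frac{a_3}{2\lambda_{\max}(L_\mu)}(t-T_1)\Big);$$ - if $\tau=\infty$, then $\|q_i(t)-q_0(t)\|_2\to0$ and $\|\dot q_i(t)-\dot q_0(t)\|_2\to0$ as $t\to\infty$ for every follower $i$. -/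

import Mathlib

open Set Filter Topology MeasureTheory
open scoped Matrix Kronecker

namespace LeaderTracking

/-! ### Vectors and eigenvalues -/

/-- The space `ℝ^p` of generalised coordinates of one agent, with the Euclidean norm. -/
abbrev Coord (p : ℕ) := EuclideanSpace ℝ (Fin p)

/-- A family of `n` vectors of `ℝ^p`, thought of as a stacked vector of `ℝ^{np}`. -/
abbrev Stack (n p : ℕ) := Fin n → Coord p

/-- The Euclidean norm of the stacked vector. -/
noncomputable def stackNorm {n p : ℕ} (x : Stack n p) : ℝ := Real.sqrt (∑ i, ‖x i‖ ^ 2)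

/-- The signum function, element by element. -/
noncomputable def sgnVec {p : ℕ} (x : Coord p) : Coord p :=
  WithLp.toLp 2 (fun k => Real.sign (x k))

/-- The smallest eigenvalue of a real symmetric matrix. -/
noncomputable def lamMin {ι : Type} [Fintype ι] [DecidableEq ι] (S : Matrix ι ι ℝ) : ℝ :=
  sInf (spectrum ℝ S)

/-- The largest eigenvalue of a real symmetric matrix. -/
noncomputable def lamMax {ι : Type} [Fintype ι] [DecidableEq ι] (S : Matrix ι ι ℝ) : ℝ :=
  sSup (spectrum ℝ S)

/-! ### Weighted directed graphs on the vertices `0` (leader), `1, …, n` (followers) -/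

/-- `A i j` is the weight of the edge from `j` to `i` (positive iff the edge is present). -/
structure IsAdjacency {n : ℕ} (A : Matrix (Fin (n + 1)) (Fin (n + 1)) ℝ) : Prop where
  nonneg : ∀ i j, 0 ≤ A i j
  diag : ∀ i, A i i = 0

/-- The graph contains a directed spanning tree rooted at vertex `0`: every other vertex `v` is
given exactly one parent `par v`, joined to `v` by an edge `par v → v` of the graph, and
following the parents leads from every vertex to the root. -/
def HasSpanningTree {n : ℕ} (A : Matrix (Fin (n + 1)) (Fin (n + 1)) ℝ) : Prop :=
  ∃ par : Fin (n + 1) → Fin (n + 1),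
    (∀ v, v ≠ 0 → 0 < A v (par v)) ∧ ∀ v, ∃ m : ℕ, par^[m] v = 0

/-- The Laplacian matrix of a weighted directed graph. -/
def laplacian {n : ℕ} (A : Matrix (Fin (n + 1)) (Fin (n + 1)) ℝ) :
    Matrix (Fin (n + 1)) (Fin (n + 1)) ℝ :=
  Matrix.of fun i j => if i = j then ∑ k ∈ Finset.univ.erase i, A i k else - A i j

/-- The block of the Laplacian belonging to the followers. -/
def lap22 {n : ℕ} (A : Matrix (Fin (n + 1)) (Fin (n + 1)) ℝ) : Matrix (Fin n) (Fin n) ℝ :=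
  (laplacian A).submatrix Fin.succ Fin.succ

/-! ### Euler–Lagrange agents and the leader -/

/-- The data of an Euler–Lagrange equation `M(q) q̈ + C(q, q̇) q̇ + g(q) + ζ(t) = τ`. The `p × p`
matrices are operators on Euclidean space, so their norm is the induced 2-norm and their
transpose is the adjoint. -/
structure Agent (p : ℕ) where
  M : Coord p → Coord p →L[ℝ] Coord p
  C : Coord p → Coord p → Coord p →L[ℝ] Coord p
  g : Coord p → Coord p
  ζ : ℝ → Coord p

/-- The known constants: bounds on the agents' dynamics and disturbances, on the leader's
velocity and acceleration, and on the initial conditions. -/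
structure Bounds where
  km : ℝ
  kM : ℝ
  kC : ℝ
  kg : ℝ
  kζ : ℝ
  kp : ℝ
  kq : ℝ
  ka : ℝ
  kb : ℝ

structure Bounds.Valid (k : Bounds) : Prop where
  km_pos : 0 < k.km
  km_le_kM : k.km ≤ k.kM
  kC_pos : 0 < k.kC
  kg_pos : 0 < k.kg
  kζ_nonneg : 0 ≤ k.kζ
  kp_pos : 0 < k.kp
  kq_pos : 0 < k.kq
  ka_pos : 0 < k.ka
  kb_pos : 0 < k.kb

/-- The standing properties of an Euler–Lagrange agent. -/
structure Agent.Satisfies {p : ℕ} (a : Agent p) (k : Bounds) : Prop where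
  smooth_M : ContDiff ℝ 1 a.M
  cont_C : Continuous fun x : Coord p × Coord p => a.C x.1 x.2
  cont_g : Continuous a.g
  symm : ∀ q, ContinuousLinearMap.adjoint (a.M q) = a.M q
  posDef : ∀ q v, v ≠ 0 → 0 < inner ℝ v (a.M q v)
  lower : ∀ q v, k.km * ‖v‖ ^ 2 ≤ inner ℝ v (a.M q v)
  upper : ∀ q v, inner ℝ v (a.M q v) ≤ k.kM * ‖v‖ ^ 2
  /-- `Ṁ = C + Cᵀ`, where `Ṁ` is the derivative of `M` at `q` in the direction `q̇ = v`. -/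
  skew : ∀ q v, fderiv ℝ a.M q v = a.C q v + ContinuousLinearMap.adjoint (a.C q v)
  bound_C : ∀ q v, ‖a.C q v‖ ≤ k.kC * ‖v‖
  bound_g : ∀ q, ‖a.g q‖ < k.kg
  bound_ζ : ∀ t, 0 ≤ t → ‖a.ζ t‖ ≤ k.kζ

/-- The trajectory of the leader with its first and second derivative. -/
structure Leader (p : ℕ) where
  q : ℝ → Coord p
  dq : ℝ → Coord p
  ddq : ℝ → Coord p

/-- The trajectory is `C²` on `[0, ∞)` with bounded first and second derivatives. -/
structure Leader.Satisfies {p : ℕ} (l : Leader p) (n : ℕ) (k : Bounds) : Prop where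
  deriv_q : ∀ t, 0 ≤ t → HasDerivWithinAt l.q (l.dq t) (Ici 0) t
  deriv_dq : ∀ t, 0 ≤ t → HasDerivWithinAt l.dq (l.ddq t) (Ici 0) t
  cont_ddq : ContinuousOn l.ddq (Ici 0)
  bound_dq : ∀ t, 0 ≤ t → stackNorm (fun _ : Fin n => l.dq t) ≤ k.kp
  bound_ddq : ∀ t, 0 ≤ t → stackNorm (fun _ : Fin n => l.ddq t) ≤ k.kq

/-! ### The closed loop -/

/-- The state `(q, q̇, r̂, v̂)`: coordinates and velocities of the followers, and their estimates
of the leader's position and velocity. -/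
abbrev State (n p : ℕ) := Stack n p × Stack n p × Stack n p × Stack n p

/-- Lebesgue measure on the state space: the product measure. -/
noncomputable instance stateMeasureSpace (n p : ℕ) : MeasureSpace (State n p) :=
  letI : MeasureSpace (Stack n p) := MeasureSpace.pi
  Measure.prod.measureSpace

/-- The family indexed by `0, …, n` with the leader's value at `0`. -/
def withLeader {n p : ℕ} (x₀ : Coord p) (x : Stack n p) : Fin (n + 1) → Coord p :=
  Fin.cons (α := fun _ => Coord p) x₀ x

/-- `∑ j, W i j (x i - x j)` for the follower `i`, the sum being over leader and followers. -/
def relSum {n p : ℕ} (W : Matrix (Fin (n + 1)) (Fin (n + 1)) ℝ) (x₀ : Coord p) (x : Stack n p)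
    (i : Fin n) : Coord p :=
  ∑ j, W i.succ j • (x i - withLeader x₀ x j)

/-- The control gains `μ, η, β`. -/
structure Gains where
  μ : ℝ
  η : ℝ
  β : ℝ

/-- The discontinuous model-independent control law. -/
noncomputable def controlLaw {n p : ℕ} (A : Matrix (Fin (n + 1)) (Fin (n + 1)) ℝ) (G : Gains)
    (q₀ dq₀ : Coord p) (s : State n p) (i : Fin n) : Coord p :=
  -(G.η • ∑ j, A i.succ j •
      ((s.1 i - withLeader q₀ s.1 j) + G.μ • (s.2.1 i - withLeader dq₀ s.2.1 j)))
    - G.β • sgnVec ((s.1 i - s.2.2.1 i) + G.μ • (s.2.1 i - s.2.2.2 i))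

/-- The (discontinuous) vector field of the closed loop made of the agents under the control law
and of the distributed observer with gains `ω₁, ω₂` on the communication graph `B t`. -/
noncomputable def closedLoop {n p : ℕ} (A : Matrix (Fin (n + 1)) (Fin (n + 1)) ℝ)
    (B : ℝ → Matrix (Fin (n + 1)) (Fin (n + 1)) ℝ) (G : Gains) (ω₁ ω₂ : ℝ)
    (agents : Fin n → Agent p) (l : Leader p) (t : ℝ) (s : State n p) : State n p :=
  (s.2.1,
   fun i => ((agents i).M (s.1 i)).inverse
     (controlLaw A G (l.q t) (l.dq t) s i
       - (agents i).C (s.1 i) (s.2.1 i) (s.2.1 i) - (agents i).g (s.1 i) - (agents i).ζ t),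
   fun i => s.2.2.2 i - ω₁ • sgnVec (relSum (B t) (l.q t) s.2.2.1 i),
   fun i => -(ω₂ • sgnVec (relSum (B t) (l.dq t) s.2.2.2 i)))

/-- Filippov's set-valued map `𝒦[f]`. -/
def filippov {E : Type} [NormedAddCommGroup E] [NormedSpace ℝ E] [MeasureSpace E]
    (f : E → E) (x : E) : Set E :=
  ⋂ (r : ℝ) (_ : 0 < r) (N : Set E) (_ : volume N = 0),
    closure (convexHull ℝ (f '' (Metric.ball x r \ N)))

/-- `z` is a Filippov solution of `ż = F(t, z)` on `[0, τ)`, where `0 < τ ≤ ∞`. -/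
structure IsFilippovSolution {E : Type} [NormedAddCommGroup E] [NormedSpace ℝ E] [MeasureSpace E]
    (F : ℝ → E → E) (τ : EReal) (z : ℝ → E) : Prop where
  abs_cont : ∀ T : ℝ, 0 ≤ T → (T : EReal) < τ → AbsolutelyContinuousOnInterval z 0 T
  inclusion : ∀ᵐ t : ℝ, 0 < t → (t : EReal) < τ →
    ∃ w ∈ filippov (F t) (z t), HasDerivAt z w t

/-- The stacked position error. -/
def posErr {n p : ℕ} (l : Leader p) (z : ℝ → State n p) (t : ℝ) : Stack n p :=
  fun i => (z t).1 i - l.q t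

/-- The stacked velocity error. -/
def velErr {n p : ℕ} (l : Leader p) (z : ℝ → State n p) (t : ℝ) : Stack n p :=
  fun i => (z t).2.1 i - l.dq t

/-- The Euclidean norm of the stacked position and velocity errors together. -/
noncomputable def errNorm {n p : ℕ} (l : Leader p) (z : ℝ → State n p) (t : ℝ) : ℝ :=
  Real.sqrt (stackNorm (posErr l z t) ^ 2 + stackNorm (velErr l z t) ^ 2)

/-- All agents, the leader included, start in the known bounded set. -/
structure InitialBounds {n p : ℕ} (k : Bounds) (l : Leader p) (s : State n p) : Prop where
  pos : ∀ j, ‖withLeader (l.q 0) s.1 j‖ ≤ k.ka / Real.sqrt n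
  vel : ∀ j, ‖withLeader (l.dq 0) s.2.1 j‖ ≤ k.kb / Real.sqrt n

/-- From time `T₁` on, all estimates of the followers are exact. -/
def ObserverExact {n p : ℕ} (l : Leader p) (τ : EReal) (z : ℝ → State n p) (T₁ : ℝ) : Prop :=
  ∀ t : ℝ, T₁ ≤ t → (t : EReal) < τ →
    ∀ i, (z t).2.2.1 i = l.q t ∧ (z t).2.2.2 i = l.dq t

/-- The leader tracking objective. -/
def TrackingAchieved {n p : ℕ} (l : Leader p) (z : ℝ → State n p) : Prop :=
  ∀ i, Tendsto (fun t => ‖(z t).1 i - l.q t‖) atTop (𝓝 0) ∧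
    Tendsto (fun t => ‖(z t).2.1 i - l.dq t‖) atTop (𝓝 0)

/-! ### The gain inequalities -/

/-- The auxiliary quantities entering the gain inequalities: the diagonal `γ` of `Γ`, the small
number `δ` and the number `μ₃`. -/
structure Design (n : ℕ) where
  γ : Fin n → ℝ
  δ : ℝ
  μ₃ : ℝ

namespace Design

variable {n : ℕ} (D : Design n) (p : ℕ) (A : Matrix (Fin (n + 1)) (Fin (n + 1)) ℝ) (k : Bounds)
  (G : Gains)

/-- `Γ L₂₂ + L₂₂ᵀ Γ`. -/
def symPart : Matrix (Fin n) (Fin n) ℝ :=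
  Matrix.diagonal D.γ * lap22 A + (lap22 A)ᵀ * Matrix.diagonal D.γ

/-- `X = (Γ L₂₂ + L₂₂ᵀ Γ) ⊗ I_p`. -/
def X : Matrix (Fin n × Fin p) (Fin n × Fin p) ℝ :=
  D.symPart A ⊗ₖ (1 : Matrix (Fin p) (Fin p) ℝ)

/-- The smallest of the `γ i`. -/
noncomputable def γmin : ℝ := ⨅ i, D.γ i

/-- Admissible auxiliary quantities: `Γ` is diagonal and positive with largest entry `1` and
`Γ L₂₂ + L₂₂ᵀ Γ` is positive definite, `0 < δ < k_m`, and `μ₃` exceeds its two thresholds. -/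
structure Admissible : Prop where
  γ_pos : ∀ i, 0 < D.γ i
  γ_le_one : ∀ i, D.γ i ≤ 1
  γ_max : ∃ i, D.γ i = 1
  posDef : (D.symPart A).PosDef
  δ_pos : 0 < D.δ
  δ_lt : D.δ < k.km
  μ₃_gt₁ : Real.sqrt ((k.kM + D.δ) / (2 * lamMax (D.X p A))) < D.μ₃
  μ₃_gt₂ : Real.sqrt (2 * D.γmin * (k.km - D.δ) / lamMin (D.X p A)) < D.μ₃

/-- The matrix `L_μ` of the upper bound for the Lyapunov function. -/
noncomputable def Lmat :
    Matrix ((Fin n × Fin p) ⊕ (Fin n × Fin p)) ((Fin n × Fin p) ⊕ (Fin n × Fin p)) ℝ :=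
  Matrix.fromBlocks ((G.η * lamMax (D.X p A)) • 1) ((1 / 2 * G.μ⁻¹ * (k.kM + D.δ)) • 1)
    ((1 / 2 * G.μ⁻¹ * (k.kM + D.δ)) • 1) ((1 / 2 * (k.kM + D.δ)) • 1)

/-- The matrix `N_μ` of the lower bound for the Lyapunov function. -/
noncomputable def Nmat :
    Matrix ((Fin n × Fin p) ⊕ (Fin n × Fin p)) ((Fin n × Fin p) ⊕ (Fin n × Fin p)) ℝ :=
  (1 / 2 : ℝ) • Matrix.fromBlocks
    ((1 / 2 * G.η * lamMin (D.X p A)) • 1) ((G.μ⁻¹ * D.γmin * (k.km - D.δ)) • 1)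
    ((G.μ⁻¹ * D.γmin * (k.km - D.δ)) • 1) ((D.γmin * (k.km - D.δ)) • 1)

/-- `η λ_max(X) x² + (k_M + δ) (y² / 2 + x y / μ₃)`. -/
noncomputable def Vbound (x y : ℝ) : ℝ :=
  G.η * lamMax (D.X p A) * x ^ 2 + 1 / 2 * (k.kM + D.δ) * y ^ 2
    + D.μ₃⁻¹ * (k.kM + D.δ) * x * y

/-- `ρ₂(μ₃)`: the Schur complement in `N_{μ₃}` of its velocity block. -/
noncomputable def ρ₂ : ℝ :=
  1 / 4 * G.η * lamMin (D.X p A) - 1 / 2 * (D.μ₃⁻¹) ^ 2 * D.γmin * (k.km - D.δ)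

/-- The Schur complement in `N_{μ₃}` of its position block. -/
noncomputable def σ₂ : ℝ :=
  1 / 2 * D.γmin * (k.km - D.δ)
    - (1 / 2 * D.μ₃⁻¹ * D.γmin * (k.km - D.δ)) ^ 2 / (1 / 4 * G.η * lamMin (D.X p A))

/-- The value of the bound at the largest possible initial errors `2 k_a`, `2 k_b`. -/
noncomputable def Vstar : ℝ := D.Vbound p A k G (2 * k.ka) (2 * k.kb)

noncomputable def X₁ : ℝ := Real.sqrt (D.Vstar p A k G / D.ρ₂ p A k G)

noncomputable def Y₁ : ℝ := Real.sqrt (D.Vstar p A k G / D.σ₂ p A k G)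

noncomputable def Vhat : ℝ := D.Vbound p A k G (D.X₁ p A k G) (D.Y₁ p A k G)

/-- The bound `𝒳` on the position error. -/
noncomputable def XX : ℝ := Real.sqrt (D.Vhat p A k G / D.ρ₂ p A k G)

/-- The bound `𝒴` on the velocity error. -/
noncomputable def YY : ℝ := Real.sqrt (D.Vhat p A k G / D.σ₂ p A k G)

/-- `φ(μ, η)`. -/
noncomputable def φ : ℝ :=
  1 / 2 * G.μ ^ 2 * G.η * lamMin (D.X p A) - G.μ * k.kC * k.kp - k.kM

/-- The function `g(x, y)`. -/
noncomputable def gFun (x y : ℝ) : ℝ :=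
  D.φ p A k G * y ^ 2 + 1 / 2 * G.η * lamMin (D.X p A) * x ^ 2
    - 2 * k.kC * k.kp * x * y - k.kC * x * y ^ 2

/-- The coefficient of the linear terms of `p(x, y)`. -/
noncomputable def linCoeff (n p : ℕ) (k : Bounds) (G : Gains) : ℝ :=
  Real.sqrt (n * p) * G.β + k.kC * k.kp ^ 2 + Real.sqrt n * (k.kg + k.kζ) + k.kM * k.kq

/-- The function `p(x, y)`. -/
noncomputable def pFun (x y : ℝ) : ℝ :=
  D.gFun p A k G x y - linCoeff n p k G * (x + G.μ * y)

/-- The lower bound for `β`: `(k_C k_p² + ξ) / γ_min` with `ξ = k_g + k_ζ + k_M k_q`. -/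
noncomputable def βlow : ℝ := (k.kC * k.kp ^ 2 + (k.kg + k.kζ + k.kM * k.kq)) / D.γmin

/-- The lower bound for `μ`. -/
noncomputable def μlow : ℝ := Real.sqrt (2 * k.kM / lamMin (D.X p A))

/-- The set of inequalities for the gains; `ϑ, ε` are the widths of the boundary layers. -/
structure GainInequalities (ϑ ε : ℝ) : Prop where
  β_gt : D.βlow k < G.β
  μ_ge : D.μ₃ ≤ G.μ
  μ_gt : D.μlow p A k < G.μ
  η_gt : 1 < G.η
  φ_gt : (2 * k.kC * k.kp) ^ 2 / (2 * G.η * lamMin (D.X p A)) + k.kC * D.XX p A k G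
    < D.φ p A k G
  ϑ_gt : D.XX p A k G - D.X₁ p A k G < ϑ
  ϑ_lt : ϑ < D.XX p A k G
  ε_gt : D.YY p A k G - D.Y₁ p A k G < ε
  ε_lt : ε < D.YY p A k G
  p_pos : ∀ x ∈ Icc 0 (D.XX p A k G), ∀ y ∈ Icc 0 (D.YY p A k G),
    (D.XX p A k G - ϑ ≤ x ∨ D.YY p A k G - ε ≤ y) → 0 < D.pFun p A k G x y

/-- `a₃ > 0` is such that `μ⁻¹ g(x, y) ≥ a₃ (x² + y²)` on `[0, 𝒳] × [0, 𝒴]`. -/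
def IsDecayCoeff (a₃ : ℝ) : Prop :=
  0 < a₃ ∧ ∀ x ∈ Icc 0 (D.XX p A k G), ∀ y ∈ Icc 0 (D.YY p A k G),
    a₃ * (x ^ 2 + y ^ 2) ≤ G.μ⁻¹ * D.gFun p A k G x y

end Design

end LeaderTracking

/-!
With the position error `e`, the velocity error `v` and the combined error `u = e + μ v`, the proof
rests on the Lyapunov function
`V = η/2 eᵀ X e + 1/2 vᵀ Γ M v + μ⁻¹ eᵀ Γ M v` (`lyapunov`). The lower bound on `μ` makes it
positive definite, and it is bounded above and below by functions of the two norms `|e|` and `|v|`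
only (`lyapunov_le`, `le_lyapunov`), hence by the quadratic forms of `L_μ` and `N_μ`.

*Derivative.* Filippov's set at a state is contained in the set of values obtained by replacing each
signum by some selection of it, since the vector field is a continuous map minus sign terms, and the
continuous factor `M⁻¹` can be moved to the other side (`isClosedLoopValue_of_mem_filippov`). Thus
almost everywhere the solution obeys the Euler–Lagrange equations with a sign selection, and
`Ṁ = C + Cᵀ` gives an explicit formula for `μ V̇`. Bounding the sign terms crudely yields
`V̇ ≤ -μ⁻¹ p(|e|, |v|)` at all times. Once the estimates are exact, the sign term is
`-β Σ γ_i |u_i|₁`, which dominates all disturbances because `β` exceeds its lower bound, and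
`V̇ ≤ -μ⁻¹ g(|e|, |v|)`.

*Boundedness.* Where `V < V̂*`, the norms `|e|` and `|v|` are below `𝒳` and `𝒴`. Let `c` be the
larger of the bound `V̄*` for the initial value of `V` and its bound `W(𝒳 - ϑ, 𝒴 - ε)` on the inner
box; since `𝒳 - ϑ < 𝒳₁` and `𝒴 - ε < 𝒴₁`, it is smaller than `V̂* = W(𝒳₁, 𝒴₁)`. Where
`c < V < V̂*`, the errors lie in the boundary layers, so `p` is positive and `V` decreases. Hence
`V ≤ c` for all times (`le_of_ae_deriv_nonpos_on_layer`, `errors_lt`).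

*Observer.* In each coordinate the largest of the deviations from the leader decreases at a constant
rate as long as it is positive: a spanning tree rooted at the leader contains a vertex attaining the
maximum whose weighted sum of differences is positive (`exists_max_relSum_pos`). So first the
velocity and then the position estimates become exact in finite time (`exists_observerExact`), after
which `g ≥ μ a₃ (|e|² + |v|²)` and Grönwall's inequality give the exponential bound.

*Existence of the gains.* `L₂₂` is a nonsingular M-matrix because of the spanning tree; positive
vectors `x`, `y` with `L₂₂ x > 0` and `yᵀ L₂₂ > 0` give `Γ = diag (y / x)` up to scaling
(`exists_diagonal_posDef`). As `η → ∞`, `𝒳` stays bounded (`exists_XX_le`) while the coefficients of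
the quadratic part of `p` grow linearly, so all inequalities hold eventually
(`exists_gainInequalities`).
-/

namespace LeaderTracking

/-! ### Absolutely continuous functions on an interval -/

/-- A function that is Lipschitz on the image of an absolutely continuous curve pulls back to an
absolutely continuous function. -/
lemma absCont_lipschitzOn_comp {X Y : Type*} [PseudoMetricSpace X] [PseudoMetricSpace Y]
    {f : ℝ → X} {Φ : X → Y} {a b : ℝ} {K : NNReal} (hf : AbsolutelyContinuousOnInterval f a b)
    (hΦ : LipschitzOnWith K Φ (f '' uIcc a b)) :
    AbsolutelyContinuousOnInterval (fun t => Φ (f t)) a b := by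
  have h2 : Tendsto (fun E : ℕ × (ℕ → ℝ × ℝ) =>
      K * ∑ i ∈ Finset.range E.1, dist (f (E.2 i).1) (f (E.2 i).2))
      (AbsolutelyContinuousOnInterval.totalLengthFilter ⊓
        𝓟 (AbsolutelyContinuousOnInterval.disjWithin a b)) (𝓝 0) := by
    simpa using Tendsto.const_mul (K : ℝ) hf
  refine squeeze_zero' (Eventually.of_forall fun E => Finset.sum_nonneg fun i _ => dist_nonneg)
    ?_ h2
  refine eventually_inf_principal.2 (Eventually.of_forall fun E hE => ?_)
  rw [Finset.mul_sum]
  exact Finset.sum_le_sum fun i hi => hΦ.dist_le_mul _ (mem_image_of_mem f (hE.1 i hi).1) _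
    (mem_image_of_mem f (hE.1 i hi).2)

lemma absCont_lipschitz_comp {X Y : Type*} [PseudoMetricSpace X] [PseudoMetricSpace Y]
    {f : ℝ → X} {Φ : X → Y} {a b : ℝ} {K : NNReal} (hf : AbsolutelyContinuousOnInterval f a b)
    (hΦ : LipschitzWith K Φ) : AbsolutelyContinuousOnInterval (fun t => Φ (f t)) a b :=
  absCont_lipschitzOn_comp hf hΦ.lipschitzOnWith

lemma absCont_contDiff_comp {E F : Type*} [NormedAddCommGroup E] [NormedSpace ℝ E]
    [NormedAddCommGroup F] [NormedSpace ℝ F] {f : ℝ → E} {Φ : E → F} {a b : ℝ}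
    (hf : AbsolutelyContinuousOnInterval f a b) (hΦ : ContDiff ℝ 1 Φ) :
    AbsolutelyContinuousOnInterval (fun t => Φ (f t)) a b := by
  have hc : IsCompact (f '' uIcc a b) := isCompact_uIcc.image_of_continuousOn hf.continuousOn
  obtain ⟨K, hK⟩ := (hΦ.locallyLipschitz.locallyLipschitzOn
    (s := f '' uIcc a b)).exists_lipschitzOnWith_of_compact hc
  exact absCont_lipschitzOn_comp hf hK

lemma absCont_prodMk {X Y : Type*} [PseudoMetricSpace X] [PseudoMetricSpace Y]
    {f : ℝ → X} {g : ℝ → Y} {a b : ℝ} (hf : AbsolutelyContinuousOnInterval f a b)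
    (hg : AbsolutelyContinuousOnInterval g a b) :
    AbsolutelyContinuousOnInterval (fun t => (f t, g t)) a b := by
  refine squeeze_zero (fun E => Finset.sum_nonneg fun i _ => dist_nonneg) (fun E => ?_)
    (by simpa using Tendsto.add hf hg)
  rw [← Finset.sum_add_distrib]
  refine Finset.sum_le_sum fun i _ => ?_
  rw [Prod.dist_eq]
  exact max_le_add_of_nonneg dist_nonneg dist_nonneg

lemma absCont_contDiff_comp₃ {E₁ E₂ E₃ F : Type*} [NormedAddCommGroup E₁] [NormedSpace ℝ E₁]
    [NormedAddCommGroup E₂] [NormedSpace ℝ E₂] [NormedAddCommGroup E₃] [NormedSpace ℝ E₃]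
    [NormedAddCommGroup F] [NormedSpace ℝ F] {f : ℝ → E₁} {g : ℝ → E₂} {h : ℝ → E₃}
    {Φ : E₁ × E₂ × E₃ → F} {a b : ℝ} (hf : AbsolutelyContinuousOnInterval f a b)
    (hg : AbsolutelyContinuousOnInterval g a b) (hh : AbsolutelyContinuousOnInterval h a b)
    (hΦ : ContDiff ℝ 1 Φ) : AbsolutelyContinuousOnInterval (fun t => Φ (f t, g t, h t)) a b :=
  absCont_contDiff_comp (absCont_prodMk hf (absCont_prodMk hg hh)) hΦ

lemma absCont_sup {f g : ℝ → ℝ} {a b : ℝ} (hf : AbsolutelyContinuousOnInterval f a b)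
    (hg : AbsolutelyContinuousOnInterval g a b) : AbsolutelyContinuousOnInterval (f ⊔ g) a b := by
  refine squeeze_zero (fun E => Finset.sum_nonneg fun i _ => dist_nonneg) (fun E => ?_)
    (by simpa using Tendsto.add hf hg)
  rw [← Finset.sum_add_distrib]
  refine Finset.sum_le_sum fun i _ => ?_
  simp only [Pi.sup_apply, Real.dist_eq]
  exact (abs_max_sub_max_le_max _ _ _ _).trans
    (max_le_add_of_nonneg (abs_nonneg _) (abs_nonneg _))

lemma le_of_absCont_of_ae_deriv_nonpos {f : ℝ → ℝ} {a b : ℝ} (hab : a ≤ b)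
    (hf : AbsolutelyContinuousOnInterval f a b) (h : ∀ᵐ t, t ∈ Ioo a b → deriv f t ≤ 0) :
    f b ≤ f a := by
  have h1 := hf.integral_deriv_eq_sub
  have h2 : ∫ t in a..b, deriv f t ≤ 0 := by
    refine (intervalIntegral.integral_mono_ae_restrict (μ := volume) (g := fun _ => (0 : ℝ)) hab
      hf.intervalIntegrable_deriv intervalIntegrable_const ?_).trans (by simp)
    rw [← restrict_Ioo_eq_restrict_Icc]
    exact (ae_restrict_iff' measurableSet_Ioo).2 h
  linarith

lemma absCont_mono_Icc {X : Type*} [PseudoMetricSpace X] {f : ℝ → X}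
    {a b c d : ℝ} (hf : AbsolutelyContinuousOnInterval f a b) (hac : a ≤ c) (hcd : c ≤ d)
    (hdb : d ≤ b) : AbsolutelyContinuousOnInterval f c d :=
  hf.mono (by
    rw [uIcc_of_le hcd, uIcc_of_le (hac.trans (hcd.trans hdb))]
    exact Icc_subset_Icc hac hdb)

/-- Barrier lemma: a function that starts below `c` and does not increase while its values lie
strictly between `c` and `d` stays below `c`. -/
lemma le_of_ae_deriv_nonpos_on_layer {f : ℝ → ℝ} {a b c d : ℝ}
    (hf : AbsolutelyContinuousOnInterval f a b) (hfa : f a ≤ c) (hcd : c < d)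
    (h : ∀ᵐ t, t ∈ Ioo a b → c < f t → f t < d → deriv f t ≤ 0) :
    ∀ t ∈ Icc a b, f t ≤ c := by
  intro t ht
  -- Truncating `f` to `[c, d]` gives a function that does not increase at all.
  let Φ : ℝ → ℝ := fun x => max c (min x d)
  have hΦ : LipschitzWith 1 Φ := (LipschitzWith.id.min_const d).const_max c
  have hg := absCont_lipschitz_comp (absCont_mono_Icc hf le_rfl ht.1 ht.2) hΦ
  have hle := le_of_absCont_of_ae_deriv_nonpos ht.1 hg (by
    filter_upwards [h] with s hs hst
    have hs' : s ∈ Ioo a b := ⟨hst.1, hst.2.trans_le ht.2⟩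
    have hcont : ContinuousAt f s := by
      refine hf.continuousOn.continuousAt ?_
      rw [uIcc_of_le (hs'.1.trans hs'.2).le]
      exact Icc_mem_nhds hs'.1 hs'.2
    rcases le_or_gt (f s) c with h1 | h1
    · have : IsLocalMin (fun t => Φ (f t)) s := by
        refine Eventually.of_forall fun r => ?_
        simp only [Φ, min_eq_left (h1.trans hcd.le), max_eq_left h1]
        exact le_max_left _ _
      exact this.deriv_eq_zero.le
    rcases le_or_gt d (f s) with h2 | h2
    · have : IsLocalMax (fun t => Φ (f t)) s := by
        refine Eventually.of_forall fun r => ?_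
        simp only [Φ, min_eq_right h2, max_eq_right hcd.le]
        exact max_le hcd.le (min_le_right _ _)
      exact this.deriv_eq_zero.le
    · have : (fun t => Φ (f t)) =ᶠ[𝓝 s] f := by
        filter_upwards [hcont.eventually_const_lt h1, hcont.eventually_lt_const h2] with r hr1 hr2
        simp only [Φ, min_eq_left hr2.le, max_eq_right hr1.le]
      rw [this.deriv_eq]
      exact hs hs' h1 h2)
  simp only [Φ, max_eq_left ((min_le_left (f a) d).trans hfa)] at hle
  by_contra! hlt
  exact absurd ((lt_min hlt hcd).trans_le ((le_max_right _ _).trans hle)) (lt_irrefl _)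

/-- Grönwall's inequality for an absolutely continuous function. -/
lemma le_exp_of_ae_deriv_le {f : ℝ → ℝ} {a b r : ℝ} (hab : a ≤ b)
    (hf : AbsolutelyContinuousOnInterval f a b)
    (h : ∀ᵐ t, t ∈ Ioo a b → deriv f t ≤ -r * f t) :
    f b ≤ f a * Real.exp (-r * (b - a)) := by
  have hE : AbsolutelyContinuousOnInterval (fun t => Real.exp (r * (t - a))) a b :=
    ContDiffOn.absolutelyContinuousOnInterval (by fun_prop)
  have hd : ∀ᵐ t, t ∈ Ioo a b → deriv (fun t => f t * Real.exp (r * (t - a))) t ≤ 0 := by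
    filter_upwards [h, hf.ae_differentiableAt] with t h1 h2 ht
    have h3 := (h2 (by rw [uIcc_of_le hab]; exact Ioo_subset_Icc_self ht)).hasDerivAt
    have h4 : HasDerivAt (fun t => Real.exp (r * (t - a))) (Real.exp (r * (t - a)) * (r * 1)) t :=
      ((hasDerivAt_id t).sub_const a |>.const_mul r).exp
    rw [(h3.fun_mul h4).deriv]
    nlinarith [h1 ht, Real.exp_pos (r * (t - a))]
  have := le_of_absCont_of_ae_deriv_nonpos hab (hf.fun_mul hE) hd
  simp only [sub_self, mul_zero, Real.exp_zero, mul_one] at this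
  rw [neg_mul, Real.exp_neg, ← div_eq_mul_inv, le_div_iff₀ (Real.exp_pos _)]
  exact this

/-! ### Finite-time consensus with the leader -/

/-- If the leader's value is not the largest one, then some vertex with the largest value has a
strictly smaller in-neighbour, hence a positive weighted sum of differences. -/
lemma exists_max_relSum_pos {n : ℕ} {B : Matrix (Fin (n + 1)) (Fin (n + 1)) ℝ}
    (hB : IsAdjacency B) (hT : HasSpanningTree B) {x : Fin (n + 1) → ℝ} {m : ℝ}
    (hm : ∀ i, x i ≤ m) (hmem : ∃ i, x i = m) (h0 : x 0 < m) :
    ∃ i : Fin n, x i.succ = m ∧ 0 < ∑ j, B i.succ j * (x i.succ - x j) := by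
  classical
  obtain ⟨par, hpar, hroot⟩ := hT
  obtain ⟨v, hv⟩ := hmem
  have hex : ∃ k, x (par^[k] v) ≠ m := by
    obtain ⟨k, hk⟩ := hroot v
    exact ⟨k, by rw [hk]; exact h0.ne⟩
  obtain ⟨k, hk, hmin⟩ : ∃ k, x (par^[k + 1] v) ≠ m ∧ x (par^[k] v) = m := by
    have h1 := Nat.find_spec hex
    have h2 : Nat.find hex ≠ 0 := fun h => by rw [h] at h1; exact h1 hv
    obtain ⟨k, hk⟩ := Nat.exists_eq_succ_of_ne_zero h2
    refine ⟨k, by rw [hk] at h1; exact h1, ?_⟩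
    have := Nat.find_min hex (m := k) (by omega)
    simpa using this
  set w := par^[k] v with hw
  have hw0 : w ≠ 0 := fun h => by rw [h] at hmin; exact h0.ne hmin
  obtain ⟨i, hi⟩ := Fin.exists_succ_eq.2 hw0
  rw [Function.iterate_succ_apply'] at hk
  refine ⟨i, by rw [hi]; exact hmin, ?_⟩
  rw [hi, hmin]
  refine Finset.sum_pos' (fun j _ => mul_nonneg (hB.nonneg _ _) (sub_nonneg.2 (hm j)))
    ⟨par w, Finset.mem_univ _, mul_pos (hpar w hw0) (sub_pos.2 (lt_of_le_of_ne (hm _) hk))⟩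

/-- One-sided finite-time consensus: if every value that exceeds the weighted mean of its
in-neighbours decreases at least at the rate `c`, then after the time `K / c` no value exceeds the
leader's value `0`. The reason is that the largest value is absolutely continuous and shares its
derivative with every value attaining it. -/
lemma nonpos_of_max_decreasing {n : ℕ} {d : Fin (n + 1) → ℝ → ℝ} {a b c K : ℝ} (hab : a ≤ b)
    (hAC : ∀ i, AbsolutelyContinuousOnInterval (d i) a b) (h0 : ∀ t ∈ Icc a b, d 0 t = 0)
    (hc : 0 < c)
    {B : ℝ → Matrix (Fin (n + 1)) (Fin (n + 1)) ℝ}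
    (hB : ∀ t ∈ Ioo a b, IsAdjacency (B t) ∧ HasSpanningTree (B t))
    (hd : ∀ᵐ t, t ∈ Ioo a b → ∀ i : Fin n,
      0 < ∑ j, B t i.succ j * (d i.succ t - d j t) → deriv (d i.succ) t ≤ -c)
    (hK : ∀ i, d i a ≤ K) (hKb : K ≤ c * (b - a)) : ∀ i, d i b ≤ 0 := by
  set m : ℝ → ℝ := Finset.univ.sup' Finset.univ_nonempty d with hm
  have hmAC : AbsolutelyContinuousOnInterval m a b :=
    Finset.sup'_induction Finset.univ_nonempty d
      (p := fun f => AbsolutelyContinuousOnInterval f a b)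
      (fun f hf g hg => absCont_sup hf hg) (fun i _ => hAC i)
  have hle : ∀ t i, d i t ≤ m t := fun t i => by
    rw [hm, Finset.sup'_apply]
    exact Finset.le_sup' (fun i => d i t) (Finset.mem_univ i)
  have hatt : ∀ t, ∃ i, d i t = m t := fun t => by
    obtain ⟨i, -, hi⟩ := Finset.exists_mem_eq_sup' Finset.univ_nonempty (fun i => d i t)
    exact ⟨i, by rw [hm, Finset.sup'_apply, hi]⟩
  have hm0 : ∀ t ∈ Icc a b, 0 ≤ m t := fun t ht => by rw [← h0 t ht]; exact hle t 0
  have hder : ∀ᵐ t, t ∈ Ioo a b → deriv m t ≤ 0 ∧ (0 < m t → deriv m t ≤ -c) := by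
    have hdiff : ∀ᵐ t, ∀ i, t ∈ uIcc a b → DifferentiableAt ℝ (d i) t :=
      ae_all_iff.2 fun i => (hAC i).ae_differentiableAt
    filter_upwards [hd, hdiff, hmAC.ae_differentiableAt] with t h1 h2 h3 ht
    have htI := Ioo_subset_Icc_self ht
    have htu : t ∈ uIcc a b := by rw [uIcc_of_le hab]; exact htI
    have key : 0 < m t → deriv m t ≤ -c := by
      intro hpos
      obtain ⟨i, hi, hsum⟩ := exists_max_relSum_pos (hB t ht).1 (hB t ht).2
        (x := fun i => d i t) (hle t) (hatt t) (by rw [h0 t htI]; exact hpos)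
      have hmin : IsLocalMin (fun s => m s - d i.succ s) t := by
        refine Eventually.of_forall fun s => ?_
        simp only [hi, sub_self]
        exact sub_nonneg.2 (hle s _)
      have hz := hmin.hasDerivAt_eq_zero ((h3 htu).hasDerivAt.sub (h2 i.succ htu).hasDerivAt)
      linarith [h1 ht i hsum]
    refine ⟨?_, key⟩
    rcases (hm0 t htI).eq_or_lt with hz | hpos
    · have hmin : IsLocalMin m t := by
        filter_upwards [Ioo_mem_nhds ht.1 ht.2] with s hs
        rw [← hz]
        exact hm0 s (Ioo_subset_Icc_self hs)
      exact hmin.deriv_eq_zero.le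
    · linarith [key hpos]
  suffices m b ≤ 0 from fun i => (hle b i).trans this
  by_contra! hpos
  have hanti : ∀ t ∈ Icc a b, 0 < m t := fun t ht => hpos.trans_le <|
    le_of_absCont_of_ae_deriv_nonpos ht.2 (absCont_mono_Icc hmAC ht.1 ht.2 le_rfl) (by
      filter_upwards [hder] with s hs hst
      exact (hs ⟨ht.1.trans_lt hst.1, hst.2⟩).1)
  have hlin : AbsolutelyContinuousOnInterval (fun t : ℝ => c * t) a b :=
    ContDiffOn.absolutelyContinuousOnInterval (by fun_prop)
  have hfin := le_of_absCont_of_ae_deriv_nonpos hab (hmAC.fun_add hlin) (by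
    filter_upwards [hder, hmAC.ae_differentiableAt] with t h1 h2 ht
    have htI := Ioo_subset_Icc_self ht
    have h3 := (h2 (by rw [uIcc_of_le hab]; exact htI)).hasDerivAt
    have h4 : HasDerivAt (fun t : ℝ => c * t) (c * 1) t := (hasDerivAt_id t).const_mul c
    rw [(h3.fun_add h4).deriv]
    linarith [(h1 ht).2 (hanti t htI)])
  obtain ⟨i, hi⟩ := hatt a
  have := hK i
  nlinarith

/-! ### Extreme eigenvalues and quadratic forms -/

section Eigenvalues

variable {ι : Type} [Fintype ι] [DecidableEq ι] {S : Matrix ι ι ℝ}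

lemma lamMin_mul_dotProduct_le (hS : S.IsHermitian) (x : ι → ℝ) :
    lamMin S * (x ⬝ᵥ x) ≤ x ⬝ᵥ (S *ᵥ x) := by
  have hP : (S - algebraMap ℝ (Matrix ι ι ℝ) (lamMin S)).PosSemidef := by
    refine Matrix.posSemidef_iff_isHermitian_and_spectrum_nonneg.2 ⟨hS.sub ?_, ?_⟩
    · rw [Matrix.IsHermitian, Matrix.algebraMap_eq_diagonal, Matrix.diagonal_conjTranspose]
      simp
    · rw [← spectrum.sub_singleton_eq]
      rintro _ ⟨a, ha, b, rfl, rfl⟩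
      exact sub_nonneg.2 (csInf_le S.finite_real_spectrum.bddBelow ha)
  have h := hP.dotProduct_mulVec_nonneg x
  rw [star_trivial, Matrix.sub_mulVec, dotProduct_sub, Algebra.algebraMap_eq_smul_one,
    Matrix.smul_mulVec, Matrix.one_mulVec, dotProduct_smul, smul_eq_mul] at h
  linarith

lemma dotProduct_le_lamMax_mul (hS : S.IsHermitian) (x : ι → ℝ) :
    x ⬝ᵥ (S *ᵥ x) ≤ lamMax S * (x ⬝ᵥ x) := by
  have hP : (algebraMap ℝ (Matrix ι ι ℝ) (lamMax S) - S).PosSemidef := by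
    refine Matrix.posSemidef_iff_isHermitian_and_spectrum_nonneg.2
      ⟨Matrix.IsHermitian.sub ?_ hS, ?_⟩
    · rw [Matrix.IsHermitian, Matrix.algebraMap_eq_diagonal, Matrix.diagonal_conjTranspose]
      simp
    · rw [← spectrum.singleton_sub_eq]
      rintro _ ⟨a, rfl, b, hb, rfl⟩
      exact sub_nonneg.2 (le_csSup S.finite_real_spectrum.bddAbove hb)
  have h := hP.dotProduct_mulVec_nonneg x
  rw [star_trivial, Matrix.sub_mulVec, dotProduct_sub, Algebra.algebraMap_eq_smul_one,
    Matrix.smul_mulVec, Matrix.one_mulVec, dotProduct_smul, smul_eq_mul] at h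
  linarith

lemma lamMin_pos [Nonempty ι] (hS : S.PosDef) : 0 < lamMin S := by
  have hne : (spectrum ℝ S).Nonempty :=
    ⟨_, hS.isHermitian.eigenvalues_mem_spectrum_real (Classical.arbitrary ι)⟩
  have hmem : lamMin S ∈ spectrum ℝ S := hne.csInf_mem S.finite_real_spectrum
  rw [hS.isHermitian.spectrum_real_eq_range_eigenvalues] at hmem
  obtain ⟨i, hi⟩ := hmem
  rw [← hi]
  exact hS.eigenvalues_pos i

lemma lamMin_le_lamMax [Nonempty ι] (hS : S.IsHermitian) : lamMin S ≤ lamMax S := by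
  have hmem := hS.eigenvalues_mem_spectrum_real (Classical.arbitrary ι)
  exact (csInf_le S.finite_real_spectrum.bddBelow hmem).trans
    (le_csSup S.finite_real_spectrum.bddAbove hmem)

end Eigenvalues

section Blocks

/-- The block matrix of the scalar blocks `a`, `b`, `b`, `c`. -/
def scalarBlocks (ι : Type) [DecidableEq ι] (a b c : ℝ) : Matrix (ι ⊕ ι) (ι ⊕ ι) ℝ :=
  Matrix.fromBlocks (a • (1 : Matrix ι ι ℝ)) (b • (1 : Matrix ι ι ℝ)) (b • (1 : Matrix ι ι ℝ))
    (c • (1 : Matrix ι ι ℝ))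

lemma isHermitian_scalarBlocks {ι : Type} [DecidableEq ι] (a b c : ℝ) :
    (scalarBlocks ι a b c).IsHermitian := by
  simp [scalarBlocks, Matrix.IsHermitian, Matrix.fromBlocks_transpose]

variable {ι : Type} [Fintype ι] [DecidableEq ι]

lemma dotProduct_scalarBlocks (a b c : ℝ) (x y : ι → ℝ) :
    Sum.elim x y ⬝ᵥ
      (scalarBlocks ι a b c *ᵥ Sum.elim x y)
      = ∑ i, (a * x i ^ 2 + 2 * b * x i * y i + c * y i ^ 2) := by
  rw [scalarBlocks, Matrix.fromBlocks_mulVec, sumElim_dotProduct_sumElim]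
  simp only [Sum.elim_comp_inl, Sum.elim_comp_inr, Matrix.smul_mulVec, Matrix.one_mulVec,
    dotProduct, Pi.add_apply, Pi.smul_apply, smul_eq_mul]
  rw [← Finset.sum_add_distrib]
  exact Finset.sum_congr rfl fun i _ => by ring

lemma lamMin_scalarBlocks_le [Nonempty ι] (a b c x y : ℝ) :
    lamMin (scalarBlocks ι a b c) * (x ^ 2 + y ^ 2)
      ≤ a * x ^ 2 + 2 * b * x * y + c * y ^ 2 := by
  have i := Classical.arbitrary ι
  have h := lamMin_mul_dotProduct_le (isHermitian_scalarBlocks (ι := ι) a b c)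
    (Sum.elim (Pi.single i x) (Pi.single i y))
  rw [dotProduct_scalarBlocks, sumElim_dotProduct_sumElim, dotProduct_single,
    dotProduct_single, Finset.sum_eq_single i] at h
  · simpa [sq] using h
  · intro j _ hj
    simp [Pi.single_eq_of_ne hj]
  · simp

lemma le_lamMax_scalarBlocks [Nonempty ι] (a b c x y : ℝ) :
    a * x ^ 2 + 2 * b * x * y + c * y ^ 2 ≤
      lamMax (scalarBlocks ι a b c)
        * (x ^ 2 + y ^ 2) := by
  have i := Classical.arbitrary ι
  have h := dotProduct_le_lamMax_mul (isHermitian_scalarBlocks (ι := ι) a b c)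
    (Sum.elim (Pi.single i x) (Pi.single i y))
  rw [dotProduct_scalarBlocks, sumElim_dotProduct_sumElim, dotProduct_single,
    dotProduct_single, Finset.sum_eq_single i] at h
  · simpa [sq] using h
  · intro j _ hj
    simp [Pi.single_eq_of_ne hj]
  · simp

lemma binary_form_pos {a b c x y : ℝ} (ha : 0 < a) (h : b ^ 2 < a * c) (hxy : x ≠ 0 ∨ y ≠ 0) :
    0 < a * x ^ 2 + 2 * b * x * y + c * y ^ 2 := by
  have key : a * (a * x ^ 2 + 2 * b * x * y + c * y ^ 2)
      = (a * x + b * y) ^ 2 + (a * c - b ^ 2) * y ^ 2 := by ring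
  refine pos_of_mul_pos_right (a := a) ?_ ha.le
  rw [key]
  by_cases hy : y = 0
  · have hx : x ≠ 0 := by tauto
    subst hy
    have : 0 < (a * x) ^ 2 := by positivity
    simpa using this
  · have : 0 < (a * c - b ^ 2) * y ^ 2 := mul_pos (by linarith) (by positivity)
    positivity

lemma posDef_scalarBlocks {a b c : ℝ} (ha : 0 < a) (h : b ^ 2 < a * c) :
    (scalarBlocks ι a b c).PosDef := by
  refine .of_dotProduct_mulVec_pos (isHermitian_scalarBlocks a b c) fun z hz => ?_
  obtain ⟨x, y, rfl⟩ : ∃ x y : ι → ℝ, z = Sum.elim x y :=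
    ⟨z ∘ Sum.inl, z ∘ Sum.inr, (Sum.elim_comp_inl_inr z).symm⟩
  rw [star_trivial, dotProduct_scalarBlocks]
  have hpos : ∀ i, x i ≠ 0 ∨ y i ≠ 0 →
      0 < a * x i ^ 2 + 2 * b * x i * y i + c * y i ^ 2 := fun i hi => binary_form_pos ha h hi
  have hnn : ∀ i, 0 ≤ a * x i ^ 2 + 2 * b * x i * y i + c * y i ^ 2 := fun i => by
    by_cases hi : x i ≠ 0 ∨ y i ≠ 0
    · exact (hpos i hi).le
    · push Not at hi
      simp [hi.1, hi.2]
  obtain ⟨i, hi⟩ : ∃ i, x i ≠ 0 ∨ y i ≠ 0 := by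
    by_contra! hcon
    refine hz (funext fun k => ?_)
    rcases k with k | k
    · exact (hcon k).1
    · exact (hcon k).2
  exact Finset.sum_pos' (fun i _ => hnn i) ⟨i, Finset.mem_univ i, hpos i hi⟩

end Blocks

/-! ### Stacked vectors -/

section Stack

variable {n p : ℕ}

lemma stackNorm_nonneg (x : Stack n p) : 0 ≤ stackNorm x := Real.sqrt_nonneg _

lemma stackNorm_sq (x : Stack n p) : stackNorm x ^ 2 = ∑ i, ‖x i‖ ^ 2 :=
  Real.sq_sqrt (Finset.sum_nonneg fun _ _ => sq_nonneg _)

lemma norm_le_stackNorm (x : Stack n p) (i : Fin n) : ‖x i‖ ≤ stackNorm x :=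
  Real.le_sqrt_of_sq_le (Finset.single_le_sum (f := fun i => ‖x i‖ ^ 2)
    (fun _ _ => sq_nonneg _) (Finset.mem_univ i))

lemma stackNorm_const (x : Coord p) : stackNorm (fun _ : Fin n => x) = Real.sqrt n * ‖x‖ := by
  rw [stackNorm, Finset.sum_const, Finset.card_univ, Fintype.card_fin, nsmul_eq_mul,
    Real.sqrt_mul (Nat.cast_nonneg n), Real.sqrt_sq (norm_nonneg x)]

lemma sum_norm_mul_norm_le (x y : Stack n p) :
    ∑ i, ‖x i‖ * ‖y i‖ ≤ stackNorm x * stackNorm y :=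
  Real.sum_mul_le_sqrt_mul_sqrt Finset.univ (fun i => ‖x i‖) (fun i => ‖y i‖)

lemma sum_norm_le (x : Stack n p) : ∑ i, ‖x i‖ ≤ Real.sqrt n * stackNorm x := by
  have h := Real.sum_mul_le_sqrt_mul_sqrt Finset.univ (fun _ : Fin n => (1 : ℝ)) (fun i => ‖x i‖)
  simpa [stackNorm] using h

lemma stackNorm_le_mul {x : Stack n p} {r : ℝ} (hr : 0 ≤ r) (h : ∀ i, ‖x i‖ ≤ r) :
    stackNorm x ≤ Real.sqrt n * r := by
  refine (Real.sqrt_le_sqrt (Finset.sum_le_sum fun i _ =>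
    pow_le_pow_left₀ (norm_nonneg (x i)) (h i) 2)).trans ?_
  rw [Finset.sum_const, Finset.card_univ, Fintype.card_fin, nsmul_eq_mul,
    Real.sqrt_mul (Nat.cast_nonneg n), Real.sqrt_sq hr]

lemma stackNorm_add_smul_le (x y : Stack n p) {c : ℝ} (hc : 0 ≤ c) :
    stackNorm (fun i => x i + c • y i) ≤ stackNorm x + c * stackNorm y := by
  refine Real.sqrt_le_iff.2 ⟨add_nonneg (stackNorm_nonneg x) (mul_nonneg hc (stackNorm_nonneg y)),
    ?_⟩
  have h1 : ∑ i, ‖x i + c • y i‖ ^ 2 ≤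
      ∑ i, (‖x i‖ ^ 2 + 2 * c * (‖x i‖ * ‖y i‖) + c ^ 2 * ‖y i‖ ^ 2) := by
    refine Finset.sum_le_sum fun i _ => ?_
    have h2 : ‖x i + c • y i‖ ≤ ‖x i‖ + c * ‖y i‖ := by
      refine (norm_add_le _ _).trans_eq ?_
      rw [norm_smul, Real.norm_of_nonneg hc]
    calc _ ≤ (‖x i‖ + c * ‖y i‖) ^ 2 := pow_le_pow_left₀ (norm_nonneg _) h2 2
      _ = _ := by ring
  rw [Finset.sum_add_distrib, Finset.sum_add_distrib, ← Finset.mul_sum, ← Finset.mul_sum,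
    ← stackNorm_sq x, ← stackNorm_sq y] at h1
  refine h1.trans ?_
  nlinarith [mul_le_mul_of_nonneg_left (sum_norm_mul_norm_le x y) hc]

/-- The bilinear form on stacked vectors defined by the matrix `P ⊗ I_p`. -/
noncomputable def stackForm (P : Matrix (Fin n) (Fin n) ℝ) (x y : Stack n p) : ℝ :=
  ∑ i, ∑ j, P i j * inner ℝ (x i) (y j)

lemma stackForm_eq_dotProduct (P : Matrix (Fin n) (Fin n) ℝ) (x : Stack n p) :
    stackForm P x x = (fun k : Fin n × Fin p => x k.1 k.2) ⬝ᵥ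
      ((P ⊗ₖ (1 : Matrix (Fin p) (Fin p) ℝ)) *ᵥ fun k => x k.1 k.2) := by
  simp only [stackForm, dotProduct, Matrix.mulVec, Matrix.kroneckerMap_apply,
    Fintype.sum_prod_type, Matrix.one_apply, PiLp.inner_apply, RCLike.inner_apply, conj_trivial,
    mul_ite, mul_one, mul_zero, ite_mul, zero_mul, Finset.sum_ite_eq, Finset.mem_univ, if_true,
    Finset.mul_sum]
  refine Finset.sum_congr rfl fun i _ => ?_
  rw [Finset.sum_comm]
  exact Finset.sum_congr rfl fun k _ => Finset.sum_congr rfl fun j _ => by ring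

lemma dotProduct_self_eq_stackNorm_sq (x : Stack n p) :
    (fun k : Fin n × Fin p => x k.1 k.2) ⬝ᵥ (fun k : Fin n × Fin p => x k.1 k.2)
      = stackNorm x ^ 2 := by
  rw [stackNorm_sq]
  simp only [dotProduct, Fintype.sum_prod_type, EuclideanSpace.norm_sq_eq, Real.norm_eq_abs,
    sq_abs]
  exact Finset.sum_congr rfl fun _ _ => Finset.sum_congr rfl fun _ _ => (sq _).symm

end Stack

/-! ### The matrices of the design -/

namespace Design

variable {n : ℕ} {D : Design n} {p : ℕ} {A : Matrix (Fin (n + 1)) (Fin (n + 1)) ℝ} {k : Bounds}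
  {G : Gains}

lemma posDef_X (h : (D.symPart A).PosDef) : (D.X p A).PosDef := h.kronecker .one

lemma lamMin_X_mul_le (h : (D.symPart A).PosDef) (x : Stack n p) :
    lamMin (D.X p A) * stackNorm x ^ 2 ≤ stackForm (D.symPart A) x x := by
  rw [stackForm_eq_dotProduct, ← dotProduct_self_eq_stackNorm_sq]
  exact lamMin_mul_dotProduct_le (posDef_X h).isHermitian _

lemma le_lamMax_X_mul (h : (D.symPart A).PosDef) (x : Stack n p) :
    stackForm (D.symPart A) x x ≤ lamMax (D.X p A) * stackNorm x ^ 2 := by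
  rw [stackForm_eq_dotProduct, ← dotProduct_self_eq_stackNorm_sq]
  exact dotProduct_le_lamMax_mul (posDef_X h).isHermitian _

lemma Nmat_eq_scalarBlocks : D.Nmat p A k G = scalarBlocks (Fin n × Fin p)
    (1 / 4 * G.η * lamMin (D.X p A)) (1 / 2 * G.μ⁻¹ * D.γmin * (k.km - D.δ))
    (1 / 2 * D.γmin * (k.km - D.δ)) := by
  rw [Nmat, scalarBlocks, Matrix.fromBlocks_smul]
  simp only [smul_smul]
  congr 2 <;> ring

lemma γmin_le (i : Fin n) : D.γmin ≤ D.γ i := ciInf_le (Set.finite_range D.γ).bddBelow i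

lemma γmin_pos (hn : 0 < n) (h : ∀ i, 0 < D.γ i) : 0 < D.γmin := by
  have : Nonempty (Fin n) := ⟨⟨0, hn⟩⟩
  obtain ⟨i, hi⟩ := exists_eq_ciInf_of_finite (f := D.γ)
  rw [γmin, ← hi]
  exact h i

end Design

/-! ### Diagonal stability of the follower block of the Laplacian -/

/-- The follower block of the Laplacian acts by weighted differences, the leader's value being
`0`. -/
lemma sum_lap22_smul {E : Type*} [AddCommGroup E] [Module ℝ E] {n : ℕ}
    (A : Matrix (Fin (n + 1)) (Fin (n + 1)) ℝ) (x : Fin n → E) (i : Fin n) :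
    ∑ j, lap22 A i j • x j
      = ∑ j, A i.succ j • (x i - (Fin.cons 0 x : Fin (n + 1) → E) j) := by
  have h1 : ∀ j : Fin n, lap22 A i j • x j
      = (if i = j then (∑ l, A i.succ l) • x j else 0) - A i.succ j.succ • x j := by
    intro j
    simp only [lap22, laplacian, Matrix.submatrix_apply, Matrix.of_apply, Fin.succ_inj]
    split_ifs with h
    · subst h
      rw [← sub_smul, ← Finset.sum_erase_add _ _ (Finset.mem_univ i.succ), add_sub_cancel_right]
    · rw [neg_smul, zero_sub]
  simp only [h1, Finset.sum_sub_distrib, smul_sub, Finset.sum_ite_eq, Finset.mem_univ, if_true]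
  rw [← Finset.sum_smul,
    Fin.sum_univ_succ (fun j => A i.succ j • (Fin.cons 0 x : Fin (n + 1) → E) j)]
  simp

lemma lap22_offDiag_nonpos {n : ℕ} {A : Matrix (Fin (n + 1)) (Fin (n + 1)) ℝ}
    (hA : IsAdjacency A) {i j : Fin n} (h : i ≠ j) : lap22 A i j ≤ 0 := by
  simp only [lap22, laplacian, Matrix.submatrix_apply, Matrix.of_apply, Fin.succ_inj, if_neg h]
  exact neg_nonpos.2 (hA.nonneg _ _)

/-- A positive vector whose image under `L₂₂` is positive: `1 - r ^ d`, where `d` is the depth in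
the spanning tree and `r` is small. -/
lemma exists_pos_lap22_mulVec_pos {n : ℕ} (hn : 0 < n) {A : Matrix (Fin (n + 1)) (Fin (n + 1)) ℝ}
    (hA : IsAdjacency A) (hT : HasSpanningTree A) :
    ∃ x : Fin n → ℝ, (∀ i, 0 < x i) ∧ ∀ i, 0 < (lap22 A *ᵥ x) i := by
  classical
  obtain ⟨par, hpar, hroot⟩ := hT
  have : Nonempty (Fin n) := ⟨⟨0, hn⟩⟩
  obtain ⟨i₀, hi₀⟩ := Finite.exists_min fun i : Fin n => A i.succ (par i.succ)
  set a := A i₀.succ (par i₀.succ) with ha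
  have ha0 : 0 < a := hpar _ (Fin.succ_ne_zero _)
  set s := ∑ i, ∑ j, A i j with hs
  have hs0 : 0 ≤ s := Finset.sum_nonneg fun i _ => Finset.sum_nonneg fun j _ => hA.nonneg i j
  -- Any `r < 1` with `s * r < a` will do.
  set r := a / (a + s + 1) with hr
  have hden : 0 < a + s + 1 := by linarith
  have hr0 : 0 < r := div_pos ha0 hden
  have hr1 : r < 1 := (div_lt_one hden).2 (by linarith)
  have hsr : s * r < a := by
    rw [hr, mul_div_assoc', div_lt_iff₀ hden]
    nlinarith
  let dep : Fin (n + 1) → ℕ := fun v => Nat.find (hroot v)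
  have hdep0 : dep 0 = 0 := (Nat.find_eq_zero _).2 rfl
  have hdep : ∀ v, v ≠ 0 → dep v = dep (par v) + 1 := fun v hv => by
    have h1 : par^[dep v] v = 0 := Nat.find_spec (hroot v)
    obtain ⟨k, hk⟩ := Nat.exists_eq_succ_of_ne_zero
      (show dep v ≠ 0 from fun h => hv (by rw [h] at h1; exact h1))
    have h2 : dep (par v) ≤ k := Nat.find_le (by rw [hk] at h1; exact h1)
    have h3 : dep v ≤ dep (par v) + 1 := Nat.find_le (Nat.find_spec (hroot (par v)))
    omega
  refine ⟨fun i => 1 - r ^ dep i.succ, fun i => ?_, fun i => ?_⟩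
  · change 0 < 1 - r ^ dep i.succ
    rw [hdep _ (Fin.succ_ne_zero i)]
    exact sub_pos.2 (pow_lt_one₀ hr0.le hr1 (Nat.succ_ne_zero _))
  have h1 := sum_lap22_smul A (fun i : Fin n => 1 - r ^ dep i.succ) i
  have h2 : ∀ j, (Fin.cons 0 (fun i : Fin n => 1 - r ^ dep i.succ) : Fin (n + 1) → ℝ) j
      = 1 - r ^ dep j := fun j => by
    refine Fin.cases ?_ (fun j => ?_) j
    · simp [hdep0]
    · simp
  simp only [smul_eq_mul, h2] at h1
  rw [Matrix.mulVec, dotProduct, h1]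
  have h3 : ∑ j, A i.succ j * (1 - r ^ dep i.succ - (1 - r ^ dep j))
      = ∑ j, A i.succ j * r ^ dep j - (∑ j, A i.succ j) * r ^ dep i.succ := by
    rw [Finset.sum_mul, ← Finset.sum_sub_distrib]
    exact Finset.sum_congr rfl fun j _ => by ring
  have h4 : A i.succ (par i.succ) * r ^ dep (par i.succ) ≤ ∑ j, A i.succ j * r ^ dep j :=
    Finset.single_le_sum (f := fun j => A i.succ j * r ^ dep j)
      (fun j _ => mul_nonneg (hA.nonneg _ _) (pow_nonneg hr0.le _)) (Finset.mem_univ _)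
  have h5 : ∑ j, A i.succ j ≤ s :=
    Finset.single_le_sum (f := fun i => ∑ j, A i j)
      (fun i _ => Finset.sum_nonneg fun j _ => hA.nonneg i j) (Finset.mem_univ _)
  rw [h3, hdep _ (Fin.succ_ne_zero i), pow_succ]
  have hp : 0 < r ^ dep (par i.succ) := pow_pos hr0 _
  have h6 : (∑ j, A i.succ j) * r < A i.succ (par i.succ) :=
    ((mul_le_mul_of_nonneg_right h5 hr0.le).trans_lt hsr).trans_le (hi₀ i)
  nlinarith [mul_lt_mul_of_pos_right h6 hp]

section ZMatrix

variable {n : ℕ} {L : Matrix (Fin n) (Fin n) ℝ}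

/-- A matrix with nonpositive off-diagonal entries that maps some positive vector to a positive
vector is inverse monotone. -/
lemma nonneg_of_mulVec_nonneg (hZ : ∀ i j, i ≠ j → L i j ≤ 0) {x : Fin n → ℝ}
    (hx : ∀ i, 0 < x i) (hLx : ∀ i, 0 < (L *ᵥ x) i) {z : Fin n → ℝ}
    (hz : ∀ i, 0 ≤ (L *ᵥ z) i) : ∀ i, 0 ≤ z i := by
  intro i
  have : Nonempty (Fin n) := ⟨i⟩
  -- Compare `z` with the largest multiple of `x` below it.
  obtain ⟨m, hm⟩ := Finite.exists_min fun i => z i / x i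
  suffices 0 ≤ z m / x m by
    have h := this.trans (hm i)
    rwa [le_div_iff₀ (hx i), zero_mul] at h
  by_contra! hneg
  have h1 : (L *ᵥ z) m ≤ z m / x m * (L *ᵥ x) m := by
    simp only [Matrix.mulVec, dotProduct, Finset.mul_sum]
    refine Finset.sum_le_sum fun j _ => ?_
    rcases eq_or_ne m j with rfl | hj
    · exact le_of_eq (by field_simp [(hx m).ne'])
    · have h2 : z m / x m * x j ≤ z j := (le_div_iff₀ (hx j)).1 (hm j)
      nlinarith [mul_le_mul_of_nonpos_left h2 (hZ m j hj)]
  linarith [hz m, mul_neg_of_neg_of_pos hneg (hLx m)]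

/-- The row sums of the nonnegative matrix `(Lᵀ)⁻¹` form such a vector. -/
lemma exists_pos_vecMul_pos (hZ : ∀ i j, i ≠ j → L i j ≤ 0) {x : Fin n → ℝ}
    (hx : ∀ i, 0 < x i) (hLx : ∀ i, 0 < (L *ᵥ x) i) :
    ∃ y : Fin n → ℝ, (∀ i, 0 < y i) ∧ ∀ i, 0 < (y ᵥ* L) i := by
  have hinj : Function.Injective L.mulVec := by
    refine (injective_iff_map_eq_zero L.mulVecLin).2 fun z hz => ?_
    have hz' : L *ᵥ z = 0 := hz
    have h1 := nonneg_of_mulVec_nonneg hZ hx hLx (z := z) (by simp [hz'])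
    have h2 := nonneg_of_mulVec_nonneg hZ hx hLx (z := -z) (by simp [Matrix.mulVec_neg, hz'])
    exact funext fun i => le_antisymm (neg_nonneg.1 (h2 i)) (h1 i)
  have hu : IsUnit L := Matrix.mulVec_injective_iff_isUnit.1 hinj
  have hdet : IsUnit L.det := (Matrix.isUnit_iff_isUnit_det L).1 hu
  have hinv : ∀ i j, 0 ≤ L⁻¹ i j := fun i j => by
    have h1 := nonneg_of_mulVec_nonneg hZ hx hLx (z := L⁻¹ *ᵥ Pi.single j 1) (fun i => by
      rw [Matrix.mulVec_mulVec, Matrix.mul_nonsing_inv _ hdet, Matrix.one_mulVec]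
      exact (Pi.single_nonneg.2 zero_le_one : (0 : Fin n → ℝ) ≤ Pi.single j 1) i) i
    simpa using h1
  have hyL : (1 : Fin n → ℝ) ᵥ* L⁻¹ ᵥ* L = 1 := by
    rw [Matrix.vecMul_vecMul, Matrix.nonsing_inv_mul _ hdet, Matrix.vecMul_one]
  have hy0 : ∀ i, 0 ≤ ((1 : Fin n → ℝ) ᵥ* L⁻¹) i := fun i => by
    simp only [Matrix.vecMul, dotProduct, Pi.one_apply, one_mul]
    exact Finset.sum_nonneg fun j _ => hinv j i
  refine ⟨(1 : Fin n → ℝ) ᵥ* L⁻¹, fun i => (hy0 i).lt_of_ne fun h => ?_, fun i => ?_⟩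
  · have h1 : ((1 : Fin n → ℝ) ᵥ* L⁻¹ ᵥ* L) i ≤ 0 := by
      rw [Matrix.vecMul, dotProduct]
      refine Finset.sum_nonpos fun j _ => ?_
      rcases eq_or_ne j i with rfl | hj
      · rw [← h, zero_mul]
      · exact mul_nonpos_of_nonneg_of_nonpos (hy0 j) (hZ j i hj)
    rw [hyL] at h1
    exact absurd h1 (by simp)
  · rw [hyL]
    exact one_pos

/-- A symmetric matrix with nonpositive off-diagonal entries that maps some positive vector to a
positive vector is positive definite. -/
lemma posDef_of_offDiag_nonpos (hS : L.IsHermitian) (hZ : ∀ i j, i ≠ j → L i j ≤ 0)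
    {x : Fin n → ℝ} (hx : ∀ i, 0 < x i) (hLx : ∀ i, 0 < (L *ᵥ x) i) : L.PosDef := by
  refine .of_dotProduct_mulVec_pos hS fun z hz => ?_
  have hsymm : ∀ i j, L i j = L j i := fun i j => by simpa using (hS.apply i j).symm
  -- With `w = z / x`, replace each product `w i * w j` by the mean of the squares.
  set w : Fin n → ℝ := fun i => z i / x i with hw
  have hzw : ∀ i, z i = w i * x i := fun i => (div_mul_cancel₀ _ (hx i).ne').symm
  have h1 : ∀ i j, (w i ^ 2 + w j ^ 2) / 2 * (x i * (L i j * x j)) ≤ z i * (L i j * z j) := by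
    intro i j
    rw [hzw i, hzw j]
    rcases eq_or_ne i j with rfl | hij
    · exact le_of_eq (by ring)
    · have h2 : 0 ≤ x i * x j * (-L i j) :=
        mul_nonneg (mul_pos (hx i) (hx j)).le (neg_nonneg.2 (hZ i j hij))
      nlinarith [mul_nonneg h2 (sq_nonneg (w i - w j))]
  have h2 : ∑ i, w i ^ 2 * x i * (L *ᵥ x) i
      = ∑ i, ∑ j, (w i ^ 2 + w j ^ 2) / 2 * (x i * (L i j * x j)) := by
    have e1 : ∑ i, w i ^ 2 * x i * (L *ᵥ x) i = ∑ i, ∑ j, w i ^ 2 * (x i * (L i j * x j)) :=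
      Finset.sum_congr rfl fun i _ => by
        rw [Matrix.mulVec, dotProduct, Finset.mul_sum]
        exact Finset.sum_congr rfl fun j _ => by ring
    have e2 : ∑ i, ∑ j, w i ^ 2 * (x i * (L i j * x j))
        = ∑ i, ∑ j, w j ^ 2 * (x i * (L i j * x j)) := by
      rw [Finset.sum_comm]
      exact Finset.sum_congr rfl fun i _ => Finset.sum_congr rfl fun j _ => by
        rw [hsymm j i]; ring
    have e3 : ∑ i, ∑ j, (w i ^ 2 + w j ^ 2) / 2 * (x i * (L i j * x j))
        = (∑ i, ∑ j, w i ^ 2 * (x i * (L i j * x j))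
          + ∑ i, ∑ j, w j ^ 2 * (x i * (L i j * x j))) / 2 := by
      rw [← Finset.sum_add_distrib, Finset.sum_div]
      refine Finset.sum_congr rfl fun i _ => ?_
      rw [← Finset.sum_add_distrib, Finset.sum_div]
      exact Finset.sum_congr rfl fun j _ => by ring
    rw [e3, ← e2, e1]
    ring
  have h3 : ∑ i, w i ^ 2 * x i * (L *ᵥ x) i ≤ star z ⬝ᵥ (L *ᵥ z) := by
    rw [h2, star_trivial, dotProduct]
    refine Finset.sum_le_sum fun i _ => ?_
    rw [Matrix.mulVec, dotProduct, Finset.mul_sum]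
    exact Finset.sum_le_sum fun j _ => h1 i j
  refine lt_of_lt_of_le ?_ h3
  obtain ⟨i, hi⟩ := Function.ne_iff.1 hz
  have hwi : w i ≠ 0 := div_ne_zero hi (hx i).ne'
  have hwx := hx i
  have hwL := hLx i
  exact Finset.sum_pos' (fun j _ => mul_nonneg (mul_nonneg (sq_nonneg _) (hx j).le) (hLx j).le)
    ⟨i, Finset.mem_univ i, by positivity⟩

end ZMatrix

/-- Diagonal stability of the follower block: with positive `x`, `y` such that `L₂₂ x` and
`yᵀ L₂₂` are positive, the weights `y / x` make `Γ L₂₂ + L₂₂ᵀ Γ` map `x` to a positive vector. -/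
lemma exists_diagonal_posDef {n : ℕ} (hn : 0 < n) {A : Matrix (Fin (n + 1)) (Fin (n + 1)) ℝ}
    (hA : IsAdjacency A) (hT : HasSpanningTree A) :
    ∃ γ : Fin n → ℝ, (∀ i, 0 < γ i) ∧ (∀ i, γ i ≤ 1) ∧ (∃ i, γ i = 1) ∧
      (Matrix.diagonal γ * lap22 A + (lap22 A)ᵀ * Matrix.diagonal γ).PosDef := by
  obtain ⟨x, hx, hLx⟩ := exists_pos_lap22_mulVec_pos hn hA hT
  obtain ⟨y, hy, hyL⟩ := exists_pos_vecMul_pos (fun i j h => lap22_offDiag_nonpos hA h) hx hLx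
  have : Nonempty (Fin n) := ⟨⟨0, hn⟩⟩
  obtain ⟨m, hm⟩ := Finite.exists_max fun i => y i / x i
  have hm0 : 0 < y m / x m := div_pos (hy m) (hx m)
  refine ⟨fun i => (y i / x i) / (y m / x m), fun i => div_pos (div_pos (hy i) (hx i)) hm0,
    fun i => (div_le_one hm0).2 (hm i), ⟨m, div_self hm0.ne'⟩, ?_⟩
  set γ : Fin n → ℝ := fun i => (y i / x i) / (y m / x m) with hγ
  have hγ0 : ∀ i, 0 < γ i := fun i => div_pos (div_pos (hy i) (hx i)) hm0
  refine posDef_of_offDiag_nonpos ?_ (fun i j hij => ?_) hx (fun i => ?_)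
  · rw [Matrix.IsHermitian, Matrix.conjTranspose_eq_transpose_of_trivial]
    simp [Matrix.transpose_mul, add_comm]
  · rw [Matrix.add_apply, Matrix.diagonal_mul, Matrix.mul_diagonal, Matrix.transpose_apply]
    exact add_nonpos (mul_nonpos_of_nonneg_of_nonpos (hγ0 i).le (lap22_offDiag_nonpos hA hij))
      (mul_nonpos_of_nonpos_of_nonneg (lap22_offDiag_nonpos hA hij.symm) (hγ0 j).le)
  · rw [Matrix.add_mulVec, ← Matrix.mulVec_mulVec, ← Matrix.mulVec_mulVec, Pi.add_apply,
      Matrix.mulVec_diagonal, Matrix.mulVec_transpose]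
    have h1 : Matrix.diagonal γ *ᵥ x = (y m / x m)⁻¹ • y := by
      funext j
      rw [Matrix.mulVec_diagonal, Pi.smul_apply, smul_eq_mul, hγ]
      have := (hx j).ne'
      have := hm0.ne'
      field_simp
    rw [h1, Matrix.smul_vecMul, Pi.smul_apply, smul_eq_mul]
    exact add_pos (mul_pos (hγ0 i) (hLx i)) (mul_pos (inv_pos.2 hm0) (hyL i))

lemma exists_admissible {n p : ℕ} (hn : 0 < n) {A : Matrix (Fin (n + 1)) (Fin (n + 1)) ℝ}
    (hA : IsAdjacency A) (hT : HasSpanningTree A) {k : Bounds} (hk : k.Valid) :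
    ∃ D : Design n, D.Admissible p A k := by
  obtain ⟨γ, h1, h2, h3, h4⟩ := exists_diagonal_posDef hn hA hT
  -- The thresholds for `μ₃` do not depend on `μ₃`, so it can be chosen last.
  set E : Design n := ⟨γ, k.km / 2, 0⟩ with hE
  refine ⟨⟨γ, k.km / 2, max (Real.sqrt ((k.kM + E.δ) / (2 * lamMax (E.X p A))))
    (Real.sqrt (2 * E.γmin * (k.km - E.δ) / lamMin (E.X p A))) + 1⟩, h1, h2, h3, h4,
    half_pos hk.km_pos, half_lt_self hk.km_pos, ?_, ?_⟩
  · exact (le_max_left _ _).trans_lt (lt_add_one _)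
  · exact (le_max_right _ _).trans_lt (lt_add_one _)

/-! ### Solvability of the gain inequalities -/

namespace Design

variable {n p : ℕ} {D : Design n} {A : Matrix (Fin (n + 1)) (Fin (n + 1)) ℝ} {k : Bounds}
  {G : Gains}

/-- The standing assumptions on a design: there are followers and coordinates, the constants are
valid and the design is admissible. -/
structure Standing (D : Design n) (p : ℕ) (A : Matrix (Fin (n + 1)) (Fin (n + 1)) ℝ)
    (k : Bounds) : Prop where
  n_pos : 0 < n
  p_pos : 0 < p
  valid : k.Valid
  adm : D.Admissible p A k

lemma lamMin_X_pos (hS : D.Standing p A k) : 0 < lamMin (D.X p A) := by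
  have : Nonempty (Fin n × Fin p) := ⟨(⟨0, hS.n_pos⟩, ⟨0, hS.p_pos⟩)⟩
  exact lamMin_pos (posDef_X hS.adm.posDef)

lemma lamMin_X_le_lamMax_X (hS : D.Standing p A k) : lamMin (D.X p A) ≤ lamMax (D.X p A) := by
  have : Nonempty (Fin n × Fin p) := ⟨(⟨0, hS.n_pos⟩, ⟨0, hS.p_pos⟩)⟩
  exact lamMin_le_lamMax (posDef_X hS.adm.posDef).isHermitian

lemma kappa_pos (hS : D.Standing p A k) : 0 < D.γmin * (k.km - D.δ) :=
  mul_pos (γmin_pos hS.n_pos hS.adm.γ_pos) (sub_pos.2 hS.adm.δ_lt)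

lemma kappa_lt (hS : D.Standing p A k) : D.γmin * (k.km - D.δ) < k.kM + D.δ := by
  have h1 : D.γmin ≤ 1 := (γmin_le ⟨0, hS.n_pos⟩).trans (hS.adm.γ_le_one _)
  nlinarith [hS.adm.δ_pos, hS.adm.δ_lt, hS.valid.km_le_kM,
    mul_le_mul_of_nonneg_right h1 (sub_pos.2 hS.adm.δ_lt).le]

lemma μ₃_pos (hS : D.Standing p A k) : 0 < D.μ₃ := (Real.sqrt_nonneg _).trans_lt hS.adm.μ₃_gt₁

lemma kappa_mul_inv_sq_lt (hS : D.Standing p A k) :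
    2 * (D.μ₃⁻¹ ^ 2 * (D.γmin * (k.km - D.δ))) < lamMin (D.X p A) := by
  have hμ := μ₃_pos hS
  have hl := lamMin_X_pos hS
  have h := (Real.sqrt_lt' hμ).1 hS.adm.μ₃_gt₂
  rw [div_lt_iff₀ hl] at h
  have h2 : 2 * (D.μ₃⁻¹ ^ 2 * (D.γmin * (k.km - D.δ)))
      = (2 * D.γmin * (k.km - D.δ)) / D.μ₃ ^ 2 := by field_simp
  rw [h2, div_lt_iff₀ (by positivity)]
  linarith

lemma ρ₂_lower (hS : D.Standing p A k) (hη : 1 ≤ G.η) :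
    G.η * (1 / 4 * lamMin (D.X p A) - 1 / 2 * (D.μ₃⁻¹ ^ 2 * (D.γmin * (k.km - D.δ))))
      ≤ D.ρ₂ p A k G := by
  have h := kappa_pos hS
  have hμ := inv_pos.2 (μ₃_pos hS)
  have h2 : 0 ≤ D.μ₃⁻¹ ^ 2 * (D.γmin * (k.km - D.δ)) := by positivity
  rw [ρ₂]
  nlinarith

lemma ρ₂_coeff_pos (hS : D.Standing p A k) :
    0 < 1 / 4 * lamMin (D.X p A) - 1 / 2 * (D.μ₃⁻¹ ^ 2 * (D.γmin * (k.km - D.δ))) := by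
  linarith [kappa_mul_inv_sq_lt hS]

lemma ρ₂_pos (hS : D.Standing p A k) (hη : 1 ≤ G.η) : 0 < D.ρ₂ p A k G :=
  (mul_pos (one_pos.trans_le hη) (ρ₂_coeff_pos hS)).trans_le (ρ₂_lower hS hη)

lemma ρ₂_lt (hS : D.Standing p A k) (hη : 1 ≤ G.η) : D.ρ₂ p A k G < G.η * lamMax (D.X p A) := by
  have h := kappa_pos hS
  have hμ := inv_pos.2 (μ₃_pos hS)
  have h2 : 0 ≤ D.μ₃⁻¹ ^ 2 * (D.γmin * (k.km - D.δ)) := by positivity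
  have hl := lamMin_X_pos hS
  have hL := lamMin_X_le_lamMax_X hS
  rw [ρ₂]
  nlinarith [mul_le_mul_of_nonneg_left hL (zero_le_one.trans hη), mul_pos (one_pos.trans_le hη) hl]

lemma σ₂_lower (hS : D.Standing p A k) (hη : 1 ≤ G.η) :
    1 / 2 * (D.γmin * (k.km - D.δ))
      - (1 / 2 * D.μ₃⁻¹ * D.γmin * (k.km - D.δ)) ^ 2 / (1 / 4 * lamMin (D.X p A))
      ≤ D.σ₂ p A k G := by
  have hl := lamMin_X_pos hS
  have h := div_le_div_of_nonneg_left (sq_nonneg (1 / 2 * D.μ₃⁻¹ * D.γmin * (k.km - D.δ)))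
    (show 0 < 1 / 4 * lamMin (D.X p A) by positivity)
    (show 1 / 4 * lamMin (D.X p A) ≤ 1 / 4 * G.η * lamMin (D.X p A) by nlinarith)
  rw [σ₂]
  linarith

lemma σ₂_coeff_pos (hS : D.Standing p A k) :
    0 < 1 / 2 * (D.γmin * (k.km - D.δ))
      - (1 / 2 * D.μ₃⁻¹ * D.γmin * (k.km - D.δ)) ^ 2 / (1 / 4 * lamMin (D.X p A)) := by
  have hl := lamMin_X_pos hS
  have h := kappa_pos hS
  rw [sub_pos, div_lt_iff₀ (by positivity)]
  nlinarith [mul_lt_mul_of_pos_right (kappa_mul_inv_sq_lt hS) h]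

lemma σ₂_pos (hS : D.Standing p A k) (hη : 1 ≤ G.η) : 0 < D.σ₂ p A k G :=
  (σ₂_coeff_pos hS).trans_le (σ₂_lower hS hη)

lemma σ₂_lt (hS : D.Standing p A k) (hη : 1 ≤ G.η) : D.σ₂ p A k G < 1 / 2 * (k.kM + D.δ) := by
  have hl := lamMin_X_pos hS
  have h := kappa_lt hS
  have hη0 := one_pos.trans_le hη
  have h2 : 0 ≤ (1 / 2 * D.μ₃⁻¹ * D.γmin * (k.km - D.δ)) ^ 2
      / (1 / 4 * G.η * lamMin (D.X p A)) := by
    positivity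
  rw [σ₂]
  linarith

lemma kM_add_δ_pos (hS : D.Standing p A k) : 0 < k.kM + D.δ := by
  linarith [hS.adm.δ_pos, hS.valid.km_pos, hS.valid.km_le_kM]

lemma Vbound_mono (hS : D.Standing p A k) (hη : 0 ≤ G.η) {x y x' y' : ℝ} (hx : 0 ≤ x)
    (hy : 0 ≤ y) (hxx : x ≤ x') (hyy : y ≤ y') : D.Vbound p A k G x y ≤ D.Vbound p A k G x' y' := by
  have h1 := kM_add_δ_pos hS
  have h2 := inv_pos.2 (μ₃_pos hS)
  have h3 := (lamMin_X_pos hS).trans_le (lamMin_X_le_lamMax_X hS)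
  unfold Vbound
  have hx' := hx.trans hxx
  gcongr

lemma Vbound_strictMono (hS : D.Standing p A k) (hη : 0 ≤ G.η) {x y x' y' : ℝ} (hx : 0 ≤ x)
    (hy : 0 ≤ y) (hxx : x ≤ x') (hyy : y < y') : D.Vbound p A k G x y < D.Vbound p A k G x' y' := by
  refine (Vbound_mono hS hη hx hy hxx le_rfl).trans_lt ?_
  have h1 := kM_add_δ_pos hS
  have h2 := inv_pos.2 (μ₃_pos hS)
  have hx' := hx.trans hxx
  have h4 : D.μ₃⁻¹ * (k.kM + D.δ) * x' * y ≤ D.μ₃⁻¹ * (k.kM + D.δ) * x' * y' := by gcongr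
  have h5 : 1 / 2 * (k.kM + D.δ) * y ^ 2 < 1 / 2 * (k.kM + D.δ) * y' ^ 2 := by gcongr
  unfold Vbound
  linarith

lemma Vbound_gt_left (hS : D.Standing p A k) {x y : ℝ} (hx : 0 < x) (hy : 0 < y) :
    G.η * lamMax (D.X p A) * x ^ 2 < D.Vbound p A k G x y := by
  have h1 := kM_add_δ_pos hS
  have h2 := inv_pos.2 (μ₃_pos hS)
  have : 0 < 1 / 2 * (k.kM + D.δ) * y ^ 2 + D.μ₃⁻¹ * (k.kM + D.δ) * x * y := by positivity
  rw [Vbound]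
  linarith

lemma Vbound_gt_right (hS : D.Standing p A k) (hη : 1 ≤ G.η) {x y : ℝ} (hx : 0 < x) (hy : 0 < y) :
    1 / 2 * (k.kM + D.δ) * y ^ 2 < D.Vbound p A k G x y := by
  have h1 := kM_add_δ_pos hS
  have h2 := inv_pos.2 (μ₃_pos hS)
  have h3 := (lamMin_X_pos hS).trans_le (lamMin_X_le_lamMax_X hS)
  have h4 := one_pos.trans_le hη
  have : 0 < G.η * lamMax (D.X p A) * x ^ 2 + D.μ₃⁻¹ * (k.kM + D.δ) * x * y := by positivity
  rw [Vbound]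
  linarith

lemma two_ka_lt_X₁ (hS : D.Standing p A k) (hη : 1 ≤ G.η) : 2 * k.ka < D.X₁ p A k G := by
  have hka := hS.valid.ka_pos
  have hkb := hS.valid.kb_pos
  have hρ := ρ₂_pos hS hη
  refine (Real.lt_sqrt (by positivity)).2 ((lt_div_iff₀ hρ).2 ?_)
  have h1 := Vbound_gt_left (G := G) hS (x := 2 * k.ka) (y := 2 * k.kb) (by positivity)
    (by positivity)
  have h2 := mul_lt_mul_of_pos_left (ρ₂_lt hS hη) (show 0 < (2 * k.ka) ^ 2 by positivity)
  rw [Vstar]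
  linarith

lemma two_kb_lt_Y₁ (hS : D.Standing p A k) (hη : 1 ≤ G.η) : 2 * k.kb < D.Y₁ p A k G := by
  have hka := hS.valid.ka_pos
  have hkb := hS.valid.kb_pos
  have hρ := σ₂_pos hS hη
  refine (Real.lt_sqrt (by positivity)).2 ((lt_div_iff₀ hρ).2 ?_)
  have h1 := Vbound_gt_right hS hη (x := 2 * k.ka) (y := 2 * k.kb) (by positivity)
    (by positivity)
  have h2 := mul_lt_mul_of_pos_left (σ₂_lt hS hη) (show 0 < (2 * k.kb) ^ 2 by positivity)
  rw [Vstar]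
  linarith

lemma Vstar_lt_Vhat (hS : D.Standing p A k) (hη : 1 ≤ G.η) : D.Vstar p A k G < D.Vhat p A k G :=
  Vbound_strictMono hS (zero_le_one.trans hη) (by linarith [hS.valid.ka_pos])
    (by linarith [hS.valid.kb_pos]) (two_ka_lt_X₁ hS hη).le (two_kb_lt_Y₁ hS hη)

/-- `𝒳` stays bounded as `η` grows. -/
lemma exists_XX_le (hS : D.Standing p A k) : ∃ C : ℝ, ∀ G : Gains, 1 ≤ G.η → D.XX p A k G ≤ C := by
  set d := 1 / 4 * lamMin (D.X p A) - 1 / 2 * (D.μ₃⁻¹ ^ 2 * (D.γmin * (k.km - D.δ))) with hd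
  set s := 1 / 2 * (D.γmin * (k.km - D.δ))
      - (1 / 2 * D.μ₃⁻¹ * D.γmin * (k.km - D.δ)) ^ 2 / (1 / 4 * lamMin (D.X p A)) with hs
  have hd0 : 0 < d := ρ₂_coeff_pos hS
  have hs0 : 0 < s := σ₂_coeff_pos hS
  have hka := hS.valid.ka_pos
  have hkb := hS.valid.kb_pos
  have h1 := kM_add_δ_pos hS
  have h2 := inv_pos.2 (μ₃_pos hS)
  have h3 := (lamMin_X_pos hS).trans_le (lamMin_X_le_lamMax_X hS)
  -- With `y = √η b` every term of `Vbound` is at most `η` times its value at `η = 1`.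
  have hV : ∀ G : Gains, 1 ≤ G.η → ∀ a b x y : ℝ, 0 ≤ a → 0 ≤ b → 0 ≤ x → 0 ≤ y → x ≤ a →
      y ≤ Real.sqrt G.η * b → D.Vbound p A k G x y ≤ G.η * D.Vbound p A k ⟨0, 1, 0⟩ a b := by
    intro G hη a b x y ha hb hx hy hxa hyb
    have hη0 := one_pos.trans_le hη
    refine (Vbound_mono hS hη0.le hx hy hxa hyb).trans ?_
    have h4 : Real.sqrt G.η ≤ G.η := by
      rw [Real.sqrt_le_left hη0.le]
      nlinarith
    have h5 : D.μ₃⁻¹ * (k.kM + D.δ) * a * (Real.sqrt G.η * b)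
        ≤ D.μ₃⁻¹ * (k.kM + D.δ) * a * (G.η * b) := by gcongr
    simp only [Vbound, mul_pow, Real.sq_sqrt hη0.le]
    linarith
  set C₁ := D.Vbound p A k ⟨0, 1, 0⟩ (2 * k.ka) (2 * k.kb) with hC₁
  refine ⟨Real.sqrt (D.Vbound p A k ⟨0, 1, 0⟩ (Real.sqrt (C₁ / d)) (Real.sqrt (C₁ / s)) / d),
    fun G hη => ?_⟩
  have hη0 := one_pos.trans_le hη
  have hρ := ρ₂_lower hS hη
  have hσ := σ₂_lower hS hη
  rw [← hd] at hρ
  rw [← hs] at hσ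
  have hC₁0 : 0 ≤ C₁ := by
    rw [hC₁, Vbound]
    positivity
  have hstar : D.Vstar p A k G ≤ G.η * C₁ := by
    refine hV G hη _ _ _ _ (by positivity) (by positivity) (by positivity) (by positivity) le_rfl ?_
    have : 1 ≤ Real.sqrt G.η := Real.one_le_sqrt.2 hη
    nlinarith
  have hX₁ : D.X₁ p A k G ≤ Real.sqrt (C₁ / d) := by
    refine Real.sqrt_le_sqrt ((div_le_div₀ (by positivity) hstar (by positivity) hρ).trans_eq ?_)
    exact mul_div_mul_left _ _ hη0.ne'
  have hY₁ : D.Y₁ p A k G ≤ Real.sqrt G.η * Real.sqrt (C₁ / s) := by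
    rw [← Real.sqrt_mul hη0.le, mul_div_assoc']
    exact Real.sqrt_le_sqrt (div_le_div₀ (by positivity) hstar hs0 hσ)
  have hhat := hV G hη _ _ _ _ (Real.sqrt_nonneg _) (Real.sqrt_nonneg _) (Real.sqrt_nonneg _)
    (Real.sqrt_nonneg _) hX₁ hY₁
  have hC₂0 : 0 ≤ D.Vbound p A k ⟨0, 1, 0⟩ (Real.sqrt (C₁ / d)) (Real.sqrt (C₁ / s)) := by
    rw [Vbound]
    positivity
  refine Real.sqrt_le_sqrt ((div_le_div₀ (by positivity) hhat (by positivity) hρ).trans_eq ?_)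
  exact mul_div_mul_left _ _ hη0.ne'

lemma βlow_nonneg (hS : D.Standing p A k) : 0 ≤ D.βlow k := by
  have h1 := γmin_pos hS.n_pos hS.adm.γ_pos
  have h2 := hS.valid.kg_pos
  have h3 := hS.valid.kζ_nonneg
  have h4 := hS.valid.kq_pos
  have h5 := hS.valid.km_pos.trans_le hS.valid.km_le_kM
  have h6 := hS.valid.kC_pos
  rw [βlow]
  positivity

/-- For all large `η` the boundary layers may be taken to reach down to `2 k_a` and `2 k_b`: there
the quadratic part of `p`, whose coefficients grow with `η`, dominates its linear part. -/
lemma exists_gainInequalities (hS : D.Standing p A k) {β μ : ℝ} (hβ : D.βlow k < β)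
    (hμ₃ : D.μ₃ ≤ μ) (hμ : D.μlow p A k < μ) :
    ∃ η₀ : ℝ, ∀ η : ℝ, η₀ ≤ η → ∃ ϑ ε : ℝ, D.GainInequalities p A k ⟨μ, η, β⟩ ϑ ε := by
  obtain ⟨C, hC⟩ := exists_XX_le hS
  have hl := lamMin_X_pos hS
  have hμ0 : 0 < μ := (μ₃_pos hS).trans_le hμ₃
  have hka := hS.valid.ka_pos
  have hkb := hS.valid.kb_pos
  have hkC := hS.valid.kC_pos
  have hkp := hS.valid.kp_pos
  set r := min (2 * k.ka) (2 * k.kb) with hr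
  have hr0 : 0 < r := lt_min (by positivity) (by positivity)
  set c := linCoeff n p k ⟨μ, 0, β⟩ with hc
  have hβ0 : 0 < β := (βlow_nonneg hS).trans_lt hβ
  have hc0 : 0 ≤ c := by
    have h2 := hS.valid.kg_pos
    have h3 := hS.valid.kζ_nonneg
    have h4 := hS.valid.kq_pos
    have h5 := hS.valid.km_pos.trans_le hS.valid.km_le_kM
    rw [hc, linCoeff]
    positivity
  -- `R (x² + y²)` exceeds the linear part `c (x + μ y)` as soon as `x + y ≥ r`, because
  -- `x² + y² ≥ r (x + y) / 2`.
  set R := 2 * c * (1 + μ) / r + 1 with hR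
  have ha : 0 < 1 / 2 * μ ^ 2 * lamMin (D.X p A) := by positivity
  have hb : 0 < 1 / 2 * lamMin (D.X p A) := by positivity
  refine eventually_atTop.1 ?_
  filter_upwards [eventually_gt_atTop 1,
    (tendsto_id.const_mul_atTop ha).eventually_gt_atTop
      ((2 * k.kC * k.kp) ^ 2 / (2 * lamMin (D.X p A)) + k.kC * C + μ * k.kC * k.kp + k.kM),
    (tendsto_id.const_mul_atTop ha).eventually_ge_atTop
      (R + μ * k.kC * k.kp + k.kM + k.kC * k.kp + k.kC * C),
    (tendsto_id.const_mul_atTop hb).eventually_ge_atTop (R + k.kC * k.kp)] with η h1 h2 h3 h4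
  simp only [id] at h2 h3 h4
  have hXC := hC ⟨μ, η, β⟩ h1.le
  refine ⟨D.XX p A k ⟨μ, η, β⟩ - 2 * k.ka, D.YY p A k ⟨μ, η, β⟩ - 2 * k.kb, hβ, hμ₃, hμ, h1, ?_,
    ?_, ?_, ?_, ?_, ?_⟩
  · have h5 : (2 * k.kC * k.kp) ^ 2 / (2 * η * lamMin (D.X p A))
        ≤ (2 * k.kC * k.kp) ^ 2 / (2 * lamMin (D.X p A)) :=
      div_le_div_of_nonneg_left (sq_nonneg _) (by positivity) (by nlinarith)
    have h6 := mul_le_mul_of_nonneg_left hXC hkC.le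
    simp only [φ]
    linarith
  · linarith [two_ka_lt_X₁ hS (G := ⟨μ, η, β⟩) h1.le]
  · linarith
  · linarith [two_kb_lt_Y₁ hS (G := ⟨μ, η, β⟩) h1.le]
  · linarith
  · intro x hx y hy hxy
    have hx0 : 0 ≤ x := hx.1
    have hy0 : 0 ≤ y := hy.1
    have hxC : x ≤ C := hx.2.trans hXC
    have hor : r ≤ x + y := by
      rcases hxy with h | h
      · linarith [min_le_left (2 * k.ka) (2 * k.kb)]
      · linarith [min_le_right (2 * k.ka) (2 * k.kb)]
    have e1 : c * (x + μ * y) ≤ c * ((1 + μ) * (x + y)) := by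
      refine mul_le_mul_of_nonneg_left ?_ hc0
      nlinarith
    have e2 : R * (r / 2) = c * (1 + μ) + r / 2 := by
      rw [hR]
      field_simp
    have hR0 : 0 < R := by positivity
    have e3 : r / 2 * (x + y) ≤ x ^ 2 + y ^ 2 := by
      nlinarith [mul_le_mul_of_nonneg_right hor (add_nonneg hx0 hy0), sq_nonneg (x - y)]
    have e4 := mul_le_mul_of_nonneg_left e3 hR0.le
    have e5 : R * (r / 2 * (x + y)) = c * ((1 + μ) * (x + y)) + r / 2 * (x + y) := by
      rw [← mul_assoc, e2]
      ring
    have e6 : 0 < r / 2 * (x + y) := by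
      have : 0 < x + y := hr0.trans_le hor
      positivity
    have e7 : R * (x ^ 2 + y ^ 2) ≤ D.gFun p A k ⟨μ, η, β⟩ x y := by
      have f1 := mul_le_mul_of_nonneg_right hxC (mul_nonneg hkC.le (sq_nonneg y))
      have f2 := mul_nonneg (mul_pos hkC hkp).le (sq_nonneg (x - y))
      have f3 := mul_le_mul_of_nonneg_right h3 (sq_nonneg y)
      have f4 := mul_le_mul_of_nonneg_right h4 (sq_nonneg x)
      simp only [gFun, φ]
      linarith
    have e8 : linCoeff n p k ⟨μ, η, β⟩ = c := rfl
    rw [pFun, e8]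
    simp only
    linarith

lemma exists_decayCoeff (hS : D.Standing p A k) {ϑ ε : ℝ} (hG : D.GainInequalities p A k G ϑ ε) :
    ∃ a₃ : ℝ, D.IsDecayCoeff p A k G a₃ := by
  have hl := lamMin_X_pos hS
  have hμ0 : 0 < G.μ := (μ₃_pos hS).trans_le hG.μ_ge
  have hη0 : 0 < G.η := one_pos.trans hG.η_gt
  set a := 1 / 2 * G.η * lamMin (D.X p A) with ha
  set c := D.φ p A k G - k.kC * D.XX p A k G with hc
  have ha0 : 0 < a := by positivity
  have hac : (-(k.kC * k.kp)) ^ 2 < a * c := by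
    have h := hG.φ_gt
    have h1 : (2 * k.kC * k.kp) ^ 2 / (2 * G.η * lamMin (D.X p A)) < c := by linarith
    rw [div_lt_iff₀ (by positivity)] at h1
    rw [ha]
    nlinarith
  refine ⟨G.μ⁻¹ * lamMin (scalarBlocks Unit a (-(k.kC * k.kp)) c),
    mul_pos (inv_pos.2 hμ0) (lamMin_pos (posDef_scalarBlocks ha0 hac)), fun x hx y hy => ?_⟩
  rw [mul_assoc]
  refine mul_le_mul_of_nonneg_left ?_ (inv_pos.2 hμ0).le
  refine (lamMin_scalarBlocks_le _ _ _ _ _).trans ?_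
  have h1 := mul_le_mul_of_nonneg_right hx.2 (mul_nonneg hS.valid.kC_pos.le (sq_nonneg y))
  rw [gFun, hc, ha]
  linarith

end Design

/-! ### Values of the Filippov map of the closed loop -/

lemma tendsto_clm_apply {α E F : Type*} [NormedAddCommGroup E] [NormedSpace ℝ E]
    [NormedAddCommGroup F] [NormedSpace ℝ F] {l : Filter α} {N : α → E →L[ℝ] F} {f : α → E}
    {T : E →L[ℝ] F} {x : E} (hN : Tendsto N l (𝓝 T)) (hf : Tendsto f l (𝓝 x)) :
    Tendsto (fun r => N r (f r)) l (𝓝 (T x)) :=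
  ((isBoundedBilinearMap_apply (𝕜 := ℝ) (E := E) (F := F)).continuous.tendsto (T, x)).comp
    (hN.prodMk_nhds hf)

section Filippov

variable {E : Type} [NormedAddCommGroup E] [NormedSpace ℝ E] [MeasureSpace E] {f : E → E} {x w : E}

/-- No null set has to be removed for this bound: the Filippov set lies in every closed half-space
that contains the values of `f` near `x` up to arbitrarily small errors. -/
lemma filippov_apply_le (hw : w ∈ filippov f x) (ψ : E →L[ℝ] ℝ) {c : ℝ}
    (h : ∀ ε > 0, ∀ᶠ s in 𝓝 x, ψ (f s) ≤ c + ε) : ψ w ≤ c := by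
  refine le_of_forall_pos_le_add fun ε hε => ?_
  obtain ⟨r, hr, hball⟩ := Metric.eventually_nhds_iff_ball.1 (h ε hε)
  simp only [filippov, mem_iInter] at hw
  have h1 := hw r hr ∅ measure_empty
  have hcl : IsClosed {v | ψ v ≤ c + ε} := isClosed_le ψ.continuous continuous_const
  have hcv : Convex ℝ {v | ψ v ≤ c + ε} :=
    convex_halfSpace_le (IsLinearMap.mk ψ.map_add ψ.map_smul) _
  refine closure_minimal (convexHull_min ?_ hcv) hcl h1
  rintro _ ⟨s, ⟨hs, -⟩, rfl⟩
  exact hball s hs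

lemma filippov_apply_eq (hw : w ∈ filippov f x) (ψ : E →L[ℝ] ℝ) {c : ℝ}
    (h : Tendsto (fun s => ψ (f s)) (𝓝 x) (𝓝 c)) : ψ w = c := by
  refine le_antisymm (filippov_apply_le hw ψ fun ε hε => ?_) ?_
  · exact (h.eventually_lt_const (lt_add_of_pos_right c hε)).mono fun _ => le_of_lt
  · have h1 := filippov_apply_le hw (-ψ) (c := -c) fun ε hε => by
      refine (h.eventually_const_lt (sub_lt_self c hε)).mono fun s hs => ?_
      rw [neg_apply]
      linarith
    simpa using h1

/-- `σ` is a selection of the set-valued signum at `y`: `1` for positive `y`, `-1` for negative `y`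
and anything in `[-1, 1]` for `y = 0`. -/
def IsSign (σ y : ℝ) : Prop := |σ| ≤ 1 ∧ σ * y = |y|

lemma IsSign.eq_one {σ y : ℝ} (h : IsSign σ y) (hy : 0 < y) : σ = 1 := by
  have := h.2
  rw [abs_of_pos hy] at this
  exact mul_right_cancel₀ hy.ne' (this.trans (one_mul y).symm)

lemma IsSign.neg {σ y : ℝ} (h : IsSign σ y) : IsSign (-σ) (-y) := by
  refine ⟨by rw [abs_neg]; exact h.1, by rw [neg_mul_neg, abs_neg]; exact h.2⟩

lemma abs_sign_le_one (y : ℝ) : |Real.sign y| ≤ 1 := by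
  rcases Real.sign_apply_eq y with h | h | h <;> simp [h]

/-- A functional whose value on the vector field jumps only through `-b * sign (u s)` takes on the
Filippov set the continuous value corrected by `-b σ`, with `σ` a selection of the signum. -/
lemma exists_isSign_of_mem_filippov (hw : w ∈ filippov f x) (ψ : E →L[ℝ] ℝ) {u : E → ℝ} {b c : ℝ}
    (hb : 0 < b) (hu : ContinuousAt u x)
    (h : Tendsto (fun s => ψ (f s) + b * Real.sign (u s)) (𝓝 x) (𝓝 c)) :
    ∃ σ, IsSign σ (u x) ∧ ψ w = c - b * σ := by
  have hup : ψ w ≤ c + b := filippov_apply_le hw ψ fun ε hε => by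
    refine (h.eventually_lt_const (lt_add_of_pos_right c hε)).mono fun s hs => ?_
    nlinarith [abs_le.1 (abs_sign_le_one (u s))]
  have hlo : (-ψ) w ≤ -c + b := filippov_apply_le hw (-ψ) fun ε hε => by
    refine (h.eventually_const_lt (sub_lt_self c hε)).mono fun s hs => ?_
    rw [neg_apply]
    nlinarith [abs_le.1 (abs_sign_le_one (u s))]
  rw [neg_apply] at hlo
  rcases lt_trichotomy (u x) 0 with hneg | hz | hpos
  · refine ⟨-1, ⟨by simp, by rw [abs_of_neg hneg]; ring⟩, ?_⟩
    have h1 : Tendsto (fun s => ψ (f s)) (𝓝 x) (𝓝 (c + b)) := by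
      refine (h.add_const b).congr' ?_
      filter_upwards [hu.eventually_lt_const hneg] with s hs
      rw [Real.sign_of_neg hs]
      ring
    rw [filippov_apply_eq hw ψ h1]
    ring
  · refine ⟨(c - ψ w) / b, ⟨?_, by rw [hz]; simp⟩, by field_simp; ring⟩
    rw [abs_div, abs_of_pos hb, div_le_one hb, abs_le]
    constructor <;> linarith
  · refine ⟨1, ⟨by simp, by rw [abs_of_pos hpos]; ring⟩, ?_⟩
    have h1 : Tendsto (fun s => ψ (f s)) (𝓝 x) (𝓝 (c - b)) := by
      refine (h.sub_const b).congr' ?_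
      filter_upwards [hu.eventually_const_lt hpos] with s hs
      rw [Real.sign_of_pos hs]
      ring
    rw [filippov_apply_eq hw ψ h1]
    ring

end Filippov

section ClosedLoop

variable {n p : ℕ}

lemma norm_le_sqrt_of_abs_le_one {x : Coord p} (h : ∀ k, |x k| ≤ 1) : ‖x‖ ≤ Real.sqrt p := by
  rw [EuclideanSpace.norm_eq]
  refine Real.sqrt_le_sqrt ((Finset.sum_le_sum fun k _ => ?_).trans_eq (b := ∑ _k : Fin p, (1 : ℝ))
    (by simp))
  rw [Real.norm_eq_abs, sq_le_one_iff₀ (abs_nonneg _)]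
  exact h k

lemma Agent.isInvertible_M {a : Agent p} {k : Bounds} (ha : a.Satisfies k)
    (q : Coord p) : (a.M q).IsInvertible := by
  have hinj : Function.Injective (a.M q : Coord p →ₗ[ℝ] Coord p) := by
    refine (injective_iff_map_eq_zero _).2 fun v hv => ?_
    by_contra hne
    have h1 := ha.posDef q v hne
    rw [show a.M q v = 0 from hv, inner_zero_right] at h1
    exact lt_irrefl _ h1
  refine ⟨(LinearEquiv.ofInjectiveEndo _ hinj).toContinuousLinearEquiv, ?_⟩
  ext v
  rfl

lemma Agent.continuous_inverse_M {a : Agent p} {k : Bounds} (ha : a.Satisfies k) :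
    Continuous fun q => (a.M q).inverse := by
  refine continuous_iff_continuousAt.2 fun q => ?_
  exact ((Agent.isInvertible_M ha q).contDiffAt_map_inverse (n := 0)).continuousAt.comp
    (f := a.M) ha.smooth_M.continuous.continuousAt

lemma continuous_withLeader (x₀ : Coord p) (j : Fin (n + 1)) :
    Continuous fun x : Stack n p => withLeader x₀ x j := by
  refine Fin.cases ?_ (fun j => ?_) j
  · exact continuous_const
  · exact continuous_apply j

lemma continuous_relSum (W : Matrix (Fin (n + 1)) (Fin (n + 1)) ℝ) (x₀ : Coord p) (i : Fin n) :
    Continuous fun x : Stack n p => relSum W x₀ x i :=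
  continuous_finsetSum _ fun j _ => by
    have h : Continuous fun x : Stack n p => x i - withLeader x₀ x j :=
      (continuous_apply i).sub (continuous_withLeader x₀ j)
    exact h.const_smul (W i.succ j)

/-- The continuous part of the force on an agent: control without the signum term, minus Coriolis,
gravity and disturbance forces. -/
noncomputable def smoothForce (A : Matrix (Fin (n + 1)) (Fin (n + 1)) ℝ) (G : Gains) (a : Agent p)
    (q₀ dq₀ : Coord p) (t : ℝ) (s : State n p) (i : Fin n) : Coord p :=
  -(G.η • (relSum A q₀ s.1 i + G.μ • relSum A dq₀ s.2.1 i))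
    - a.C (s.1 i) (s.2.1 i) (s.2.1 i) - a.g (s.1 i) - a.ζ t

lemma continuous_smoothForce (A : Matrix (Fin (n + 1)) (Fin (n + 1)) ℝ) (G : Gains) {a : Agent p}
    {k : Bounds} (ha : a.Satisfies k) (q₀ dq₀ : Coord p) (t : ℝ) (i : Fin n) :
    Continuous fun s : State n p => smoothForce A G a q₀ dq₀ t s i := by
  have h1 : Continuous fun s : State n p => s.1 i := by fun_prop
  have h2 : Continuous fun s : State n p => s.2.1 i := by fun_prop
  have h3 := (continuous_relSum A q₀ i).comp (continuous_fst (X := Stack n p)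
    (Y := Stack n p × Stack n p × Stack n p))
  have h4 := (continuous_relSum A dq₀ i).comp ((continuous_fst (X := Stack n p)
    (Y := Stack n p × Stack n p)).comp (continuous_snd (X := Stack n p)))
  have h5 : Continuous fun s : State n p => a.C (s.1 i) (s.2.1 i) :=
    ha.cont_C.comp (h1.prodMk h2)
  exact ((((h3.add (h4.const_smul G.μ)).const_smul G.η).neg.sub (h5.clm_apply h2)).sub
    (ha.cont_g.comp h1)).sub continuous_const

lemma controlLaw_sub_eq (A : Matrix (Fin (n + 1)) (Fin (n + 1)) ℝ) (G : Gains) (a : Agent p)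
    (q₀ dq₀ : Coord p) (t : ℝ) (s : State n p) (i : Fin n) :
    controlLaw A G q₀ dq₀ s i - a.C (s.1 i) (s.2.1 i) (s.2.1 i) - a.g (s.1 i) - a.ζ t
      = smoothForce A G a q₀ dq₀ t s i
        - G.β • sgnVec ((s.1 i - s.2.2.1 i) + G.μ • (s.2.1 i - s.2.2.2 i)) := by
  have h : ∑ j, A i.succ j •
        ((s.1 i - withLeader q₀ s.1 j) + G.μ • (s.2.1 i - withLeader dq₀ s.2.1 j))
      = relSum A q₀ s.1 i + G.μ • relSum A dq₀ s.2.1 i := by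
    rw [relSum, relSum, Finset.smul_sum, ← Finset.sum_add_distrib]
    exact Finset.sum_congr rfl fun j _ => by rw [smul_add, smul_comm]
  rw [controlLaw, smoothForce, h]
  abel

/-- `w` is obtained from the closed-loop vector field at the state `s` by replacing each coordinate
of each signum by a selection of the set-valued signum. -/
structure IsClosedLoopValue (A : Matrix (Fin (n + 1)) (Fin (n + 1)) ℝ)
    (B : ℝ → Matrix (Fin (n + 1)) (Fin (n + 1)) ℝ) (G : Gains) (ω₁ ω₂ : ℝ)
    (agents : Fin n → Agent p) (l : Leader p) (t : ℝ) (s w : State n p) : Prop where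
  position : w.1 = s.2.1
  velocity : ∀ i, ∃ σ : Coord p,
    (∀ c, IsSign (σ c) (((s.1 i - s.2.2.1 i) + G.μ • (s.2.1 i - s.2.2.2 i)) c)) ∧
    (agents i).M (s.1 i) (w.2.1 i)
      = smoothForce A G (agents i) (l.q t) (l.dq t) t s i - G.β • σ
  posEst : ∀ i c, ∃ σ, IsSign σ (relSum (B t) (l.q t) s.2.2.1 i c) ∧
    w.2.2.1 i c = s.2.2.2 i c - ω₁ * σ
  velEst : ∀ i c, ∃ σ, IsSign σ (relSum (B t) (l.dq t) s.2.2.2 i c) ∧ w.2.2.2 i c = -(ω₂ * σ)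

/-- Only this inclusion is needed, not equality. The acceleration `w` of an agent is controlled
through the functionals `w ↦ (M(q) w)_c` with `q` frozen at the state `s`: the error from `M(q)⁻¹`
at nearby states multiplies bounded signum terms, hence tends to `0`. -/
lemma isClosedLoopValue_of_mem_filippov (A : Matrix (Fin (n + 1)) (Fin (n + 1)) ℝ)
    (B : ℝ → Matrix (Fin (n + 1)) (Fin (n + 1)) ℝ) {G : Gains} {ω₁ ω₂ : ℝ}
    {agents : Fin n → Agent p} {k : Bounds} (l : Leader p) {t : ℝ} {s w : State n p}
    (hag : ∀ i, (agents i).Satisfies k) (hβ : 0 < G.β) (hω₁ : 0 < ω₁) (hω₂ : 0 < ω₂)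
    (hw : w ∈ filippov (closedLoop A B G ω₁ ω₂ agents l t) s) :
    IsClosedLoopValue A B G ω₁ ω₂ agents l t s w := by
  -- Coordinate functionals on the four components of the state space.
  let π₁ : State n p →L[ℝ] Stack n p := ContinuousLinearMap.fst ℝ _ _
  let π₂ : State n p →L[ℝ] Stack n p :=
    (ContinuousLinearMap.fst ℝ _ _).comp (ContinuousLinearMap.snd ℝ _ _)
  let π₃ : State n p →L[ℝ] Stack n p := (ContinuousLinearMap.fst ℝ _ _).comp
    ((ContinuousLinearMap.snd ℝ _ _).comp (ContinuousLinearMap.snd ℝ _ _))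
  let π₄ : State n p →L[ℝ] Stack n p := (ContinuousLinearMap.snd ℝ _ _).comp
    ((ContinuousLinearMap.snd ℝ _ _).comp (ContinuousLinearMap.snd ℝ _ _))
  let pr : Fin n → Stack n p →L[ℝ] Coord p := fun i => ContinuousLinearMap.proj i
  let co : Fin p → Coord p →L[ℝ] ℝ := fun c => EuclideanSpace.proj c
  refine ⟨?_, ?_, ?_, ?_⟩
  · funext i
    ext c
    refine filippov_apply_eq hw ((co c).comp ((pr i).comp π₁)) ?_
    exact (((co c).comp ((pr i).comp π₂)).continuous.tendsto s)
  · intro i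
    set N : State n p → Coord p →L[ℝ] Coord p :=
      fun r => ((agents i).M (s.1 i)).comp ((agents i).M (r.1 i)).inverse with hN
    have hNc : Tendsto N (𝓝 s) (𝓝 (ContinuousLinearMap.id ℝ _)) := by
      have h1 : ContinuousAt N s := by
        have h2 : Continuous fun r : State n p => ((agents i).M (r.1 i)).inverse :=
          (Agent.continuous_inverse_M (hag i)).comp (by fun_prop)
        exact (continuous_const.clm_comp h2).continuousAt
      have h3 : N s = ContinuousLinearMap.id ℝ _ :=
        (Agent.isInvertible_M (hag i) _).self_comp_inverse
      rw [← h3]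
      exact h1
    let F : State n p → Coord p := fun r => smoothForce A G (agents i) (l.q t) (l.dq t) t r i
    have hF : Tendsto F (𝓝 s) (𝓝 (F s)) := (continuous_smoothForce A G (hag i) _ _ t i).tendsto s
    let u : State n p → Coord p := fun r => (r.1 i - r.2.2.1 i) + G.μ • (r.2.1 i - r.2.2.2 i)
    have hu : Continuous u := by fun_prop
    have hsgn : Tendsto (fun r => (N r - ContinuousLinearMap.id ℝ (Coord p)) (G.β • sgnVec (u r)))
        (𝓝 s) (𝓝 0) := by
      have h1 : Tendsto (fun r => ‖N r - ContinuousLinearMap.id ℝ (Coord p)‖ * (G.β * Real.sqrt p))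
          (𝓝 s) (𝓝 0) := by
        simpa using (hNc.sub_const (ContinuousLinearMap.id ℝ (Coord p))).norm.mul_const
          (G.β * Real.sqrt p)
      refine squeeze_zero_norm (fun r => ?_) h1
      refine (ContinuousLinearMap.le_opNorm _ _).trans
        (mul_le_mul_of_nonneg_left ?_ (norm_nonneg _))
      rw [norm_smul, Real.norm_of_nonneg hβ.le]
      exact mul_le_mul_of_nonneg_left
        (norm_le_sqrt_of_abs_le_one fun c => abs_sign_le_one _) hβ.le
    have hvec : Tendsto (fun r => (agents i).M (s.1 i)
        ((closedLoop A B G ω₁ ω₂ agents l t r).2.1 i) + G.β • sgnVec (u r)) (𝓝 s) (𝓝 (F s)) := by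
      have h1 : Tendsto (fun r => N r (F r)) (𝓝 s) (𝓝 (F s)) := tendsto_clm_apply hNc hF
      have h2 := h1.sub hsgn
      rw [sub_zero] at h2
      refine h2.congr fun r => ?_
      have h3 : (closedLoop A B G ω₁ ω₂ agents l t r).2.1 i
          = ((agents i).M (r.1 i)).inverse (F r - G.β • sgnVec (u r)) :=
        congrArg _ (controlLaw_sub_eq A G (agents i) (l.q t) (l.dq t) t r i)
      rw [h3]
      simp only [hN, ContinuousLinearMap.comp_apply, sub_apply,
        ContinuousLinearMap.id_apply, map_sub]
      abel
    have key : ∀ c, ∃ σ, IsSign σ (u s c) ∧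
        (agents i).M (s.1 i) (w.2.1 i) c = F s c - G.β * σ := fun c =>
      exists_isSign_of_mem_filippov hw ((co c).comp (((agents i).M (s.1 i)).comp ((pr i).comp π₂)))
        (u := fun r => u r c) hβ ((co c).continuous.comp hu).continuousAt
        (((co c).continuous.tendsto _).comp hvec)
    choose σ hσ1 hσ2 using key
    refine ⟨WithLp.toLp 2 σ, hσ1, ?_⟩
    ext c
    exact hσ2 c
  · intro i c
    refine exists_isSign_of_mem_filippov hw ((co c).comp ((pr i).comp π₃))
      (u := fun r => relSum (B t) (l.q t) r.2.2.1 i c) hω₁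
      ((co c).continuous.comp ((continuous_relSum _ _ i).comp π₃.continuous)).continuousAt ?_
    refine (((co c).comp ((pr i).comp π₄)).continuous.tendsto s).congr fun r => ?_
    exact (sub_add_cancel (r.2.2.2 i c) _).symm
  · intro i c
    obtain ⟨σ, h1, h2⟩ := exists_isSign_of_mem_filippov (c := 0) hw ((co c).comp ((pr i).comp π₄))
      (u := fun r => relSum (B t) (l.dq t) r.2.2.2 i c) hω₂
      ((co c).continuous.comp ((continuous_relSum _ _ i).comp π₄.continuous)).continuousAt
      (tendsto_const_nhds.congr fun r =>
        (neg_add_cancel (ω₂ * Real.sign (relSum (B t) (l.dq t) r.2.2.2 i c))).symm)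
    exact ⟨σ, h1, h2.trans (zero_sub _)⟩

end ClosedLoop

/-! ### Solutions of the closed loop and the leader's trajectory -/

section Components

variable {n p : ℕ}

lemma absCont_clm_comp {E F : Type*} [NormedAddCommGroup E] [NormedSpace ℝ E]
    [NormedAddCommGroup F] [NormedSpace ℝ F] {f : ℝ → E} {a b : ℝ}
    (hf : AbsolutelyContinuousOnInterval f a b) (L : E →L[ℝ] F) :
    AbsolutelyContinuousOnInterval (fun t => L (f t)) a b :=
  absCont_lipschitz_comp hf L.lipschitz

/-- The position of the follower `i` as a function of the state. -/
def posCLM (i : Fin n) : State n p →L[ℝ] Coord p :=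
  (ContinuousLinearMap.proj i).comp (ContinuousLinearMap.fst ℝ (Stack n p) _)

/-- The velocity of the follower `i` as a function of the state. -/
def velCLM (i : Fin n) : State n p →L[ℝ] Coord p :=
  (ContinuousLinearMap.proj i).comp ((ContinuousLinearMap.fst ℝ (Stack n p) _).comp
    (ContinuousLinearMap.snd ℝ (Stack n p) _))

/-- The position estimate of the follower `i` as a function of the state. -/
def posEstCLM (i : Fin n) : State n p →L[ℝ] Coord p :=
  (ContinuousLinearMap.proj i).comp ((ContinuousLinearMap.fst ℝ (Stack n p) _).comp
    ((ContinuousLinearMap.snd ℝ (Stack n p) _).comp (ContinuousLinearMap.snd ℝ (Stack n p) _)))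

/-- The velocity estimate of the follower `i` as a function of the state. -/
def velEstCLM (i : Fin n) : State n p →L[ℝ] Coord p :=
  (ContinuousLinearMap.proj i).comp ((ContinuousLinearMap.snd ℝ (Stack n p) _).comp
    ((ContinuousLinearMap.snd ℝ (Stack n p) _).comp (ContinuousLinearMap.snd ℝ (Stack n p) _)))

lemma HasDerivAt.clm {E F : Type*} [NormedAddCommGroup E] [NormedSpace ℝ E]
    [NormedAddCommGroup F] [NormedSpace ℝ F] {f : ℝ → E} {f' : E} {t : ℝ} (hf : HasDerivAt f f' t)
    (L : E →L[ℝ] F) : HasDerivAt (fun t => L (f t)) (L f') t :=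
  L.hasFDerivAt.comp_hasDerivAt t hf

lemma norm_le_div_sqrt {x : Coord p} {r : ℝ} (hn : 0 < n)
    (h : stackNorm (fun _ : Fin n => x) ≤ r) : ‖x‖ ≤ r / Real.sqrt n := by
  rw [le_div_iff₀ (Real.sqrt_pos.2 (Nat.cast_pos.2 hn)), mul_comm, ← stackNorm_const]
  exact h

variable {l : Leader p} {k : Bounds}

lemma Leader.absCont_q (hl : l.Satisfies n k) (hn : 0 < n) {T : ℝ} (hT : 0 ≤ T) :
    AbsolutelyContinuousOnInterval l.q 0 T := by
  refine LipschitzOnWith.absolutelyContinuousOnInterval (K := (k.kp / Real.sqrt n).toNNReal) ?_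
  rw [uIcc_of_le hT]
  refine (convex_Icc 0 T).lipschitzOnWith_of_nnnorm_hasDerivWithin_le
    (fun t ht => (hl.deriv_q t ht.1).mono Icc_subset_Ici_self) fun t ht => ?_
  exact NNReal.le_toNNReal_of_coe_le (norm_le_div_sqrt hn (hl.bound_dq t ht.1))

lemma Leader.absCont_dq (hl : l.Satisfies n k) (hn : 0 < n) {T : ℝ} (hT : 0 ≤ T) :
    AbsolutelyContinuousOnInterval l.dq 0 T := by
  refine LipschitzOnWith.absolutelyContinuousOnInterval (K := (k.kq / Real.sqrt n).toNNReal) ?_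
  rw [uIcc_of_le hT]
  refine (convex_Icc 0 T).lipschitzOnWith_of_nnnorm_hasDerivWithin_le
    (fun t ht => (hl.deriv_dq t ht.1).mono Icc_subset_Ici_self) fun t ht => ?_
  exact NNReal.le_toNNReal_of_coe_le (norm_le_div_sqrt hn (hl.bound_ddq t ht.1))

lemma Leader.hasDerivAt_q (hl : l.Satisfies n k) {t : ℝ} (ht : 0 < t) :
    HasDerivAt l.q (l.dq t) t := (hl.deriv_q t ht.le).hasDerivAt (Ici_mem_nhds ht)

lemma Leader.hasDerivAt_dq (hl : l.Satisfies n k) {t : ℝ} (ht : 0 < t) :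
    HasDerivAt l.dq (l.ddq t) t := (hl.deriv_dq t ht.le).hasDerivAt (Ici_mem_nhds ht)

/-- A solution of the closed loop in the form used below: a locally absolutely continuous curve
whose derivative is almost everywhere a value of the closed-loop inclusion. -/
structure IsClosedLoopSolution (A : Matrix (Fin (n + 1)) (Fin (n + 1)) ℝ)
    (B : ℝ → Matrix (Fin (n + 1)) (Fin (n + 1)) ℝ) (G : Gains) (ω₁ ω₂ : ℝ)
    (agents : Fin n → Agent p) (l : Leader p) (τ : EReal) (z : ℝ → State n p) : Prop where
  abs_cont : ∀ T : ℝ, 0 ≤ T → (T : EReal) < τ → AbsolutelyContinuousOnInterval z 0 T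
  inclusion : ∀ᵐ t : ℝ, 0 < t → (t : EReal) < τ →
    ∃ w, IsClosedLoopValue A B G ω₁ ω₂ agents l t (z t) w ∧ HasDerivAt z w t

lemma IsFilippovSolution.isClosedLoopSolution {A : Matrix (Fin (n + 1)) (Fin (n + 1)) ℝ}
    {B : ℝ → Matrix (Fin (n + 1)) (Fin (n + 1)) ℝ} {G : Gains} {ω₁ ω₂ : ℝ}
    {agents : Fin n → Agent p} {τ : EReal} {z : ℝ → State n p}
    (hz : IsFilippovSolution (closedLoop A B G ω₁ ω₂ agents l) τ z)
    (hag : ∀ i, (agents i).Satisfies k) (hβ : 0 < G.β) (hω₁ : 0 < ω₁) (hω₂ : 0 < ω₂) :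
    IsClosedLoopSolution A B G ω₁ ω₂ agents l τ z := by
  refine ⟨hz.abs_cont, ?_⟩
  filter_upwards [hz.inclusion] with t h h0 hτ
  obtain ⟨w, hw, hd⟩ := h h0 hτ
  exact ⟨w, isClosedLoopValue_of_mem_filippov A B l hag hβ hω₁ hω₂ hw, hd⟩

end Components

/-! ### Finite-time convergence of the observer -/

section Observer

variable {n p : ℕ}

lemma relSum_apply (W : Matrix (Fin (n + 1)) (Fin (n + 1)) ℝ) (x₀ : Coord p) (x : Stack n p)
    (i : Fin n) (c : Fin p) :
    relSum W x₀ x i c = ∑ j, W i.succ j * (x i c - withLeader x₀ x j c) := by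
  simp [relSum]

/-- Vector form of finite-time consensus: followers driven by `-ω σ`, with `σ` a selection of the
signum of the weighted sum of differences, reach the leader despite a relative drift bounded by
`ρ < ω`. -/
lemma eq_leader_of_sign_consensus {B : ℝ → Matrix (Fin (n + 1)) (Fin (n + 1)) ℝ}
    {x : ℝ → Stack n p} {y : ℝ → Coord p} {a b ω ρ K : ℝ} (hab : a ≤ b)
    (hx : ∀ i, AbsolutelyContinuousOnInterval (fun t => x t i) a b)
    (hy : AbsolutelyContinuousOnInterval y a b)
    (hB : ∀ t ∈ Ioo a b, IsAdjacency (B t) ∧ HasSpanningTree (B t)) (hρ : ρ < ω)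
    (hd : ∀ᵐ t, t ∈ Ioo a b → ∀ i c, ∃ σ e, IsSign σ (relSum (B t) (y t) (x t) i c) ∧
      HasDerivAt (fun t => x t i c - y t c) e t ∧ |e + ω * σ| ≤ ρ)
    (hK : ∀ i c, |x a i c - y a c| ≤ K) (hK0 : 0 ≤ K) (hKb : K ≤ (ω - ρ) * (b - a)) :
    ∀ i, x b i = y b := by
  have key : ∀ s : ℝ, (s = 1 ∨ s = -1) → ∀ c (i : Fin n), s * (x b i c - y b c) ≤ 0 := by
    intro s hs c i
    have habs : |s| = 1 := by rcases hs with rfl | rfl <;> simp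
    have hAC : ∀ i, AbsolutelyContinuousOnInterval (fun t => x t i c - y t c) a b := fun i =>
      (absCont_clm_comp (hx i) (EuclideanSpace.proj c)).fun_sub
        (absCont_clm_comp hy (EuclideanSpace.proj (𝕜 := ℝ) c))
    have hsucc : ∀ (t : ℝ) (j : Fin n),
        s * (withLeader (y t) (x t) j.succ c - y t c) = s * (x t j c - y t c) := fun t j => rfl
    have h := nonpos_of_max_decreasing (B := B) (c := ω - ρ) (K := K)
      (d := fun j t => s * (withLeader (y t) (x t) j c - y t c)) hab ?_ ?_ (sub_pos.2 hρ) hB ?_ ?_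
      hKb i.succ
    · exact h
    · intro j
      refine Fin.cases ?_ (fun j => ?_) j
      · refine LipschitzOnWith.absolutelyContinuousOnInterval (K := 0)
          (LipschitzOnWith.of_dist_le_mul fun r _ t _ => ?_)
        simp [withLeader]
      · exact (hAC j).const_mul s
    · intro t _
      simp [withLeader]
    · filter_upwards [hd] with t ht htI j hsum
      obtain ⟨σ, e, hσ, he, hb⟩ := ht htI j c
      simp only [hsucc] at hsum ⊢
      rw [(he.const_mul s).deriv]
      have h1 : ∑ m, B t j.succ m * (s * (x t j c - y t c)
          - s * (withLeader (y t) (x t) m c - y t c)) = s * relSum (B t) (y t) (x t) j c := by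
        rw [relSum_apply, Finset.mul_sum]
        exact Finset.sum_congr rfl fun m _ => by ring
      rw [h1] at hsum
      have h2 := abs_le.1 hb
      rcases hs with rfl | rfl
      · rw [hσ.eq_one (by linarith)] at h2
        linarith
      · have h3 : -σ = 1 := hσ.neg.eq_one (by linarith)
        rw [show σ = -1 by linarith] at h2
        linarith
    · intro j
      refine Fin.cases ?_ (fun j => ?_) j
      · simpa [withLeader] using hK0
      · refine (le_abs_self _).trans ?_
        rw [hsucc, abs_mul, habs, one_mul]
        exact hK j c
  intro i
  ext c
  have h1 := key 1 (Or.inl rfl) c i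
  have h2 := key (-1) (Or.inr rfl) c i
  linarith

variable {A : Matrix (Fin (n + 1)) (Fin (n + 1)) ℝ}
  {B : ℝ → Matrix (Fin (n + 1)) (Fin (n + 1)) ℝ} {G : Gains} {ω₁ ω₂ : ℝ}
  {agents : Fin n → Agent p} {l : Leader p} {k : Bounds} {τ : EReal} {z : ℝ → State n p}

/-- The velocity estimates become exact in finite time because `ω₂` exceeds the leader's
acceleration; from then on the position estimates obey a driftless consensus protocol. -/
lemma exists_observerExact (hn : 0 < n)
    (hz : IsClosedLoopSolution A B G ω₁ ω₂ agents l τ z) (hl : l.Satisfies n k)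
    (hB : ∀ t, 0 ≤ t → IsAdjacency (B t) ∧ HasSpanningTree (B t)) (hω₁ : 0 < ω₁)
    (hω₂ : k.kq / Real.sqrt n < ω₂) : ∃ T₁ : ℝ, 0 ≤ T₁ ∧ ObserverExact l τ z T₁ := by
  have hτ : ∀ {s t : ℝ}, s ≤ t → (t : EReal) < τ → (s : EReal) < τ := fun hst ht =>
    (EReal.coe_le_coe_iff.2 hst).trans_lt ht
  have hsum : ∀ (f : Fin n → Fin p → ℝ) i c, |f i c| ≤ ∑ i, ∑ c, |f i c| := fun f i c =>
    (Finset.single_le_sum (f := fun c => |f i c|) (fun _ _ => abs_nonneg _)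
      (Finset.mem_univ c)).trans
      (Finset.single_le_sum (f := fun i => ∑ c, |f i c|)
        (fun _ _ => Finset.sum_nonneg fun _ _ => abs_nonneg _) (Finset.mem_univ i))
  have hsum0 : ∀ f : Fin n → Fin p → ℝ, 0 ≤ ∑ i, ∑ c, |f i c| := fun f =>
    Finset.sum_nonneg fun _ _ => Finset.sum_nonneg fun _ _ => abs_nonneg _
  set K := ∑ i, ∑ c, |(z 0).2.2.2 i c - l.dq 0 c| with hK
  have hω : 0 < ω₂ - k.kq / Real.sqrt n := sub_pos.2 hω₂
  set T := K / (ω₂ - k.kq / Real.sqrt n) with hT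
  have hT0 : 0 ≤ T := div_nonneg (hsum0 _) hω.le
  have hvel : ∀ t : ℝ, T ≤ t → (t : EReal) < τ → ∀ i, (z t).2.2.2 i = l.dq t := by
    intro t hTt ht
    have ht0 := hT0.trans hTt
    refine eq_leader_of_sign_consensus (x := fun t => (z t).2.2.2) ht0
      (fun i => absCont_clm_comp (hz.abs_cont t ht0 ht) (velEstCLM i))
      (Leader.absCont_dq hl hn ht0) (fun s hs => hB s hs.1.le) hω₂ ?_
      (hsum fun i c => (z 0).2.2.2 i c - l.dq 0 c) (hsum0 _) ?_
    · filter_upwards [hz.inclusion] with s hs hsI i c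
      obtain ⟨w, hw, hd⟩ := hs hsI.1 (hτ hsI.2.le ht)
      obtain ⟨σ, hσ, hwσ⟩ := hw.velEst i c
      refine ⟨σ, _, hσ, (HasDerivAt.clm hd ((EuclideanSpace.proj c).comp (velEstCLM i))).fun_sub
        (HasDerivAt.clm (Leader.hasDerivAt_dq hl hsI.1) (EuclideanSpace.proj (𝕜 := ℝ) c)), ?_⟩
      change |w.2.2.2 i c - l.ddq s c + ω₂ * σ| ≤ _
      rw [hwσ, show -(ω₂ * σ) - l.ddq s c + ω₂ * σ = -(l.ddq s c) by ring, abs_neg]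
      exact (PiLp.norm_apply_le (l.ddq s) c).trans
        (norm_le_div_sqrt hn (hl.bound_ddq s hsI.1.le))
    · rw [sub_zero, ← div_le_iff₀' hω]
      exact hTt
  set K' := ∑ i, ∑ c, |(z T).2.2.1 i c - l.q T c| with hK'
  have hK'0 : 0 ≤ K' := hsum0 _
  refine ⟨T + K' / ω₁, by positivity, fun t hTt ht i => ?_⟩
  have hTt' : T ≤ t := le_trans (le_add_of_nonneg_right (by positivity)) hTt
  have ht0 := hT0.trans hTt'
  refine ⟨?_, hvel t hTt' ht i⟩
  refine eq_leader_of_sign_consensus (B := B) (x := fun t => (z t).2.2.1) (ω := ω₁) (ρ := 0) hTt'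
    (fun i => absCont_clm_comp (absCont_mono_Icc (hz.abs_cont t ht0 ht) hT0 hTt' le_rfl)
      (posEstCLM i))
    (absCont_mono_Icc (Leader.absCont_q hl hn ht0) hT0 hTt' le_rfl)
    (fun s hs => hB s (hT0.trans hs.1.le)) hω₁ ?_
    (hsum fun i c => (z T).2.2.1 i c - l.q T c) hK'0 ?_ i
  · filter_upwards [hz.inclusion] with s hs hsI i c
    have hs0 : 0 < s := hT0.trans_lt hsI.1
    have hsτ := hτ hsI.2.le ht
    obtain ⟨w, hw, hd⟩ := hs hs0 hsτ
    obtain ⟨σ, hσ, hwσ⟩ := hw.posEst i c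
    refine ⟨σ, _, hσ, (HasDerivAt.clm hd ((EuclideanSpace.proj c).comp (posEstCLM i))).fun_sub
      (HasDerivAt.clm (Leader.hasDerivAt_q hl hs0) (EuclideanSpace.proj (𝕜 := ℝ) c)), ?_⟩
    change |w.2.2.1 i c - l.dq s c + ω₁ * σ| ≤ _
    rw [hwσ, hvel s hsI.1.le hsτ i]
    simp
  · rw [sub_zero, ← div_le_iff₀' hω₁]
    linarith

end Observer

/-! ### The Lyapunov function and its bounds -/

section Agents

variable {p : ℕ} {a : Agent p} {k : Bounds}

lemma Agent.inner_M_comm (ha : a.Satisfies k) (q x y : Coord p) :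
    inner ℝ x (a.M q y) = inner ℝ y (a.M q x) := by
  rw [← ContinuousLinearMap.adjoint_inner_left, ha.symm, real_inner_comm]

/-- The Cauchy–Schwarz inequality for the inertia matrix with the bound `M ≤ k_M`. -/
lemma Agent.inner_M_le (ha : a.Satisfies k) (q x y : Coord p) :
    inner ℝ x (a.M q y) ≤ k.kM * (‖x‖ * ‖y‖) := by
  have key : ∀ x y, 2 * inner ℝ x (a.M q y) ≤ k.kM * (‖x‖ ^ 2 + ‖y‖ ^ 2) := by
    intro x y
    have h1 : 0 ≤ inner ℝ (x - y) (a.M q (x - y)) := by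
      by_cases h : x - y = 0
      · simp [h]
      · exact (ha.posDef q _ h).le
    rw [map_sub, inner_sub_left, inner_sub_right, inner_sub_right,
      Agent.inner_M_comm ha q y x] at h1
    linarith [ha.upper q x, ha.upper q y]
  rcases (mul_nonneg (norm_nonneg x) (norm_nonneg y)).eq_or_lt with h | h
  · rcases mul_eq_zero.1 h.symm with hx | hy
    · simp [norm_eq_zero.1 hx]
    · simp [norm_eq_zero.1 hy]
  · have h1 := key (‖y‖ • x) (‖x‖ • y)
    rw [map_smul, inner_smul_left, inner_smul_right, norm_smul, norm_smul, norm_norm, norm_norm,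
      conj_trivial] at h1
    refine le_of_mul_le_mul_left ?_ h
    linarith

end Agents

section Lyapunov

variable {n p : ℕ}

lemma stackForm_add_smul {P : Matrix (Fin n) (Fin n) ℝ} (hP : Pᵀ = P) (x y : Stack n p) (c : ℝ) :
    stackForm P (fun i => x i + c • y i) (fun i => x i + c • y i)
      = stackForm P x x + 2 * c * stackForm P x y + c ^ 2 * stackForm P y y := by
  have hsymm : stackForm P y x = stackForm P x y := by
    rw [stackForm, Finset.sum_comm]
    refine Finset.sum_congr rfl fun i _ => Finset.sum_congr rfl fun j _ => ?_
    rw [real_inner_comm, ← Matrix.transpose_apply P, hP]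
  have h : stackForm P (fun i => x i + c • y i) (fun i => x i + c • y i)
      = stackForm P x x + c * stackForm P x y + c * stackForm P y x + c ^ 2 * stackForm P y y := by
    simp only [stackForm, Finset.mul_sum, ← Finset.sum_add_distrib]
    refine Finset.sum_congr rfl fun i _ => Finset.sum_congr rfl fun j _ => ?_
    simp only [inner_add_left, inner_add_right, inner_smul_left, inner_smul_right, conj_trivial]
    ring
  rw [h, hsymm]
  ring

/-- The Lyapunov function
`η/2 eᵀ X e + 1/2 vᵀ Γ M(q) v + μ⁻¹ eᵀ Γ M(q) v` of the position error `e` and velocity error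
`v`. -/
noncomputable def lyapunov (D : Design n) (A : Matrix (Fin (n + 1)) (Fin (n + 1)) ℝ) (G : Gains)
    (agents : Fin n → Agent p) (q e v : Stack n p) : ℝ :=
  1 / 2 * G.η * stackForm (D.symPart A) e e
    + ∑ i, D.γ i * (1 / 2 * inner ℝ (v i) ((agents i).M (q i) (v i))
      + G.μ⁻¹ * inner ℝ (e i) ((agents i).M (q i) (v i)))

variable {D : Design n} {A : Matrix (Fin (n + 1)) (Fin (n + 1)) ℝ} {k : Bounds} {G : Gains}
  {agents : Fin n → Agent p} {ϑ ε : ℝ}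

lemma lyapunov_le (hS : D.Standing p A k) (hG : D.GainInequalities p A k G ϑ ε)
    (hag : ∀ i, (agents i).Satisfies k) (q e v : Stack n p) :
    lyapunov D A G agents q e v ≤ 1 / 2 * G.η * lamMax (D.X p A) * stackNorm e ^ 2
      + 1 / 2 * k.kM * stackNorm v ^ 2 + G.μ⁻¹ * k.kM * (stackNorm e * stackNorm v) := by
  have hη : 0 < G.η := one_pos.trans hG.η_gt
  have hμ : 0 < G.μ⁻¹ := inv_pos.2 ((Design.μ₃_pos hS).trans_le hG.μ_ge)
  have hkM : 0 < k.kM := hS.valid.km_pos.trans_le hS.valid.km_le_kM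
  have h1 := mul_le_mul_of_nonneg_left (Design.le_lamMax_X_mul hS.adm.posDef e) hη.le
  have h2 : ∑ i, D.γ i * (1 / 2 * inner ℝ (v i) ((agents i).M (q i) (v i))
      + G.μ⁻¹ * inner ℝ (e i) ((agents i).M (q i) (v i)))
      ≤ ∑ i, (1 / 2 * k.kM * ‖v i‖ ^ 2 + G.μ⁻¹ * k.kM * (‖e i‖ * ‖v i‖)) := by
    refine Finset.sum_le_sum fun i _ => ?_
    have h3 := (hag i).upper (q i) (v i)
    have h4 := mul_le_mul_of_nonneg_left (Agent.inner_M_le (hag i) (q i) (e i) (v i)) hμ.le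
    refine (mul_le_mul_of_nonneg_left (b := 1 / 2 * inner ℝ (v i) ((agents i).M (q i) (v i))
      + G.μ⁻¹ * inner ℝ (e i) ((agents i).M (q i) (v i)))
      (c := 1 / 2 * k.kM * ‖v i‖ ^ 2 + G.μ⁻¹ * k.kM * (‖e i‖ * ‖v i‖)) (by linarith)
      (hS.adm.γ_pos i).le).trans (mul_le_of_le_one_left (by positivity) (hS.adm.γ_le_one i))
  rw [Finset.sum_add_distrib, ← Finset.mul_sum, ← Finset.mul_sum, ← stackNorm_sq] at h2
  have h3 := mul_le_mul_of_nonneg_left (sum_norm_mul_norm_le e v)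
    (show 0 ≤ G.μ⁻¹ * k.kM by positivity)
  rw [lyapunov]
  linarith

lemma le_lyapunov (hS : D.Standing p A k) (hG : D.GainInequalities p A k G ϑ ε)
    (hag : ∀ i, (agents i).Satisfies k) (q e v : Stack n p) :
    1 / 4 * G.η * lamMin (D.X p A) * stackNorm e ^ 2
      - G.μ⁻¹ * (D.γmin * (k.km - D.δ)) * (stackNorm e * stackNorm v)
      + 1 / 2 * (D.γmin * (k.km - D.δ)) * stackNorm v ^ 2 ≤ lyapunov D A G agents q e v := by
  have hη : 1 < G.η := hG.η_gt
  have hμ0 : 0 < G.μ := (Design.μ₃_pos hS).trans_le hG.μ_ge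
  have hμ : 0 < G.μ⁻¹ := inv_pos.2 hμ0
  have hl := Design.lamMin_X_pos hS
  have hκ := Design.kappa_pos hS
  have hkM : 0 < k.kM := hS.valid.km_pos.trans_le hS.valid.km_le_kM
  set κ := D.γmin * (k.km - D.δ) with hκd
  have hκkm : ∀ i, κ ≤ D.γ i * k.km := fun i => by
    have h1 := Design.γmin_le (D := D) i
    have h2 := Design.γmin_pos hS.n_pos hS.adm.γ_pos
    have h3 := hS.adm.δ_pos
    rw [hκd]
    nlinarith [hS.valid.km_pos, mul_pos h2 h3]
  have h1 := mul_le_mul_of_nonneg_left (Design.lamMin_X_mul_le hS.adm.posDef e)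
    (zero_le_one.trans hη.le)
  -- Complete the square in the velocity error: `w = v + μ⁻¹ e`.
  have h2 : ∑ i, (1 / 2 * κ * ‖v i‖ ^ 2 - G.μ⁻¹ * κ * (‖e i‖ * ‖v i‖)
      - 1 / 2 * G.μ⁻¹ ^ 2 * k.kM * ‖e i‖ ^ 2)
      ≤ ∑ i, D.γ i * (1 / 2 * inner ℝ (v i) ((agents i).M (q i) (v i))
      + G.μ⁻¹ * inner ℝ (e i) ((agents i).M (q i) (v i))) := by
    refine Finset.sum_le_sum fun i _ => ?_
    have hγ := hS.adm.γ_pos i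
    have h3 : D.γ i * (1 / 2 * inner ℝ (v i) ((agents i).M (q i) (v i))
        + G.μ⁻¹ * inner ℝ (e i) ((agents i).M (q i) (v i)))
        = 1 / 2 * (D.γ i *
          inner ℝ (v i + G.μ⁻¹ • e i) ((agents i).M (q i) (v i + G.μ⁻¹ • e i)))
          - 1 / 2 * G.μ⁻¹ ^ 2 * (D.γ i * inner ℝ (e i) ((agents i).M (q i) (e i))) := by
      simp only [map_add, map_smul, inner_add_left, inner_add_right, inner_smul_left,
        inner_smul_right, conj_trivial]
      rw [Agent.inner_M_comm (hag i) (q i) (v i) (e i)]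
      ring
    have h4 : κ * ‖v i + G.μ⁻¹ • e i‖ ^ 2 ≤ D.γ i *
        inner ℝ (v i + G.μ⁻¹ • e i) ((agents i).M (q i) (v i + G.μ⁻¹ • e i)) := by
      refine (mul_le_mul_of_nonneg_right (hκkm i) (sq_nonneg _)).trans ?_
      rw [mul_assoc]
      exact mul_le_mul_of_nonneg_left ((hag i).lower _ _) hγ.le
    have h5 : D.γ i * inner ℝ (e i) ((agents i).M (q i) (e i)) ≤ k.kM * ‖e i‖ ^ 2 :=
      (mul_le_mul_of_nonneg_left ((hag i).upper _ _) hγ.le).trans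
        (mul_le_of_le_one_left (by positivity) (hS.adm.γ_le_one i))
    have h6 : ‖v i‖ ^ 2 - 2 * G.μ⁻¹ * (‖e i‖ * ‖v i‖) ≤ ‖v i + G.μ⁻¹ • e i‖ ^ 2 := by
      rw [norm_add_sq_real, inner_smul_right]
      have h7 := neg_le_of_abs_le (abs_real_inner_le_norm (v i) (e i))
      nlinarith [mul_le_mul_of_nonneg_left h7 hμ.le, sq_nonneg ‖G.μ⁻¹ • e i‖]
    rw [h3]
    have h8 := mul_le_mul_of_nonneg_left h6 hκ.le
    have h9 := mul_le_mul_of_nonneg_left h5 (show 0 ≤ 1 / 2 * G.μ⁻¹ ^ 2 by positivity)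
    linarith
  rw [Finset.sum_sub_distrib, Finset.sum_sub_distrib, ← Finset.mul_sum, ← Finset.mul_sum,
    ← Finset.mul_sum, ← stackNorm_sq, ← stackNorm_sq] at h2
  have h3 := mul_le_mul_of_nonneg_left (sum_norm_mul_norm_le e v)
    (show 0 ≤ G.μ⁻¹ * κ by positivity)
  -- The lower bound on `μ` makes the negative term at most half of the `X`-term.
  have h4 : G.μ⁻¹ ^ 2 * k.kM ≤ 1 / 2 * lamMin (D.X p A) := by
    have h5 := (Real.sqrt_lt' hμ0).1 hG.μ_gt
    rw [div_lt_iff₀ hl] at h5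
    have h6 : G.μ⁻¹ ^ 2 * k.kM = k.kM / G.μ ^ 2 := by field_simp
    rw [h6, div_le_iff₀ (by positivity)]
    linarith
  have h5 := mul_le_mul_of_nonneg_right h4 (sq_nonneg (stackNorm e))
  have h6 : lamMin (D.X p A) * stackNorm e ^ 2 ≤ G.η * (lamMin (D.X p A) * stackNorm e ^ 2) :=
    le_mul_of_one_le_left (by positivity) hη.le
  rw [lyapunov]
  linarith

lemma lyapunov_le_Vbound (hS : D.Standing p A k) (hG : D.GainInequalities p A k G ϑ ε)
    (hag : ∀ i, (agents i).Satisfies k) (q e v : Stack n p) :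
    lyapunov D A G agents q e v ≤ D.Vbound p A k G (stackNorm e) (stackNorm v) := by
  refine (lyapunov_le hS hG hag q e v).trans ?_
  have hη : 0 < G.η := one_pos.trans hG.η_gt
  have hμ₃ := Design.μ₃_pos hS
  have hμ : G.μ⁻¹ ≤ D.μ₃⁻¹ := inv_anti₀ hμ₃ hG.μ_ge
  have hμ0 : 0 < G.μ⁻¹ := inv_pos.2 (hμ₃.trans_le hG.μ_ge)
  have hkM : 0 < k.kM := hS.valid.km_pos.trans_le hS.valid.km_le_kM
  have hL := (Design.lamMin_X_pos hS).trans_le (Design.lamMin_X_le_lamMax_X hS)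
  have hδ := hS.adm.δ_pos
  have hx := stackNorm_nonneg e
  have hy := stackNorm_nonneg v
  have h1 : G.μ⁻¹ * k.kM * (stackNorm e * stackNorm v)
      ≤ D.μ₃⁻¹ * (k.kM + D.δ) * (stackNorm e * stackNorm v) := by
    gcongr
    linarith
  have h2 : 0 ≤ G.η * lamMax (D.X p A) * stackNorm e ^ 2 := by positivity
  have h3 : 0 ≤ D.δ * stackNorm v ^ 2 := by positivity
  rw [Design.Vbound]
  linarith

lemma lamMax_Lmat_pos (hS : D.Standing p A k) : 0 < lamMax (D.Lmat p A k G) := by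
  have : Nonempty (Fin n × Fin p) := ⟨(⟨0, hS.n_pos⟩, ⟨0, hS.p_pos⟩)⟩
  have h := le_lamMax_scalarBlocks (ι := Fin n × Fin p) (G.η * lamMax (D.X p A))
    (1 / 2 * G.μ⁻¹ * (k.kM + D.δ)) (1 / 2 * (k.kM + D.δ)) 0 1
  have h1 := Design.kM_add_δ_pos hS
  change _ ≤ lamMax (D.Lmat p A k G) * _ at h
  linarith

lemma lyapunov_le_lamMax (hS : D.Standing p A k) (hG : D.GainInequalities p A k G ϑ ε)
    (hag : ∀ i, (agents i).Satisfies k) (q e v : Stack n p) :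
    lyapunov D A G agents q e v
      ≤ lamMax (D.Lmat p A k G) * (stackNorm e ^ 2 + stackNorm v ^ 2) := by
  refine (lyapunov_le hS hG hag q e v).trans ?_
  have : Nonempty (Fin n × Fin p) := ⟨(⟨0, hS.n_pos⟩, ⟨0, hS.p_pos⟩)⟩
  refine le_trans ?_ (le_lamMax_scalarBlocks (ι := Fin n × Fin p) (G.η * lamMax (D.X p A))
    (1 / 2 * G.μ⁻¹ * (k.kM + D.δ)) (1 / 2 * (k.kM + D.δ)) (stackNorm e) (stackNorm v))
  have hη : 0 < G.η := one_pos.trans hG.η_gt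
  have hμ0 : 0 < G.μ⁻¹ := inv_pos.2 ((Design.μ₃_pos hS).trans_le hG.μ_ge)
  have hL := (Design.lamMin_X_pos hS).trans_le (Design.lamMin_X_le_lamMax_X hS)
  have hδ := hS.adm.δ_pos
  have hx := stackNorm_nonneg e
  have hy := stackNorm_nonneg v
  have h2 : 0 ≤ G.η * lamMax (D.X p A) * stackNorm e ^ 2 := by positivity
  have h3 : 0 ≤ D.δ * stackNorm v ^ 2 := by positivity
  have h4 : 0 ≤ G.μ⁻¹ * D.δ * (stackNorm e * stackNorm v) := by positivity
  linarith

lemma inv_sq_le (hS : D.Standing p A k) (hG : D.GainInequalities p A k G ϑ ε) :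
    G.μ⁻¹ ^ 2 ≤ D.μ₃⁻¹ ^ 2 := by
  have hμ₃ := Design.μ₃_pos hS
  exact pow_le_pow_left₀ (inv_pos.2 (hμ₃.trans_le hG.μ_ge)).le (inv_anti₀ hμ₃ hG.μ_ge) 2

lemma ρ₂_mul_sq_le_lyapunov (hS : D.Standing p A k) (hG : D.GainInequalities p A k G ϑ ε)
    (hag : ∀ i, (agents i).Satisfies k) (q e v : Stack n p) :
    D.ρ₂ p A k G * stackNorm e ^ 2 ≤ lyapunov D A G agents q e v := by
  refine le_trans ?_ (le_lyapunov hS hG hag q e v)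
  have hκ := Design.kappa_pos hS
  have h1 := mul_le_mul_of_nonneg_right (inv_sq_le hS hG)
    (mul_nonneg hκ.le (sq_nonneg (stackNorm e)))
  have h2 := mul_nonneg hκ.le (sq_nonneg (stackNorm v - G.μ⁻¹ * stackNorm e))
  rw [Design.ρ₂]
  linarith

lemma σ₂_mul_sq_le_lyapunov (hS : D.Standing p A k) (hG : D.GainInequalities p A k G ϑ ε)
    (hag : ∀ i, (agents i).Satisfies k) (q e v : Stack n p) :
    D.σ₂ p A k G * stackNorm v ^ 2 ≤ lyapunov D A G agents q e v := by
  refine le_trans ?_ (le_lyapunov hS hG hag q e v)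
  have hη : 0 < G.η := one_pos.trans hG.η_gt
  have hl := Design.lamMin_X_pos hS
  set b := D.γmin * (k.km - D.δ) with hb
  set a := 1 / 4 * G.η * lamMin (D.X p A) with ha
  have ha0 : 0 < a := by positivity
  have h1 : 1 / 4 * (G.μ⁻¹ ^ 2 * b ^ 2) / a ≤ (1 / 2 * D.μ₃⁻¹ * D.γmin * (k.km - D.δ)) ^ 2 / a := by
    refine div_le_div_of_nonneg_right ?_ ha0.le
    have := mul_le_mul_of_nonneg_right (inv_sq_le hS hG) (sq_nonneg b)
    rw [show 1 / 2 * D.μ₃⁻¹ * D.γmin * (k.km - D.δ) = 1 / 2 * D.μ₃⁻¹ * b by rw [hb]; ring]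
    linarith
  have h2 := mul_le_mul_of_nonneg_right h1 (sq_nonneg (stackNorm v))
  have h3 : 0 ≤ (a * stackNorm e - 1 / 2 * G.μ⁻¹ * b * stackNorm v) ^ 2 / a :=
    div_nonneg (sq_nonneg _) ha0.le
  have h4 : (a * stackNorm e - 1 / 2 * G.μ⁻¹ * b * stackNorm v) ^ 2 / a
      = a * stackNorm e ^ 2 - G.μ⁻¹ * b * (stackNorm e * stackNorm v)
        + 1 / 4 * (G.μ⁻¹ ^ 2 * b ^ 2) / a * stackNorm v ^ 2 := by
    field_simp
    ring
  rw [Design.σ₂, ← ha]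
  linarith

lemma lamMin_Nmat_pos (hS : D.Standing p A k) (hG : D.GainInequalities p A k G ϑ ε) :
    0 < lamMin (D.Nmat p A k G) := by
  have : Nonempty (Fin n × Fin p) := ⟨(⟨0, hS.n_pos⟩, ⟨0, hS.p_pos⟩)⟩
  have hη : 1 < G.η := hG.η_gt
  have hl := Design.lamMin_X_pos hS
  have hκ := Design.kappa_pos hS
  rw [Design.Nmat_eq_scalarBlocks]
  refine lamMin_pos (posDef_scalarBlocks (by positivity) ?_)
  have h1 := mul_le_mul_of_nonneg_right (inv_sq_le hS hG) hκ.le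
  have h2 := Design.kappa_mul_inv_sq_lt hS
  have h3 : lamMin (D.X p A) < G.η * lamMin (D.X p A) := lt_mul_of_one_lt_left hl hη
  nlinarith [mul_pos hκ (show 0 < G.η * lamMin (D.X p A)
    - 2 * (G.μ⁻¹ ^ 2 * (D.γmin * (k.km - D.δ))) by linarith)]

lemma lamMin_mul_le_lyapunov (hS : D.Standing p A k) (hG : D.GainInequalities p A k G ϑ ε)
    (hag : ∀ i, (agents i).Satisfies k) (q e v : Stack n p) :
    lamMin (D.Nmat p A k G) * (stackNorm e ^ 2 + stackNorm v ^ 2)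
      ≤ lyapunov D A G agents q e v := by
  refine le_trans ?_ (le_lyapunov hS hG hag q e v)
  have : Nonempty (Fin n × Fin p) := ⟨(⟨0, hS.n_pos⟩, ⟨0, hS.p_pos⟩)⟩
  -- The sign of the velocity error is reversed to obtain the negative mixed term.
  have h := lamMin_scalarBlocks_le (ι := Fin n × Fin p) (1 / 4 * G.η * lamMin (D.X p A))
    (1 / 2 * G.μ⁻¹ * D.γmin * (k.km - D.δ)) (1 / 2 * D.γmin * (k.km - D.δ))
    (stackNorm e) (-stackNorm v)
  rw [← Design.Nmat_eq_scalarBlocks, neg_sq] at h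
  linarith

end Lyapunov

/-! ### The Lyapunov function along solutions -/

section Derivative

variable {n p : ℕ} {D : Design n} {A : Matrix (Fin (n + 1)) (Fin (n + 1)) ℝ}
  {B : ℝ → Matrix (Fin (n + 1)) (Fin (n + 1)) ℝ} {k : Bounds} {G : Gains} {ω₁ ω₂ : ℝ}
  {agents : Fin n → Agent p} {l : Leader p} {z : ℝ → State n p} {ϑ ε : ℝ}

lemma relSum_eq_sum_lap22 (x₀ : Coord p) (x : Stack n p) (i : Fin n) :
    relSum A x₀ x i = ∑ j, lap22 A i j • (x j - x₀) := by
  rw [sum_lap22_smul A (fun j => x j - x₀) i, relSum]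
  refine Finset.sum_congr rfl fun j _ => ?_
  congr 1
  refine Fin.cases ?_ (fun j => ?_) j
  · simp [withLeader]
  · simp [withLeader]

lemma transpose_symPart : (D.symPart A)ᵀ = D.symPart A := by
  rw [Design.symPart, Matrix.transpose_add, Matrix.transpose_mul, Matrix.transpose_mul,
    Matrix.transpose_transpose, Matrix.diagonal_transpose, add_comm]

lemma sum_inner_lap22 (u : Stack n p) :
    ∑ i, D.γ i * inner ℝ (u i) (∑ j, lap22 A i j • u j)
      = 1 / 2 * stackForm (D.symPart A) u u := by
  have h1 : ∑ i, D.γ i * inner ℝ (u i) (∑ j, lap22 A i j • u j)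
      = ∑ i, ∑ j, D.γ i * lap22 A i j * inner ℝ (u i) (u j) := by
    refine Finset.sum_congr rfl fun i _ => ?_
    rw [inner_sum, Finset.mul_sum]
    refine Finset.sum_congr rfl fun j _ => ?_
    rw [inner_smul_right]
    ring
  have h2 : ∑ i, ∑ j, D.γ i * lap22 A i j * inner ℝ (u i) (u j)
      = ∑ i, ∑ j, lap22 A j i * D.γ j * inner ℝ (u i) (u j) := by
    rw [Finset.sum_comm]
    refine Finset.sum_congr rfl fun i _ => Finset.sum_congr rfl fun j _ => ?_
    rw [real_inner_comm]
    ring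
  have h3 : stackForm (D.symPart A) u u
      = ∑ i, ∑ j, D.γ i * lap22 A i j * inner ℝ (u i) (u j)
        + ∑ i, ∑ j, lap22 A j i * D.γ j * inner ℝ (u i) (u j) := by
    simp only [stackForm, ← Finset.sum_add_distrib]
    refine Finset.sum_congr rfl fun i _ => Finset.sum_congr rfl fun j _ => ?_
    rw [Design.symPart, Matrix.add_apply, Matrix.diagonal_mul, Matrix.mul_diagonal,
      Matrix.transpose_apply]
    ring
  rw [h3, ← h2, h1]
  ring

/-- The combined error `e + μ v` on which the control law acts. -/
noncomputable def combErr (G : Gains) (l : Leader p) (z : ℝ → State n p) (t : ℝ) : Stack n p :=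
  fun i => posErr l z t i + G.μ • velErr l z t i

/-- The Lyapunov function along a curve. -/
noncomputable def lyapunovAlong (D : Design n) (A : Matrix (Fin (n + 1)) (Fin (n + 1)) ℝ)
    (G : Gains) (agents : Fin n → Agent p) (l : Leader p) (z : ℝ → State n p) (t : ℝ) : ℝ :=
  lyapunov D A G agents (z t).1 (posErr l z t) (velErr l z t)

/-- Differentiation of the Lyapunov function; the relation `Ṁ = C + Cᵀ` turns the derivative of
the inertia matrix into Coriolis terms. -/
lemma hasDerivAt_lyapunovAlong (hag : ∀ i, (agents i).Satisfies k) (hl : l.Satisfies n k) {t : ℝ}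
    (ht : 0 < t) {w : State n p} (hd : HasDerivAt z w t) (hw : w.1 = (z t).2.1) :
    HasDerivAt (lyapunovAlong D A G agents l z)
      (G.η * stackForm (D.symPart A) (posErr l z t) (velErr l z t)
        + ∑ i, D.γ i * (inner ℝ (velErr l z t i)
            ((agents i).M ((z t).1 i) (w.2.1 i - l.ddq t)
              + (agents i).C ((z t).1 i) ((z t).2.1 i) (velErr l z t i))
          + G.μ⁻¹ * (inner ℝ (velErr l z t i) ((agents i).M ((z t).1 i) (velErr l z t i))
            + inner ℝ ((agents i).C ((z t).1 i) ((z t).2.1 i) (posErr l z t i)) (velErr l z t i)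
            + inner ℝ (posErr l z t i) ((agents i).M ((z t).1 i) (w.2.1 i - l.ddq t)
              + (agents i).C ((z t).1 i) ((z t).2.1 i) (velErr l z t i))))) t := by
  have hq : ∀ i, HasDerivAt (fun s => (z s).1 i) ((z t).2.1 i) t := fun i => by
    rw [← hw]
    exact HasDerivAt.clm hd (posCLM i)
  have he : ∀ i, HasDerivAt (fun s => posErr l z s i) (velErr l z t i) t := fun i =>
    (hq i).fun_sub (Leader.hasDerivAt_q hl ht)
  have hv : ∀ i, HasDerivAt (fun s => velErr l z s i) (w.2.1 i - l.ddq t) t := fun i =>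
    (HasDerivAt.clm hd (velCLM i)).fun_sub (Leader.hasDerivAt_dq hl ht)
  have hM : ∀ i, HasDerivAt (fun s => (agents i).M ((z s).1 i))
      ((agents i).C ((z t).1 i) ((z t).2.1 i)
        + ContinuousLinearMap.adjoint ((agents i).C ((z t).1 i) ((z t).2.1 i))) t := fun i => by
    rw [← (hag i).skew]
    exact ((hag i).smooth_M.differentiable one_ne_zero _).hasFDerivAt.comp_hasDerivAt t (hq i)
  have hMv := fun i => (hM i).clm_apply (hv i)
  have hX : HasDerivAt
      (fun s => 1 / 2 * G.η * stackForm (D.symPart A) (posErr l z s) (posErr l z s))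
      (G.η * stackForm (D.symPart A) (posErr l z t) (velErr l z t)) t := by
    have h1 := HasDerivAt.fun_sum (u := Finset.univ) fun i _ =>
      HasDerivAt.fun_sum (u := Finset.univ) fun j _ =>
        ((he i).inner ℝ (he j)).const_mul (D.symPart A i j)
    refine (h1.const_mul (1 / 2 * G.η)).congr_deriv ?_
    have h2 : ∑ i, ∑ j, D.symPart A i j * inner ℝ (velErr l z t i) (posErr l z t j)
        = stackForm (D.symPart A) (posErr l z t) (velErr l z t) := by
      rw [stackForm, Finset.sum_comm]
      refine Finset.sum_congr rfl fun i _ => Finset.sum_congr rfl fun j _ => ?_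
      rw [real_inner_comm, ← Matrix.transpose_apply (D.symPart A), transpose_symPart]
    simp only [mul_add, Finset.sum_add_distrib]
    rw [h2, ← stackForm]
    ring
  refine hX.add (HasDerivAt.fun_sum (u := Finset.univ) fun i _ => ?_)
  refine HasDerivAt.const_mul (D.γ i) ?_
  refine ((((hv i).inner ℝ (hMv i)).const_mul (1 / 2)).fun_add
    (((he i).inner ℝ (hMv i)).const_mul G.μ⁻¹)).congr_deriv ?_
  simp only [add_apply, inner_add_right, ContinuousLinearMap.adjoint_inner_right]
  rw [Agent.inner_M_comm (hag i) _ (w.2.1 i - l.ddq t),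
    real_inner_comm (velErr l z t i) ((agents i).C _ _ (velErr l z t i))]
  ring

/-- The derivative of the Lyapunov function along the closed loop, in which the mixed terms in `X`
have cancelled. -/
lemma exists_hasDerivAt_lyapunovAlong (hag : ∀ i, (agents i).Satisfies k)
    (hl : l.Satisfies n k) (hμ : 0 < G.μ) {t : ℝ} (ht : 0 < t) {w : State n p}
    (hd : HasDerivAt z w t) (hw : IsClosedLoopValue A B G ω₁ ω₂ agents l t (z t) w) :
    ∃ (V' : ℝ) (σ : Stack n p), HasDerivAt (lyapunovAlong D A G agents l z) V' t ∧
      (∀ i c, IsSign (σ i c) ((((z t).1 i - (z t).2.2.1 i)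
        + G.μ • ((z t).2.1 i - (z t).2.2.2 i)) c)) ∧
      G.μ * V' = -(1 / 2 * G.η * stackForm (D.symPart A) (posErr l z t) (posErr l z t))
        - 1 / 2 * G.η * G.μ ^ 2 * stackForm (D.symPart A) (velErr l z t) (velErr l z t)
        + ∑ i, D.γ i * (inner ℝ (velErr l z t i) ((agents i).M ((z t).1 i) (velErr l z t i))
          + inner ℝ ((agents i).C ((z t).1 i) ((z t).2.1 i) (posErr l z t i)) (velErr l z t i)
          - inner ℝ (combErr G l z t i) (G.β • σ i + (agents i).g ((z t).1 i) + (agents i).ζ t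
            + (agents i).M ((z t).1 i) (l.ddq t)
            + (agents i).C ((z t).1 i) ((z t).2.1 i) (l.dq t))) := by
  choose σ hσ hforce using hw.velocity
  refine ⟨_, σ, hasDerivAt_lyapunovAlong hag hl ht hd hw.position, hσ, ?_⟩
  have hMα : ∀ i, (agents i).M ((z t).1 i) (w.2.1 i - l.ddq t)
      + (agents i).C ((z t).1 i) ((z t).2.1 i) (velErr l z t i)
      = -(G.η • ∑ j, lap22 A i j • combErr G l z t j)
        - (G.β • σ i + (agents i).g ((z t).1 i) + (agents i).ζ t
            + (agents i).M ((z t).1 i) (l.ddq t)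
            + (agents i).C ((z t).1 i) ((z t).2.1 i) (l.dq t)) := by
    intro i
    have h1 : relSum A (l.q t) (z t).1 i + G.μ • relSum A (l.dq t) (z t).2.1 i
        = ∑ j, lap22 A i j • combErr G l z t j := by
      rw [relSum_eq_sum_lap22, relSum_eq_sum_lap22, Finset.smul_sum, ← Finset.sum_add_distrib]
      refine Finset.sum_congr rfl fun j _ => ?_
      rw [combErr, smul_add, smul_comm G.μ]
      rfl
    rw [map_sub, hforce i, smoothForce, h1, velErr, map_sub]
    abel
  have hterm : ∀ i, G.μ * (D.γ i * (inner ℝ (velErr l z t i)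
        ((agents i).M ((z t).1 i) (w.2.1 i - l.ddq t)
          + (agents i).C ((z t).1 i) ((z t).2.1 i) (velErr l z t i))
      + G.μ⁻¹ * (inner ℝ (velErr l z t i) ((agents i).M ((z t).1 i) (velErr l z t i))
        + inner ℝ ((agents i).C ((z t).1 i) ((z t).2.1 i) (posErr l z t i)) (velErr l z t i)
        + inner ℝ (posErr l z t i) ((agents i).M ((z t).1 i) (w.2.1 i - l.ddq t)
          + (agents i).C ((z t).1 i) ((z t).2.1 i) (velErr l z t i)))))
      = -(G.η * (D.γ i * inner ℝ (combErr G l z t i) (∑ j, lap22 A i j • combErr G l z t j)))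
        + D.γ i * (inner ℝ (velErr l z t i) ((agents i).M ((z t).1 i) (velErr l z t i))
          + inner ℝ ((agents i).C ((z t).1 i) ((z t).2.1 i) (posErr l z t i)) (velErr l z t i)
          - inner ℝ (combErr G l z t i) (G.β • σ i + (agents i).g ((z t).1 i) + (agents i).ζ t
            + (agents i).M ((z t).1 i) (l.ddq t)
            + (agents i).C ((z t).1 i) ((z t).2.1 i) (l.dq t))) := by
    intro i
    rw [hMα i]
    generalize G.β • σ i + (agents i).g ((z t).1 i) + (agents i).ζ t
      + (agents i).M ((z t).1 i) (l.ddq t)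
      + (agents i).C ((z t).1 i) ((z t).2.1 i) (l.dq t) = F
    generalize (∑ j, lap22 A i j • combErr G l z t j) = U
    simp only [combErr, inner_add_left, inner_sub_right, inner_neg_right, inner_smul_left,
      inner_smul_right, conj_trivial]
    field_simp
    ring
  rw [mul_add, Finset.mul_sum, Finset.sum_congr rfl fun i _ => hterm i, Finset.sum_add_distrib,
    Finset.sum_neg_distrib, ← Finset.mul_sum, sum_inner_lap22]
  have hu := stackForm_add_smul (transpose_symPart (D := D) (A := A)) (posErr l z t)
    (velErr l z t) G.μ
  change stackForm _ (combErr G l z t) (combErr G l z t) = _ at hu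
  rw [hu]
  ring

/-- The estimate of `W = μ V̇` with the signum terms left explicit. The quadratic and cubic terms
are collected in `g`. -/
lemma mul_deriv_lyapunov_le (hS : D.Standing p A k) (hG : D.GainInequalities p A k G ϑ ε)
    (hag : ∀ i, (agents i).Satisfies k) (hl : l.Satisfies n k) {t : ℝ} (ht : 0 < t)
    {σ : Stack n p} {W : ℝ}
    (hW : W = -(1 / 2 * G.η * stackForm (D.symPart A) (posErr l z t) (posErr l z t))
        - 1 / 2 * G.η * G.μ ^ 2 * stackForm (D.symPart A) (velErr l z t) (velErr l z t)
        + ∑ i, D.γ i * (inner ℝ (velErr l z t i) ((agents i).M ((z t).1 i) (velErr l z t i))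
          + inner ℝ ((agents i).C ((z t).1 i) ((z t).2.1 i) (posErr l z t i)) (velErr l z t i)
          - inner ℝ (combErr G l z t i) (G.β • σ i + (agents i).g ((z t).1 i) + (agents i).ζ t
            + (agents i).M ((z t).1 i) (l.ddq t)
            + (agents i).C ((z t).1 i) ((z t).2.1 i) (l.dq t)))) :
    W ≤ -D.gFun p A k G (stackNorm (posErr l z t)) (stackNorm (velErr l z t))
      + ∑ i, D.γ i * ((k.kC * (k.kp / Real.sqrt n) ^ 2 + k.kg + k.kζ
          + k.kM * (k.kq / Real.sqrt n)) * ‖combErr G l z t i‖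
        - G.β * inner ℝ (combErr G l z t i) (σ i)) := by
  have hη : 0 < G.η := one_pos.trans hG.η_gt
  have hμ : 0 < G.μ := (Design.μ₃_pos hS).trans_le hG.μ_ge
  have hkM : 0 < k.kM := hS.valid.km_pos.trans_le hS.valid.km_le_kM
  have hkC := hS.valid.kC_pos
  have hkp := hS.valid.kp_pos
  have hn1 : 1 ≤ Real.sqrt n := Real.one_le_sqrt.2 (by exact_mod_cast hS.n_pos)
  set a := k.kp / Real.sqrt n with ha
  set b := k.kq / Real.sqrt n with hb
  have ha0 : 0 ≤ a := by positivity
  have hap : a ≤ k.kp := div_le_self hkp.le hn1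
  have hdq : ‖l.dq t‖ ≤ a := norm_le_div_sqrt hS.n_pos (hl.bound_dq t ht.le)
  have hddq : ‖l.ddq t‖ ≤ b := norm_le_div_sqrt hS.n_pos (hl.bound_ddq t ht.le)
  set e := posErr l z t with he
  set v := velErr l z t with hv
  set u := combErr G l z t with hu
  set x := stackNorm e with hx
  set y := stackNorm v with hy
  have hx0 : 0 ≤ x := stackNorm_nonneg e
  have hy0 : 0 ≤ y := stackNorm_nonneg v
  have hux : stackNorm u ≤ x + G.μ * y := stackNorm_add_smul_le e v hμ.le
  have hterm : ∀ i, D.γ i * (inner ℝ (v i) ((agents i).M ((z t).1 i) (v i))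
          + inner ℝ ((agents i).C ((z t).1 i) ((z t).2.1 i) (e i)) (v i)
          - inner ℝ (u i) (G.β • σ i + (agents i).g ((z t).1 i) + (agents i).ζ t
            + (agents i).M ((z t).1 i) (l.ddq t)
            + (agents i).C ((z t).1 i) ((z t).2.1 i) (l.dq t)))
      ≤ (k.kM * ‖v i‖ ^ 2 + k.kC * (x * ‖v i‖ ^ 2) + k.kC * k.kp * (‖e i‖ * ‖v i‖)
          + k.kC * k.kp * (‖u i‖ * ‖v i‖))
        + D.γ i * ((k.kC * a ^ 2 + k.kg + k.kζ + k.kM * b) * ‖u i‖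
          - G.β * inner ℝ (u i) (σ i)) := by
    intro i
    set q := (z t).1 i
    set dq := (z t).2.1 i with hdqi
    have hvel : ‖dq‖ ≤ ‖v i‖ + a := by
      have h : dq = v i + l.dq t := by rw [hv, velErr, sub_add_cancel]
      rw [h]
      exact (norm_add_le _ _).trans (by linarith)
    have hCn : ‖(agents i).C q dq‖ ≤ k.kC * (‖v i‖ + a) :=
      ((hag i).bound_C q dq).trans (mul_le_mul_of_nonneg_left hvel hkC.le)
    have h1 := (hag i).upper q (v i)
    have h2 : inner ℝ ((agents i).C q dq (e i)) (v i)
        ≤ k.kC * (x * ‖v i‖ ^ 2) + k.kC * k.kp * (‖e i‖ * ‖v i‖) := by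
      have f1 := real_inner_le_norm ((agents i).C q dq (e i)) (v i)
      have f2 := mul_le_mul_of_nonneg_right
        (((agents i).C q dq).le_of_opNorm_le hCn (e i)) (norm_nonneg (v i))
      have f3 := mul_le_mul_of_nonneg_right (norm_le_stackNorm e i)
        (mul_nonneg hkC.le (sq_nonneg ‖v i‖))
      have f4 := mul_le_mul_of_nonneg_right hap
        (mul_nonneg hkC.le (mul_nonneg (norm_nonneg (e i)) (norm_nonneg (v i))))
      linarith
    have h3 : -inner ℝ (u i) ((agents i).g q) ≤ k.kg * ‖u i‖ := by
      have f1 := neg_le_of_abs_le (abs_real_inner_le_norm (u i) ((agents i).g q))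
      have f2 := mul_le_mul_of_nonneg_left ((hag i).bound_g q).le (norm_nonneg (u i))
      linarith
    have h4 : -inner ℝ (u i) ((agents i).ζ t) ≤ k.kζ * ‖u i‖ := by
      have f1 := neg_le_of_abs_le (abs_real_inner_le_norm (u i) ((agents i).ζ t))
      have f2 := mul_le_mul_of_nonneg_left ((hag i).bound_ζ t ht.le) (norm_nonneg (u i))
      linarith
    have h5 : -inner ℝ (u i) ((agents i).M q (l.ddq t)) ≤ k.kM * b * ‖u i‖ := by
      have f1 := Agent.inner_M_le (hag i) q (-u i) (l.ddq t)
      rw [inner_neg_left, norm_neg] at f1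
      have f2 := mul_le_mul_of_nonneg_left hddq (mul_nonneg hkM.le (norm_nonneg (u i)))
      linarith
    have h6 : -inner ℝ (u i) ((agents i).C q dq (l.dq t))
        ≤ k.kC * k.kp * (‖u i‖ * ‖v i‖) + k.kC * a ^ 2 * ‖u i‖ := by
      have f1 := neg_le_of_abs_le (abs_real_inner_le_norm (u i) ((agents i).C q dq (l.dq t)))
      have f2 : ‖(agents i).C q dq (l.dq t)‖ ≤ k.kC * (‖v i‖ + a) * a :=
        (((agents i).C q dq).le_of_opNorm_le hCn (l.dq t)).trans
          (mul_le_mul_of_nonneg_left hdq (by positivity))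
      have f3 := mul_le_mul_of_nonneg_left f2 (norm_nonneg (u i))
      have f4 := mul_le_mul_of_nonneg_right hap
        (mul_nonneg hkC.le (mul_nonneg (norm_nonneg (u i)) (norm_nonneg (v i))))
      linarith
    have hγ0 := (hS.adm.γ_pos i).le
    have hγ1 := hS.adm.γ_le_one i
    have hpos : 0 ≤ k.kM * ‖v i‖ ^ 2 + k.kC * (x * ‖v i‖ ^ 2) + k.kC * k.kp * (‖e i‖ * ‖v i‖)
        + k.kC * k.kp * (‖u i‖ * ‖v i‖) := by positivity
    refine le_trans (mul_le_mul_of_nonneg_left (c := (k.kM * ‖v i‖ ^ 2 + k.kC * (x * ‖v i‖ ^ 2)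
        + k.kC * k.kp * (‖e i‖ * ‖v i‖) + k.kC * k.kp * (‖u i‖ * ‖v i‖))
        + ((k.kC * a ^ 2 + k.kg + k.kζ + k.kM * b) * ‖u i‖ - G.β * inner ℝ (u i) (σ i))) ?_ hγ0) ?_
    · simp only [inner_add_right, inner_smul_right]
      linarith
    · rw [mul_add]
      linarith [mul_le_of_le_one_left hpos hγ1]
  have hsum := Finset.sum_le_sum fun i (_ : i ∈ Finset.univ) => hterm i
  simp only [Finset.sum_add_distrib, ← Finset.mul_sum] at hsum
  rw [← stackNorm_sq, ← hy] at hsum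
  have g1 := mul_le_mul_of_nonneg_left (sum_norm_mul_norm_le e v) (mul_pos hkC hkp).le
  have g2 := mul_le_mul_of_nonneg_left ((sum_norm_mul_norm_le u v).trans
    (mul_le_mul_of_nonneg_right hux hy0)) (mul_pos hkC hkp).le
  have g3 := mul_le_mul_of_nonneg_left (Design.lamMin_X_mul_le hS.adm.posDef e) hη.le
  have g4 := mul_le_mul_of_nonneg_left (Design.lamMin_X_mul_le hS.adm.posDef v)
    (mul_nonneg hη.le (sq_nonneg G.μ))
  rw [← hx, ← hy] at g1
  rw [← hx] at g3
  rw [← hy] at g4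
  rw [hW, Design.gFun, Design.φ]
  linarith

/-- Without information on the estimates the signum terms count as disturbances. Here `W` stands for
`μ V̇`. -/
lemma mul_deriv_lyapunov_le_pFun (hS : D.Standing p A k)
    (hβ : 0 < G.β) {e v σ : Stack n p} {W x y : ℝ} (hσ : ∀ i c, |σ i c| ≤ 1)
    (hx : stackNorm (fun i => e i + G.μ • v i) ≤ x + G.μ * y)
    (hW : W ≤ -D.gFun p A k G x y + ∑ i, D.γ i * ((k.kC * (k.kp / Real.sqrt n) ^ 2 + k.kg + k.kζ
          + k.kM * (k.kq / Real.sqrt n)) * ‖e i + G.μ • v i‖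
        - G.β * inner ℝ (e i + G.μ • v i) (σ i))) :
    W ≤ -D.pFun p A k G x y := by
  have hkM : 0 < k.kM := hS.valid.km_pos.trans_le hS.valid.km_le_kM
  have hkC := hS.valid.kC_pos
  have hkp := hS.valid.kp_pos
  have hkg := hS.valid.kg_pos
  have hkζ := hS.valid.kζ_nonneg
  have hkq := hS.valid.kq_pos
  have hn1 : 1 ≤ Real.sqrt n := Real.one_le_sqrt.2 (by exact_mod_cast hS.n_pos)
  have hn0 : 0 < Real.sqrt n := one_pos.trans_le hn1
  set c := k.kC * (k.kp / Real.sqrt n) ^ 2 + k.kg + k.kζ + k.kM * (k.kq / Real.sqrt n) with hc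
  have hc0 : 0 ≤ c := by positivity
  set u : Stack n p := fun i => e i + G.μ • v i with hu
  have hterm : ∀ i, D.γ i * (c * ‖u i‖ - G.β * inner ℝ (u i) (σ i))
      ≤ (c + G.β * Real.sqrt p) * ‖u i‖ := by
    intro i
    have h1 := neg_le_of_abs_le (abs_real_inner_le_norm (u i) (σ i))
    have h2 := mul_le_mul_of_nonneg_left (norm_le_sqrt_of_abs_le_one (hσ i)) (norm_nonneg (u i))
    have h3 := mul_le_mul_of_nonneg_left (h2.trans' (neg_le.1 h1)) hβ.le
    refine (mul_le_mul_of_nonneg_left (c := (c + G.β * Real.sqrt p) * ‖u i‖) (by linarith)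
      (hS.adm.γ_pos i).le).trans (mul_le_of_le_one_left (by positivity) (hS.adm.γ_le_one i))
  have hsum := Finset.sum_le_sum fun i (_ : i ∈ Finset.univ) => hterm i
  rw [← Finset.mul_sum] at hsum
  have h1 := mul_le_mul_of_nonneg_left ((sum_norm_le u).trans
    (mul_le_mul_of_nonneg_left hx hn0.le)) (show 0 ≤ c + G.β * Real.sqrt p by positivity)
  have h2 : (c + G.β * Real.sqrt p) * Real.sqrt n ≤ Design.linCoeff n p k G := by
    have e1 : Real.sqrt (n * p) = Real.sqrt n * Real.sqrt p := Real.sqrt_mul (Nat.cast_nonneg n) _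
    have e2 : k.kC * (k.kp / Real.sqrt n) ^ 2 * Real.sqrt n ≤ k.kC * k.kp ^ 2 := by
      have : k.kC * (k.kp / Real.sqrt n) ^ 2 * Real.sqrt n = k.kC * k.kp ^ 2 / Real.sqrt n := by
        field_simp
      rw [this]
      exact div_le_self (by positivity) hn1
    have e3 : k.kM * (k.kq / Real.sqrt n) * Real.sqrt n = k.kM * k.kq := by
      field_simp
    rw [Design.linCoeff, e1, hc]
    linarith
  have h3 := mul_le_mul_of_nonneg_right h2 ((stackNorm_nonneg u).trans hx)
  rw [Design.pFun]
  linarith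

/-- With exact estimates the signum terms dominate the disturbances, since `⟪u, σ⟫` is then the
`ℓ¹`-norm of `u`. Here `W` stands for `μ V̇`. -/
lemma mul_deriv_lyapunov_le_gFun (hS : D.Standing p A k) (hG : D.GainInequalities p A k G ϑ ε)
    {u σ : Stack n p} {W g : ℝ} (hσ : ∀ i c, IsSign (σ i c) (u i c))
    (hW : W ≤ -g + ∑ i, D.γ i * ((k.kC * (k.kp / Real.sqrt n) ^ 2 + k.kg + k.kζ
          + k.kM * (k.kq / Real.sqrt n)) * ‖u i‖ - G.β * inner ℝ (u i) (σ i))) :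
    W ≤ -g := by
  have hkM : 0 < k.kM := hS.valid.km_pos.trans_le hS.valid.km_le_kM
  have hkC := hS.valid.kC_pos
  have hkp := hS.valid.kp_pos
  have hkg := hS.valid.kg_pos
  have hkζ := hS.valid.kζ_nonneg
  have hkq := hS.valid.kq_pos
  have hn1 : 1 ≤ Real.sqrt n := Real.one_le_sqrt.2 (by exact_mod_cast hS.n_pos)
  have hβ : k.kC * (k.kp / Real.sqrt n) ^ 2 + k.kg + k.kζ + k.kM * (k.kq / Real.sqrt n) ≤ G.β := by
    have h1 : k.kp / Real.sqrt n ≤ k.kp := div_le_self hkp.le hn1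
    have h2 : k.kq / Real.sqrt n ≤ k.kq := div_le_self hkq.le hn1
    have h3 : k.kC * (k.kp / Real.sqrt n) ^ 2 ≤ k.kC * k.kp ^ 2 := by gcongr
    have h4 : k.kM * (k.kq / Real.sqrt n) ≤ k.kM * k.kq := by gcongr
    have h5 := Design.γmin_pos hS.n_pos hS.adm.γ_pos
    have h6 : D.γmin ≤ 1 := (Design.γmin_le ⟨0, hS.n_pos⟩).trans (hS.adm.γ_le_one _)
    have h7 : k.kC * k.kp ^ 2 + (k.kg + k.kζ + k.kM * k.kq) ≤ D.βlow k := by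
      rw [Design.βlow, le_div_iff₀ h5]
      exact mul_le_of_le_one_right (by positivity) h6
    linarith [hG.β_gt]
  have hβ0 : 0 ≤ G.β := le_trans (by positivity) hβ
  have hin : ∀ i, ‖u i‖ ≤ inner ℝ (u i) (σ i) := by
    intro i
    have h1 : inner ℝ (u i) (σ i) = ∑ c, |u i c| := by
      rw [PiLp.inner_apply]
      refine Finset.sum_congr rfl fun c _ => ?_
      rw [RCLike.inner_apply, conj_trivial]
      exact (hσ i c).2
    have h0 : ∀ c ∈ Finset.univ, 0 ≤ |u i c| := fun c _ => abs_nonneg _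
    rw [h1, EuclideanSpace.norm_eq]
    refine Real.sqrt_le_iff.2 ⟨Finset.sum_nonneg h0, ?_⟩
    simp only [Real.norm_eq_abs]
    exact Finset.sum_sq_le_sq_sum_of_nonneg h0
  have hsum : ∑ i, D.γ i * ((k.kC * (k.kp / Real.sqrt n) ^ 2 + k.kg + k.kζ
          + k.kM * (k.kq / Real.sqrt n)) * ‖u i‖ - G.β * inner ℝ (u i) (σ i)) ≤ 0 := by
    refine Finset.sum_nonpos fun i _ => mul_nonpos_of_nonneg_of_nonpos (hS.adm.γ_pos i).le ?_
    have h1 := mul_le_mul_of_nonneg_right hβ (norm_nonneg (u i))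
    have h2 := mul_le_mul_of_nonneg_left (hin i) hβ0
    linarith
  linarith

end Derivative

/-! ### Boundedness, exponential decay and tracking -/

section Tracking

variable {n p : ℕ} {D : Design n} {A : Matrix (Fin (n + 1)) (Fin (n + 1)) ℝ}
  {B : ℝ → Matrix (Fin (n + 1)) (Fin (n + 1)) ℝ} {k : Bounds} {G : Gains} {ω₁ ω₂ : ℝ}
  {agents : Fin n → Agent p} {l : Leader p} {τ : EReal} {z : ℝ → State n p} {ϑ ε : ℝ}

lemma contDiff_lyapunov {E : Type*} [NormedAddCommGroup E] [NormedSpace ℝ E]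
    (hag : ∀ i, (agents i).Satisfies k) {q e v : Fin n → E → Coord p}
    (hq : ∀ i, ContDiff ℝ 1 (q i)) (he : ∀ i, ContDiff ℝ 1 (e i))
    (hv : ∀ i, ContDiff ℝ 1 (v i)) :
    ContDiff ℝ 1 fun s => lyapunov D A G agents (fun i => q i s) (fun i => e i s)
      (fun i => v i s) := by
  have hMv : ∀ i, ContDiff ℝ 1 fun s => (agents i).M (q i s) (v i s) := fun i =>
    ((hag i).smooth_M.comp (hq i)).clm_apply (hv i)
  unfold lyapunov stackForm
  refine ContDiff.add (contDiff_const.mul ?_) (ContDiff.sum fun i _ => contDiff_const.mul ?_)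
  · exact ContDiff.sum fun i _ => ContDiff.sum fun j _ =>
      contDiff_const.mul ((he i).inner ℝ (he j))
  · exact ContDiff.add (contDiff_const.mul ((hv i).inner ℝ (hMv i)))
      (contDiff_const.mul ((he i).inner ℝ (hMv i)))

/-- Absolute continuity of the Lyapunov function, with an arbitrary normed space in place of the
state space. -/
lemma absCont_lyapunov_comp {E : Type*} [NormedAddCommGroup E] [NormedSpace ℝ E]
    (hag : ∀ i, (agents i).Satisfies k) {a b : ℝ} {f : ℝ → E} {q₀ v₀ : ℝ → Coord p}
    (P V : Fin n → E →L[ℝ] Coord p) (hf : AbsolutelyContinuousOnInterval f a b)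
    (hq : AbsolutelyContinuousOnInterval q₀ a b) (hv : AbsolutelyContinuousOnInterval v₀ a b) :
    AbsolutelyContinuousOnInterval (fun t => lyapunov D A G agents (fun i => P i (f t))
      (fun i => P i (f t) - q₀ t) (fun i => V i (f t) - v₀ t)) a b := by
  have h₀ : ContDiff ℝ 1 fun s : E × Coord p × Coord p => s.2.1 :=
    contDiff_fst.comp contDiff_snd
  have h₁ : ContDiff ℝ 1 fun s : E × Coord p × Coord p => s.2.2 :=
    contDiff_snd.comp contDiff_snd
  have hP : ∀ i, ContDiff ℝ 1 fun s : E × Coord p × Coord p => P i s.1 :=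
    fun i => (P i).contDiff.comp contDiff_fst
  have hV : ∀ i, ContDiff ℝ 1 fun s : E × Coord p × Coord p => V i s.1 :=
    fun i => (V i).contDiff.comp contDiff_fst
  obtain ⟨Φ, hΦ, hΦs⟩ : ∃ Φ : E × Coord p × Coord p → ℝ, ContDiff ℝ 1 Φ ∧
      ∀ s, Φ s = lyapunov D A G agents (fun i => P i s.1) (fun i => P i s.1 - s.2.1)
        (fun i => V i s.1 - s.2.2) :=
    ⟨_, contDiff_lyapunov hag hP (fun i => (hP i).sub h₀) (fun i => (hV i).sub h₁), fun _ => rfl⟩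
  have h := absCont_contDiff_comp₃ hf hq hv hΦ
  simp only [hΦs] at h
  exact h

lemma absCont_lyapunovAlong (hag : ∀ i, (agents i).Satisfies k) {a b : ℝ}
    (hz : AbsolutelyContinuousOnInterval z a b) (hq : AbsolutelyContinuousOnInterval l.q a b)
    (hdq : AbsolutelyContinuousOnInterval l.dq a b) :
    AbsolutelyContinuousOnInterval (lyapunovAlong D A G agents l z) a b :=
  absCont_lyapunov_comp hag posCLM velCLM hz hq hdq

lemma gains_β_pos (hS : D.Standing p A k) (hG : D.GainInequalities p A k G ϑ ε) : 0 < G.β :=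
  (Design.βlow_nonneg hS).trans_lt hG.β_gt

lemma ae_deriv_lyapunovAlong_le (hS : D.Standing p A k) (hG : D.GainInequalities p A k G ϑ ε)
    (hag : ∀ i, (agents i).Satisfies k) (hl : l.Satisfies n k)
    (hz : IsClosedLoopSolution A B G ω₁ ω₂ agents l τ z) :
    ∀ᵐ t : ℝ, 0 < t → (t : EReal) < τ →
      deriv (lyapunovAlong D A G agents l z) t
        ≤ -(G.μ⁻¹ * D.pFun p A k G (stackNorm (posErr l z t)) (stackNorm (velErr l z t))) ∧
      ((∀ i, (z t).2.2.1 i = l.q t ∧ (z t).2.2.2 i = l.dq t) →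
        deriv (lyapunovAlong D A G agents l z) t
          ≤ -(G.μ⁻¹ * D.gFun p A k G (stackNorm (posErr l z t)) (stackNorm (velErr l z t)))) := by
  have hμ : 0 < G.μ := (Design.μ₃_pos hS).trans_le hG.μ_ge
  filter_upwards [hz.inclusion] with t hincl ht htτ
  obtain ⟨w, hw, hd⟩ := hincl ht htτ
  obtain ⟨V', σ, hV, hσ, hV'⟩ := exists_hasDerivAt_lyapunovAlong (D := D) hag hl hμ ht hd hw
  have hle := mul_deriv_lyapunov_le hS hG hag hl ht hV'
  have hdiv : ∀ r, G.μ * V' ≤ -r → V' ≤ -(G.μ⁻¹ * r) := fun r hr => by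
    rw [← mul_neg, ← div_eq_inv_mul, le_div_iff₀ hμ]
    linarith
  rw [hV.deriv]
  refine ⟨hdiv _ ?_, fun hex => hdiv _ ?_⟩
  · exact mul_deriv_lyapunov_le_pFun hS (gains_β_pos hS hG) (fun i c => (hσ i c).1)
      (stackNorm_add_smul_le _ _ hμ.le) hle
  · refine mul_deriv_lyapunov_le_gFun hS hG (u := combErr G l z t) (fun i c => ?_) hle
    have h := hσ i c
    rw [(hex i).1, (hex i).2] at h
    exact h

lemma initial_errors_le (hn : 0 < n) (h0 : InitialBounds k l (z 0)) :
    stackNorm (posErr l z 0) ≤ 2 * k.ka ∧ stackNorm (velErr l z 0) ≤ 2 * k.kb := by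
  have hs : 0 < Real.sqrt n := Real.sqrt_pos.2 (Nat.cast_pos.2 hn)
  have key : ∀ (x₀ : Coord p) (x : Stack n p) (r : ℝ),
      (∀ j, ‖withLeader x₀ x j‖ ≤ r / Real.sqrt n) → stackNorm (fun i => x i - x₀) ≤ 2 * r := by
    intro x₀ x r h
    have h1 : ∀ i, ‖x i - x₀‖ ≤ 2 * (r / Real.sqrt n) := fun i => by
      have h2 : ‖x i‖ ≤ r / Real.sqrt n := h i.succ
      have h3 : ‖x₀‖ ≤ r / Real.sqrt n := h 0
      linarith [norm_sub_le (x i) x₀]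
    have h4 : 0 ≤ r / Real.sqrt n := (norm_nonneg _).trans (h 0)
    refine (stackNorm_le_mul (by positivity) h1).trans_eq ?_
    field_simp
  exact ⟨key _ _ _ h0.pos, key _ _ _ h0.vel⟩

/-- The errors never leave the box `[0, 𝒳) × [0, 𝒴)`, which contains them while the Lyapunov
function is below `V̂*`. Above its upper bound on the inner box `[0, 𝒳 - ϑ] × [0, 𝒴 - ε]` the
errors lie in the boundary layers, where it decreases; both this bound and the initial value are
below `V̂*`. -/
lemma errors_lt (hS : D.Standing p A k) (hG : D.GainInequalities p A k G ϑ ε)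
    (hag : ∀ i, (agents i).Satisfies k) (hl : l.Satisfies n k)
    (hz : IsClosedLoopSolution A B G ω₁ ω₂ agents l τ z) (h0 : InitialBounds k l (z 0)) {t : ℝ}
    (ht : 0 ≤ t) (htτ : (t : EReal) < τ) :
    stackNorm (posErr l z t) < D.XX p A k G ∧ stackNorm (velErr l z t) < D.YY p A k G := by
  have hη := hG.η_gt.le
  have hη0 : 0 ≤ G.η := zero_le_one.trans hη
  have hμ : 0 < G.μ := (Design.μ₃_pos hS).trans_le hG.μ_ge
  set c := max (D.Vstar p A k G)
    (D.Vbound p A k G (D.XX p A k G - ϑ) (D.YY p A k G - ε)) with hc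
  have hcV : c < D.Vhat p A k G := by
    refine max_lt (Design.Vstar_lt_Vhat hS hη) ?_
    refine Design.Vbound_strictMono hS hη0 ?_ ?_ ?_ ?_ <;>
      linarith [hG.ϑ_gt, hG.ϑ_lt, hG.ε_gt, hG.ε_lt]
  have hbox : ∀ s, lyapunovAlong D A G agents l z s < D.Vhat p A k G →
      stackNorm (posErr l z s) < D.XX p A k G ∧ stackNorm (velErr l z s) < D.YY p A k G := by
    intro s hs
    constructor
    · refine Real.lt_sqrt_of_sq_lt ((lt_div_iff₀ (Design.ρ₂_pos hS hη)).2 ?_)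
      rw [mul_comm]
      exact (ρ₂_mul_sq_le_lyapunov hS hG hag _ _ _).trans_lt hs
    · refine Real.lt_sqrt_of_sq_lt ((lt_div_iff₀ (Design.σ₂_pos hS hη)).2 ?_)
      rw [mul_comm]
      exact (σ₂_mul_sq_le_lyapunov hS hG hag _ _ _).trans_lt hs
  have hinit : lyapunovAlong D A G agents l z 0 ≤ c := by
    obtain ⟨h1, h2⟩ := initial_errors_le hS.n_pos h0
    exact ((lyapunov_le_Vbound hS hG hag _ _ _).trans (Design.Vbound_mono hS hη0
      (stackNorm_nonneg _) (stackNorm_nonneg _) h1 h2)).trans (le_max_left _ _)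
  refine hbox t (lt_of_le_of_lt ?_ hcV)
  refine le_of_ae_deriv_nonpos_on_layer (absCont_lyapunovAlong hag (hz.abs_cont t ht htτ)
    (Leader.absCont_q hl hS.n_pos ht) (Leader.absCont_dq hl hS.n_pos ht)) hinit hcV ?_ t
    (right_mem_Icc.2 ht)
  filter_upwards [ae_deriv_lyapunovAlong_le hS hG hag hl hz] with s hs hsI hcs hsV
  have hsτ : (s : EReal) < τ := (EReal.coe_le_coe_iff.2 hsI.2.le).trans_lt htτ
  obtain ⟨hx, hy⟩ := hbox s hsV
  have hp := hG.p_pos _ ⟨stackNorm_nonneg (posErr l z s), hx.le⟩ _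
    ⟨stackNorm_nonneg (velErr l z s), hy.le⟩ (by
      by_contra! hsmall
      refine absurd hcs (not_lt.2 ?_)
      exact ((lyapunov_le_Vbound hS hG hag _ _ _).trans (Design.Vbound_mono hS hη0
        (stackNorm_nonneg _) (stackNorm_nonneg _) hsmall.1.le hsmall.2.le)).trans
        (le_max_right _ _))
  refine (hs hsI.1 hsτ).1.trans (neg_nonpos.2 ?_)
  positivity

lemma errNorm_nonneg (t : ℝ) : 0 ≤ errNorm l z t := Real.sqrt_nonneg _

lemma errNorm_sq (t : ℝ) :
    errNorm l z t ^ 2 = stackNorm (posErr l z t) ^ 2 + stackNorm (velErr l z t) ^ 2 :=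
  Real.sq_sqrt (by positivity)

lemma errNorm_le_exp (hS : D.Standing p A k) (hG : D.GainInequalities p A k G ϑ ε)
    (hag : ∀ i, (agents i).Satisfies k) (hl : l.Satisfies n k)
    (hz : IsClosedLoopSolution A B G ω₁ ω₂ agents l τ z) (h0 : InitialBounds k l (z 0))
    {T₁ : ℝ} (hT₁ : 0 ≤ T₁) (hex : ObserverExact l τ z T₁) {a₃ : ℝ}
    (ha₃ : D.IsDecayCoeff p A k G a₃) {t : ℝ} (ht : T₁ ≤ t) (htτ : (t : EReal) < τ) :
    errNorm l z t ≤
      Real.sqrt (lamMax (D.Lmat p A k G) / lamMin (D.Nmat p A k G)) * errNorm l z T₁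
        * Real.exp (-(a₃ / (2 * lamMax (D.Lmat p A k G))) * (t - T₁)) := by
  have ht0 := hT₁.trans ht
  have hL := lamMax_Lmat_pos (G := G) hS
  have hN := lamMin_Nmat_pos hS hG
  set ΛL := lamMax (D.Lmat p A k G) with hΛL
  set ΛN := lamMin (D.Nmat p A k G) with hΛN
  have hτ : ∀ {s : ℝ}, s ≤ t → (s : EReal) < τ := fun hst =>
    (EReal.coe_le_coe_iff.2 hst).trans_lt htτ
  have hAC := absCont_mono_Icc (absCont_lyapunovAlong (D := D) (A := A) (G := G) hag
    (hz.abs_cont t ht0 htτ) (Leader.absCont_q hl hS.n_pos ht0)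
    (Leader.absCont_dq hl hS.n_pos ht0)) hT₁ ht le_rfl
  have hexp := le_exp_of_ae_deriv_le (r := a₃ / ΛL) ht hAC (by
    filter_upwards [ae_deriv_lyapunovAlong_le hS hG hag hl hz] with s hs hsI
    have hs0 : 0 < s := hT₁.trans_lt hsI.1
    have hsτ := hτ hsI.2.le
    obtain ⟨hx, hy⟩ := errors_lt hS hG hag hl hz h0 hs0.le hsτ
    have h1 := (hs hs0 hsτ).2 (hex s hsI.1.le hsτ)
    have h2 := ha₃.2 _ ⟨stackNorm_nonneg (posErr l z s), hx.le⟩ _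
      ⟨stackNorm_nonneg (velErr l z s), hy.le⟩
    have h3 := mul_le_mul_of_nonneg_left (lyapunov_le_lamMax hS hG hag (z s).1 (posErr l z s)
      (velErr l z s)) (div_pos ha₃.1 hL).le
    rw [← hΛL, ← mul_assoc, div_mul_cancel₀ _ hL.ne'] at h3
    change _ ≤ -(a₃ / ΛL) * lyapunov D A G agents (z s).1 (posErr l z s) (velErr l z s)
    linarith)
  have hlow := lamMin_mul_le_lyapunov hS hG hag (z t).1 (posErr l z t) (velErr l z t)
  have hup := lyapunov_le_lamMax hS hG hag (z T₁).1 (posErr l z T₁) (velErr l z T₁)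
  rw [← errNorm_sq] at hlow hup
  have hE : Real.exp (-(a₃ / (2 * ΛL)) * (t - T₁)) ^ 2 = Real.exp (-(a₃ / ΛL) * (t - T₁)) := by
    rw [← Real.exp_nat_mul]
    congr 1
    push_cast
    field_simp
  have hsq : errNorm l z t ^ 2 ≤ (Real.sqrt (ΛL / ΛN) * errNorm l z T₁
      * Real.exp (-(a₃ / (2 * ΛL)) * (t - T₁))) ^ 2 := by
    rw [mul_pow, mul_pow, Real.sq_sqrt (div_pos hL hN).le, hE, div_mul_eq_mul_div,
      div_mul_eq_mul_div, le_div_iff₀ hN, mul_comm]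
    exact hlow.trans (hexp.trans (mul_le_mul_of_nonneg_right hup (Real.exp_pos _).le))
  refine le_of_sq_le_sq hsq ?_
  have := errNorm_nonneg (l := l) (z := z) T₁
  positivity

lemma trackingAchieved_of_errNorm_tendsto (h : Tendsto (errNorm l z) atTop (𝓝 0)) :
    TrackingAchieved l z := by
  intro i
  have h1 : ∀ t, ‖posErr l z t i‖ ≤ errNorm l z t := fun t =>
    (norm_le_stackNorm _ i).trans (Real.le_sqrt_of_sq_le (le_add_of_nonneg_right (sq_nonneg _)))
  have h2 : ∀ t, ‖velErr l z t i‖ ≤ errNorm l z t := fun t =>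
    (norm_le_stackNorm _ i).trans (Real.le_sqrt_of_sq_le (le_add_of_nonneg_left (sq_nonneg _)))
  exact ⟨squeeze_zero (fun t => norm_nonneg _) h1 h, squeeze_zero (fun t => norm_nonneg _) h2 h⟩

end Tracking

end LeaderTracking

open LeaderTracking in
theorem mainTheorem1 (n p : ℕ) (hn : 0 < n) (hp : 0 < p)
    (A : Matrix (Fin (n + 1)) (Fin (n + 1)) ℝ) (hA : IsAdjacency A) (hAtree : HasSpanningTree A)
    (k : Bounds) (hk : k.Valid) :
    (∃ D : Design n, D.Admissible p A k) ∧
    ∀ D : Design n, D.Admissible p A k →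
      (∀ β : ℝ, D.βlow k < β → ∀ μ : ℝ, D.μ₃ ≤ μ → D.μlow p A k < μ →
        ∃ η₀ : ℝ, ∀ η : ℝ, η₀ ≤ η → ∃ ϑ ε : ℝ, D.GainInequalities p A k ⟨μ, η, β⟩ ϑ ε) ∧
      ∀ (G : Gains) (ϑ ε : ℝ), D.GainInequalities p A k G ϑ ε →
        (∃ a₃ : ℝ, D.IsDecayCoeff p A k G a₃) ∧
        ∀ (agents : Fin n → Agent p) (l : Leader p)
          (B : ℝ → Matrix (Fin (n + 1)) (Fin (n + 1)) ℝ) (ω₁ ω₂ : ℝ)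
          (τ : EReal) (z : ℝ → State n p),
          (∀ i, (agents i).Satisfies k) → l.Satisfies n k →
          (∀ t, 0 ≤ t → IsAdjacency (B t) ∧ HasSpanningTree (B t)) →
          0 < ω₁ → k.kq / Real.sqrt n < ω₂ →
          0 < τ → IsFilippovSolution (closedLoop A B G ω₁ ω₂ agents l) τ z →
          InitialBounds k l (z 0) →
          (∀ t : ℝ, 0 ≤ t → (t : EReal) < τ →
            stackNorm (posErr l z t) < D.XX p A k G ∧
            stackNorm (velErr l z t) < D.YY p A k G) ∧
          (∃ T₁ : ℝ, 0 ≤ T₁ ∧ ObserverExact l τ z T₁) ∧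
          (∀ T₁ : ℝ, 0 ≤ T₁ → ObserverExact l τ z T₁ →
            ∀ a₃ : ℝ, D.IsDecayCoeff p A k G a₃ →
            ∀ t : ℝ, T₁ ≤ t → (t : EReal) < τ →
              errNorm l z t ≤
                Real.sqrt (lamMax (D.Lmat p A k G) / lamMin (D.Nmat p A k G)) * errNorm l z T₁
                  * Real.exp (-(a₃ / (2 * lamMax (D.Lmat p A k G))) * (t - T₁))) ∧
          (τ = ⊤ → TrackingAchieved l z) := by
  refine ⟨exists_admissible hn hA hAtree hk, fun D hD => ?_⟩
  have hS : D.Standing p A k := ⟨hn, hp, hk, hD⟩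
  refine ⟨fun β hβ μ hμ₃ hμ => Design.exists_gainInequalities hS hβ hμ₃ hμ,
    fun G ϑ ε hG => ?_⟩
  obtain ⟨a₃, ha₃⟩ := Design.exists_decayCoeff hS hG
  refine ⟨⟨a₃, ha₃⟩, fun agents l B ω₁ ω₂ τ z hag hl hB hω₁ hω₂ _ hz h0 => ?_⟩
  have hω₂0 : 0 < ω₂ := (div_nonneg hk.kq_pos.le (Real.sqrt_nonneg _)).trans_lt hω₂
  have hsol := IsFilippovSolution.isClosedLoopSolution hz hag (gains_β_pos hS hG) hω₁ hω₂0
  obtain ⟨T₁, hT₁, hex⟩ := exists_observerExact hn hsol hl hB hω₁ hω₂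
  refine ⟨fun t ht htτ => errors_lt hS hG hag hl hsol h0 ht htτ, ⟨T₁, hT₁, hex⟩,
    fun T hT hTex a ha t ht htτ => errNorm_le_exp hS hG hag hl hsol h0 hT hTex ha ht htτ, ?_⟩
  rintro rfl
  refine trackingAchieved_of_errNorm_tendsto ?_
  have hL := lamMax_Lmat_pos (G := G) hS
  have hr : 0 < a₃ / (2 * lamMax (D.Lmat p A k G)) := div_pos ha₃.1 (by positivity)
  have hexp : Tendsto (fun t =>
      Real.sqrt (lamMax (D.Lmat p A k G) / lamMin (D.Nmat p A k G)) * errNorm l z T₁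
        * Real.exp (-(a₃ / (2 * lamMax (D.Lmat p A k G))) * (t - T₁))) atTop (𝓝 0) := by
    have h1 : Tendsto (fun t => -(a₃ / (2 * lamMax (D.Lmat p A k G))) * (t - T₁)) atTop atBot :=
      (tendsto_atTop_add_const_right atTop (-T₁) tendsto_id).const_mul_atTop_of_neg
        (neg_neg_of_pos hr)
    simpa using (Real.tendsto_exp_atBot.comp h1).const_mul
      (Real.sqrt (lamMax (D.Lmat p A k G) / lamMin (D.Nmat p A k G)) * errNorm l z T₁)
  refine squeeze_zero' (Eventually.of_forall fun t => errNorm_nonneg t) ?_ hexp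
  filter_upwards [eventually_ge_atTop T₁] with t ht
  exact errNorm_le_exp hS hG hag hl hsol h0 hT₁ hex ha₃ ht (EReal.coe_lt_top t)
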